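/- Let $N\ge 2$ and let $\Xi_F=([N],\mathbf 1,\mathrm{wt})$ be a full passport: $\mathrm{wt}:[N]\to\mathbb R\setminus\{0\}$ with $\sum_{s}\mathrm{wt}(s)=0$. **Trees.** A labeled weighted bi-colored plane tree (LWBP-tree) of passport $\Xi_F$ is a tree with vertex set $[N]$, with a partition of the vertices into black and white ones such that every edge joins a black and a white vertex, with edge weights $W_E(e)>0$ such that $\mathrm{wt}(v)=\sum_{e\ni v}W_E(e)$ for black $v$ and $\mathrm{wt}(v)=-\sum_{e\ni v}W_E(e)$ for white $v$, and with a plane structure, given by a cyclic permutation $\sigma_v$ of the set $E(v)$ of edges at each vertex $v$ ("anticlockwise next edge"). Two such trees are identified iff all these data agree. $\mathbf TM(\Xi_F)$ is the set of twice-marked LWBP-trees $(T;a,b)$, $T$ an LWBP-tree of passport $\Xi_F$ and $a\ne b$ in $[N]$. **Tree permutations.** For a permutation $\underline P=(s_1,\dots,s_N)$ of $[N]$ let $H_i=\sum_{j\le i}\mathrm{wt}(s_j)$, $0\le i\le N$. It is a tree permutation, $\underline P\in\mathbf PT(\Xi_F)$, if (1) $H_i\ne 0$ for $1\le i\le N-1$;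 (2) whenever $1\le k<l\le N$ and $H_{k-1}=H_l>0$, then $\min\{H_k,\dots,H_{l-1}\}<H_l$; (3) whenever $1\le k<l\le N$ and $H_{k-1}=H_l<0$, then $\max\{H_k,\dots,H_{l-1}\}>H_l$. **Combing map.** Let $R(\underline P)=\bigcup_{i=1}^N[i,i+1]\times[\min\{0,H_i\},\max\{0,H_i\}]$. The $i$-th vertical line is the segment of $\{i\}\times\mathbb R$ between the heights $H_{i-1}$ and $H_i$. Extend each horizontal line $[i,i+1]\times\{H_i\}$ in both directions as far as it stays in $R(\underline P)$. These extended segments and the segment $[1,N]\times\{0\}$ cut $R(\underline P)$ into horizontal rectangles, each bounded on the left and right by two vertical lines. The graph $G(\underline P)$ has vertex set $[N]$, where $s_i$ corresponds to the $i$-th vertical line and is black iff $\mathrm{wt}(s_i)>0$; each horizontal rectangle between the $k$-th and $l$-th vertical lines is an edge between $s_k$ and $s_l$ whose weight is its height; and the cyclic order of the edges at $s_i$ is: rectangles attached to the right of the $i$-th vertical line from bottom to top, then those attached to its left from top to bottom. Put $\mathrm{Comb}(\underline P)=(G(\underline P);s_1,s_N)$. **Folding map.** Let $(T;a,b)\in\mathbf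 TM(\Xi_F)$ and let $a=\ell(0),\ell(1),\dots,\ell(M+1)=b$ be the path from $a$ to $b$ in $T$. Draw a rectangle for each edge as follows. The edge from $\ell(i)$ to $\ell(i+1)$ gets a rectangle over $[i,i+1]$ with height equal to its weight and one side on the x-axis, above the axis if $\ell(i)$ is black and below it if $\ell(i)$ is white; its left side belongs to $\ell(i)$ and its right side to $\ell(i+1)$. Then repeat: if the rectangle $\mathbf e^0$ of an edge $e^0$ at $w$ is drawn, where either $e^0$ is on the path and $w$ is any of its two ends, or $e^0$ is not on the path and $w$ is its end further from the path, let $e^1,e^2,\dots,e^\gamma$ be the edges following $e^0$ around $w$, anticlockwise if $w$ is black and clockwise if $w$ is white, up to but excluding the next edge of the path (or $e^0$ itself, whichever comes first). Stack their rectangles on $\mathbf e^0$ one after another in the direction away from the x-axis, the $i$-th one having height $W_E(e^i)$ and length $3^{-i}$ times that of $\mathbf e^0$, and aligned with $\mathbf e^0$ at the vertical side belonging to $w$. All rectangles of edges at a vertex $v$ then end at one vertical segment belonging to $v$; $\mathrm{Fold}(T;a,b)$ is the list of all vertices in increasing order of the x-coordinates of these segments. **Theorem.** $\mathrm{Comb}$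 maps $\mathbf PT(\Xi_F)$ bijectively onto $\mathbf TM(\Xi_F)$, and its inverse is $\mathrm{Fold}:\mathbf TM(\Xi_F)\to\mathbf PT(\Xi_F)$. -/

import Mathlib

/-! ## Full passports, permutations, plane trees -/

/-- A full passport with index set `[N]` (modelled by `Fin N`): the index set is nonempty, every
weight is a nonzero real number, all multiplicities are `1`, and the weights add up to `0`. -/
structure FullPassport (N : ℕ) where
  wt : Fin N → ℝ
  nonempty : 0 < N
  wt_ne_zero : ∀ s, wt s ≠ 0
  sum_wt : ∑ s, wt s = 0

/-- The data of a weighted bi-colored ribbon graph whose vertices are identified with their labels.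
* `black` is the set of black vertices, its complement the set of white vertices.
* `weight e` is the weight of the edge `e`.
* `rot v` is the cyclic action at `v`: an edge `{v, u}` at `v` is represented by its other endpoint
  `u`, and `rot v u` is the other endpoint of the anticlockwise next edge around `v`.

As the labels are part of the vertices, a label preserving isomorphism is the identity on vertices,
so that isomorphism of such objects is equality. -/
@[ext]
structure RibbonGraph (N : ℕ) where
  graph : SimpleGraph (Fin N)
  black : Set (Fin N)
  weight : Sym2 (Fin N) → ℝ
  rot : Fin N → Equiv.Perm (Fin N)

/-- A ribbon graph with two marked vertices `(G; a, b)`. -/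
@[ext]
structure MarkedRibbonGraph (N : ℕ) where
  G : RibbonGraph N
  a : Fin N
  b : Fin N

/-- `G` is a labeled weighted bi-colored plane forest of passport `Ξ`. The fields `weight_eq_zero`
and `rot_eq_self` only fix the values of `weight` and `rot` outside their domains: on pairs that are
not edges, and on edges that are not at `v`. -/
structure FullPassport.IsForest {N : ℕ} (Ξ : FullPassport N) (G : RibbonGraph N) : Prop where
  acyclic : G.graph.IsAcyclic
  bicolored : ∀ u v, G.graph.Adj u v → (u ∈ G.black ↔ v ∉ G.black)
  weight_pos : ∀ e ∈ G.graph.edgeSet, 0 < G.weight e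
  weight_eq_zero : ∀ e ∉ G.graph.edgeSet, G.weight e = 0
  rot_isCycleOn : ∀ v, (G.rot v).IsCycleOn (G.graph.neighborSet v)
  rot_eq_self : ∀ v u, ¬ G.graph.Adj v u → G.rot v u = u
  wt_black : ∀ v ∈ G.black, Ξ.wt v = ∑ u, G.weight s(v, u)
  wt_white : ∀ v ∉ G.black, Ξ.wt v = -∑ u, G.weight s(v, u)

/-- `G` is a labeled weighted bi-colored plane tree of passport `Ξ`. -/
structure FullPassport.IsTree {N : ℕ} (Ξ : FullPassport N) (G : RibbonGraph N) : Prop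
    extends Ξ.IsForest G where
  connected : G.graph.Connected

/-- The set of twice-marked trees `(T; a, b)`, `a ≠ b`, of passport `Ξ`. -/
def FullPassport.twiceMarkedTrees {N : ℕ} (Ξ : FullPassport N) : Set (MarkedRibbonGraph N) :=
  {M | Ξ.IsTree M.G ∧ M.a ≠ M.b}

namespace FullPassport

variable {N : ℕ} (Ξ : FullPassport N) (P : Equiv.Perm (Fin N))

/-! ## Cumulative sums and tree permutations

A permutation `(s₁, …, s_N)` is `P : Equiv.Perm (Fin N)` with `P k = s_{k+1}`; positions are
counted from `0`. -/

/-- The `i`-th cumulative sum: the total weight of the first `i` entries of `P`. -/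
def cumSum (i : ℕ) : ℝ :=
  ∑ j : Fin N with j.val < i, Ξ.wt (P j)

/-- Tree permutations. For the positions `k < l`, counted from `0`, the sum before `k` is `cumSum k`
and the sum up to and including `l` is `cumSum (l + 1)`; the sums in between are `cumSum j`,
`k < j ≤ l`, and a minimum (maximum) of finitely many numbers is `< c` (`> c`) iff one of them
is. -/
structure IsTreePermutation : Prop where
  ne_zero : ∀ i : ℕ, 0 < i → i < N → Ξ.cumSum P i ≠ 0
  pos : ∀ k l : Fin N, k < l → Ξ.cumSum P k = Ξ.cumSum P (l + 1) → 0 < Ξ.cumSum P k →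
    ∃ j : ℕ, k < j ∧ j ≤ l ∧ Ξ.cumSum P j < Ξ.cumSum P k
  neg : ∀ k l : Fin N, k < l → Ξ.cumSum P k = Ξ.cumSum P (l + 1) → Ξ.cumSum P k < 0 →
    ∃ j : ℕ, k < j ∧ j ≤ l ∧ Ξ.cumSum P k < Ξ.cumSum P j

/-- The set of tree permutations. -/
def treePermutations : Set (Equiv.Perm (Fin N)) :=
  {P | Ξ.IsTreePermutation P}

/-! ## The combing map -/

/-- The vertical rectangle over `[k, k + 1]`, between the x-axis and the cumulative sum up to and
including position `k`. -/
def verticalRect (k : Fin N) : Set (ℝ × ℝ) :=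
  Set.Icc (k : ℝ) (k + 1) ×ˢ Set.uIcc 0 (Ξ.cumSum P (k + 1))

/-- The histogram region of a permutation. -/
def region : Set (ℝ × ℝ) :=
  ⋃ k : Fin N, Ξ.verticalRect P k

/-- The rising or falling vertical line at position `k`. -/
def verticalLine (k : Fin N) : Set (ℝ × ℝ) :=
  {(k : ℝ)} ×ˢ Set.uIcc (Ξ.cumSum P k) (Ξ.cumSum P (k + 1))

/-- The cut through the horizontal line `[k, k + 1] × {h}`, `h = cumSum (k + 1)`: that line extended
in both directions as far as it stays in the region. -/
def lineCut (k : Fin N) : Set (ℝ × ℝ) :=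
  {p | p.2 = Ξ.cumSum P (k + 1) ∧ Set.uIcc (k : ℝ) p.1 ×ˢ {p.2} ⊆ Ξ.region P}

/-- All horizontal cuts: the extended horizontal lines and the segment on the x-axis. -/
def cuts : Set (ℝ × ℝ) :=
  (⋃ k : Fin N, Ξ.lineCut P k) ∪ Set.Icc (0 : ℝ) (N - 1) ×ˢ {(0 : ℝ)}

/-- `[k, l] × [y₀, y₁]` is one of the horizontal rectangles into which the cuts split the region:
it is contained in the region, its left and right sides lie on the vertical lines at the positions
`k` and `l`, its lower and upper sides lie on cuts, and no cut meets its interior. -/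
structure IsHorizontalRect (k l : Fin N) (y₀ y₁ : ℝ) : Prop where
  pos_lt : k < l
  height_lt : y₀ < y₁
  subset_region : Set.Icc (k : ℝ) l ×ˢ Set.Icc y₀ y₁ ⊆ Ξ.region P
  left_side : {(k : ℝ)} ×ˢ Set.Icc y₀ y₁ ⊆ Ξ.verticalLine P k
  right_side : {(l : ℝ)} ×ˢ Set.Icc y₀ y₁ ⊆ Ξ.verticalLine P l
  lower_side : Set.Icc (k : ℝ) l ×ˢ {y₀} ⊆ Ξ.cuts P
  upper_side : Set.Icc (k : ℝ) l ×ˢ {y₁} ⊆ Ξ.cuts P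
  interior : Disjoint (Set.Ioo (k : ℝ) l ×ˢ Set.Ioo y₀ y₁) (Ξ.cuts P)

/-- Some horizontal rectangle is bounded by the vertical lines at the positions `k < l`, on the left
and on the right respectively. -/
def HasRect (k l : Fin N) : Prop :=
  ∃ y : ℝ × ℝ, Ξ.IsHorizontalRect P k l y.1 y.2

open Classical in
/-- The vertical extent `(y₀, y₁)` of the horizontal rectangle between the positions `k < l` (there
is at most one), and `(0, 0)` if there is none. -/
noncomputable def rectExtent (k l : Fin N) : ℝ × ℝ :=
  if h : Ξ.HasRect P k l then h.choose else 0

/-- The height of the horizontal rectangle between `k < l`, and `0` if there is none. -/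
noncomputable def rectHeight (k l : Fin N) : ℝ :=
  (Ξ.rectExtent P k l).2 - (Ξ.rectExtent P k l).1

open Classical in
/-- The horizontal rectangles attached to the right of the vertical line at `i`, listed from bottom
to top; each is represented by the position of its other vertical line. -/
noncomputable def rightList (i : Fin N) : List (Fin N) :=
  ((List.finRange N).filter fun l => Ξ.HasRect P i l).insertionSort
    fun l m => (Ξ.rectExtent P i l).1 ≤ (Ξ.rectExtent P i m).1

open Classical in
/-- The horizontal rectangles attached to the left of the vertical line at `i`, listed from top
to bottom; each is represented by the position of its other vertical line. -/
noncomputable def leftList (i : Fin N) : List (Fin N) :=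
  ((List.finRange N).filter fun k => Ξ.HasRect P k i).insertionSort
    fun k m => (Ξ.rectExtent P m i).1 ≤ (Ξ.rectExtent P k i).1

/-- The cyclic action at position `i`: it runs cyclically through the list of the rectangles on the
right from bottom to top, followed by those on the left from top to bottom. -/
noncomputable def posRot (i : Fin N) : Equiv.Perm (Fin N) :=
  (Ξ.rightList P i ++ Ξ.leftList P i).formPerm

/-- The labeled weighted bi-colored ribbon graph of a permutation: position `k` is the vertex with
label `P k`, and each horizontal rectangle between two positions is an edge whose weight is
the height of the rectangle. -/
noncomputable def combGraph : RibbonGraph N where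
  graph :=
    { Adj := fun u v => Ξ.HasRect P (P.symm u) (P.symm v) ∨ Ξ.HasRect P (P.symm v) (P.symm u)
      symm := ⟨fun _ _ h => h.symm⟩
      loopless := ⟨fun _ h => by
        rcases h with ⟨_, h⟩ | ⟨_, h⟩ <;> exact lt_irrefl _ h.pos_lt⟩ }
  black := {v | 0 < Ξ.wt v}
  weight := Sym2.lift
    ⟨fun u v => Ξ.rectHeight P (P.symm u) (P.symm v) + Ξ.rectHeight P (P.symm v) (P.symm u),
      fun _ _ => add_comm _ _⟩
  rot := fun v => P.permCongr (Ξ.posRot P (P.symm v))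

/-- The combing map: the ribbon graph of `P`, marked at the first and the last entry of `P`. -/
noncomputable def comb : MarkedRibbonGraph N where
  G := Ξ.combGraph P
  a := P ⟨0, Ξ.nonempty⟩
  b := P ⟨N - 1, Nat.sub_one_lt_of_lt Ξ.nonempty⟩

end FullPassport

/-! ## The folding map -/

namespace RibbonGraph

variable {N : ℕ} (G : RibbonGraph N)

open Classical in
/-- The next edge around `w`, anticlockwise if `w` is black and clockwise if `w` is white. -/
noncomputable def turn (w : Fin N) : Equiv.Perm (Fin N) :=
  if w ∈ G.black then G.rot w else (G.rot w)⁻¹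

open Classical in
/-- `1` for a black vertex, `-1` for a white vertex. -/
noncomputable def colorSign (v : Fin N) : ℝ :=
  if v ∈ G.black then 1 else -1

/-- A horizontal rectangle drawn for an edge from `v` to `w`: its side at `v` has x-coordinate
`xv`, its side at `w` has x-coordinate `xw`, its horizontal sides have the heights `yin` (closer to
the x-axis) and `yout`, and `side` is `1` if it is above the x-axis and `-1` if it is below. -/
structure FoldRect where
  xv : ℝ
  xw : ℝ
  yin : ℝ
  yout : ℝ
  side : ℝ

/-- `Drawn G p v w r`: in the folding along the path `p` from `a` to `b`, the rectangle `r` is drawn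
for the edge from `v` to `w`.
* The `i`-th edge of the path gets `[i, i + 1]` horizontally; it lies on the x-axis, above it if
  the `i`-th vertex of the path is black and below it if that vertex is white. Further rectangles
  may be attached to it at both of its ends.
* If a rectangle `r` is drawn for the edge from `v` to `w`, then the edges at `w` that follow it
  (anticlockwise if `w` is black, clockwise if `w` is white), up to the next edge of the path or
  until the first edge recurs, are stacked on `r`, away from the x-axis: the `i`-th of them is
  aligned with `r` at `w`, and its length is `3⁻ⁱ` times the length of `r`. -/
inductive Drawn {a b : Fin N} (p : G.graph.Walk a b) : Fin N → Fin N → FoldRect → Prop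
  | path (i : ℕ) (hi : i < p.length) :
      Drawn p (p.getVert i) (p.getVert (i + 1))
        { xv := i
          xw := i + 1
          yin := 0
          yout := G.colorSign (p.getVert i) * G.weight s(p.getVert i, p.getVert (i + 1))
          side := G.colorSign (p.getVert i) }
  | path_symm (i : ℕ) (hi : i < p.length) :
      Drawn p (p.getVert (i + 1)) (p.getVert i)
        { xv := i + 1
          xw := i
          yin := 0
          yout := G.colorSign (p.getVert i) * G.weight s(p.getVert i, p.getVert (i + 1))
          side := G.colorSign (p.getVert i) }
  | attach (v w : Fin N) (r : FoldRect) (h : Drawn p v w r) (i : ℕ) (hi : 1 ≤ i)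
      (hfree : ∀ j ∈ Finset.Icc 1 i,
        (G.turn w ^ j) v ≠ v ∧ s(w, (G.turn w ^ j) v) ∉ p.edges) :
      Drawn p w ((G.turn w ^ i) v)
        { xv := r.xw
          xw := r.xw + (r.xv - r.xw) / 3 ^ i
          yin := r.yout + r.side * ∑ j ∈ Finset.Ico 1 i, G.weight s(w, (G.turn w ^ j) v)
          yout := r.yout + r.side * ∑ j ∈ Finset.Icc 1 i, G.weight s(w, (G.turn w ^ j) v)
          side := r.side }

end RibbonGraph

namespace MarkedRibbonGraph

variable {N : ℕ} (M : MarkedRibbonGraph N)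

/-- In the region folded along a path from `a` to `b`, the rectangles of the edges at `v` end on
the vertical segment with x-coordinate `x`. -/
def HasVertexAt (v : Fin N) (x : ℝ) : Prop :=
  ∃ p : M.G.graph.Walk M.a M.b, p.IsPath ∧
    ∃ (u : Fin N) (r : RibbonGraph.FoldRect), M.G.Drawn p u v r ∧ r.xw = x

open Classical in
/-- The x-coordinate of the vertical segment of `v` (for a twice-marked tree, there is
exactly one; the value `0` is used if there is none). -/
noncomputable def vertexX (v : Fin N) : ℝ :=
  if h : ∃ x, M.HasVertexAt v x then h.choose else 0

/-- The folding map: the vertices listed in increasing order of the x-coordinates of their vertical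
segments. -/
noncomputable def fold : Equiv.Perm (Fin N) :=
  Tuple.sort M.vertexX

end MarkedRibbonGraph

/-!
The whole correspondence is read off the height sequence `cumSum` of a permutation `P`. A
horizontal rectangle between the positions `k < l` is the same as an *arc* (`Arc`): all heights
strictly between the two positions have one sign and are farther from the axis than the heights on
both sides of the interval and than the axis itself (`hasRect_iff`); the height of the rectangle is
the resulting gap (`rectHeight_eq`).

*The combed graph is a tree.* By the conditions on tree permutations, an arc has a unique step
closest to the axis, its *bottom*, and every step is the bottom of exactly one arc
(`TreeSeq.exists_bottom`, `TreeSeq.exists_upperArc`, `UpperArc.eq_of_isBottom`). The bottom splits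
the interval below an arc into the intervals of the arcs that rest on it, so that by induction the
arcs connect all `N` positions (`TreeSeq.rel_of_arc`); as there are at most `N - 1` steps, hence at
most `N - 1` edges, the graph is a tree. The heights of the arcs at one position telescope to the
weight of its vertex (`sum_arcHeight_right`, `sum_arcHeight_left`).

*Folding a tree.* Remove the edges of the path; what remains is a forest rooted on the path. Since
the lengths in a stack are divided by three from each rectangle to the next, every branch of this
forest stays within a third of the way from its root vertex to the parent (`FoldLayout.branch`).
Hence the vertical segments are pairwise distinct (`FoldLayout.x_injective`), and the edges are
drawn as noncrossing arcs over them, with left ends of one color over every point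
(`FoldLayout.noncrossing`). For such a drawing, the height of a step is the signed total weight of
the edges over it (`IsTree.cumSum_eq`). So every edge is an arc of the height sequence
(`IsTree.arc_of_adj`), two steps of equal height are separated by one closer to the axis because the
tree is connected (`IsTree.exists_lower`), and the fold is a tree permutation.

*Combing after folding.* The combed graph of the fold contains the tree and is itself a tree, thus
they have the same edges, and the same weights, since the weights of a tree are determined by their
sums at the vertices. Both rotations lead from each edge of a stack to the next, which is nearer
(`FoldLayout.turn_eq`); the remaining at most two values of a rotation are then forced, as two
cyclic permutations of a set cannot differ by a transposition
(`Equiv.Perm.IsCycleOn.eq_of_agree`).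

*Folding after combing.* The arcs on the axis form the path from the first to the last vertex
(`FullPassport.exists_axis_walk`), and from any arc the turn at each of its ends leads to one of the
two arcs that rest on it. These have a third of its length in the folding, so the vertical segments
below an arc are, by induction on the arc, in the order of the positions (`FullPassport.step_lt`).
-/

/-! ### Arcs of height sequences -/

/-- The interval between the positions `k < l` spans a horizontal rectangle above the axis: every
height strictly between the two positions is positive and exceeds the heights on either side. -/
def UpperArc (h : ℕ → ℝ) (k l : ℕ) : Prop :=
  k < l ∧ ∀ j, k < j → j ≤ l → 0 < h j ∧ h k < h j ∧ h (l + 1) < h j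

/-- An arc above or below the axis. -/
def Arc (h : ℕ → ℝ) (k l : ℕ) : Prop :=
  UpperArc h k l ∨ UpperArc (-h) k l

/-- The height sequences of tree permutations. -/
structure TreeSeq (N : ℕ) (h : ℕ → ℝ) : Prop where
  zero : h 0 = 0
  last : h N = 0
  ne_zero : ∀ i, 0 < i → i < N → h i ≠ 0
  pos : ∀ i j, i < j → j ≤ N → h i = h j → 0 < h i → ∃ q, i < q ∧ q < j ∧ h q < h i
  neg : ∀ i j, i < j → j ≤ N → h i = h j → h i < 0 → ∃ q, i < q ∧ q < j ∧ h i < h q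

/-- `m` is the unique lowest step of the interval between the positions `k` and `l`. -/
def IsBottom (h : ℕ → ℝ) (k l m : ℕ) : Prop :=
  k < m ∧ m ≤ l ∧ ∀ j, k < j → j ≤ l → j ≠ m → h m < h j

theorem Arc.lt {h : ℕ → ℝ} {k l : ℕ} (a : Arc h k l) : k < l := by
  rcases a with a | a <;> exact a.1

namespace TreeSeq

variable {N : ℕ} {h : ℕ → ℝ}

theorem negate (H : TreeSeq N h) : TreeSeq N (-h) where
  zero := by simp [H.zero]
  last := by simp [H.last]
  ne_zero i h0 h1 := by simpa using H.ne_zero i h0 h1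
  pos i j hij hj he hp := by
    obtain ⟨q, h1, h2, h3⟩ := H.neg i j hij hj (by simpa using he) (by simpa using hp)
    exact ⟨q, h1, h2, by simpa using h3⟩
  neg i j hij hj he hp := by
    obtain ⟨q, h1, h2, h3⟩ := H.pos i j hij hj (by simpa using he) (by simpa using hp)
    exact ⟨q, h1, h2, by simpa using h3⟩

/-- On an interval where a positive minimum is attained, it is attained only once. -/
theorem lt_of_le (H : TreeSeq N h) {k l m : ℕ} (hl : l < N) (hkm : k < m) (hml : m ≤ l)
    (hm : 0 < h m) (hmin : ∀ j, k < j → j ≤ l → h m ≤ h j) : IsBottom h k l m := by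
  refine ⟨hkm, hml, fun j hkj hjl hne => lt_of_le_of_ne (hmin j hkj hjl) fun he => ?_⟩
  rcases lt_or_gt_of_ne hne with hlt | hlt
  · obtain ⟨q, h1, h2, h3⟩ := H.pos j m hlt (by omega) he.symm (he ▸ hm)
    have := hmin q (by omega) (by omega)
    linarith
  · obtain ⟨q, h1, h2, h3⟩ := H.pos m j hlt (by omega) he hm
    have := hmin q (by omega) (by omega)
    linarith

theorem exists_bottom (H : TreeSeq N h) {k l : ℕ} (hl : l < N) (a : UpperArc h k l) :
    ∃ m, IsBottom h k l m := by
  obtain ⟨m, hm, hmin⟩ := (Finset.Ioc k l).exists_min_image h ⟨l, by simpa using a.1⟩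
  rw [Finset.mem_Ioc] at hm
  refine ⟨m, H.lt_of_le hl hm.1 hm.2 (a.2 m hm.1 hm.2).1 fun j h1 h2 => ?_⟩
  exact hmin j (by simp [h1, h2])

/-- Every step above the axis is the lowest step of an arc. -/
theorem exists_upperArc (H : TreeSeq N h) {m : ℕ} (hm : m < N) (hpos : 0 < h m) :
    ∃ k l, l < N ∧ UpperArc h k l ∧ IsBottom h k l m := by
  classical
  have hm0 : 0 < m := by
    rcases Nat.eq_zero_or_pos m with rfl | h0
    · rw [H.zero] at hpos; exact absurd hpos (lt_irrefl _)
    · exact h0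
  have hex : ∃ q, m < q ∧ h q < h m := ⟨N, hm, by rw [H.last]; exact hpos⟩
  obtain ⟨hq1, hq2⟩ := Nat.find_spec hex
  have hqN : Nat.find hex ≤ N := Nat.find_min' hex ⟨hm, by rw [H.last]; exact hpos⟩
  set q := Nat.find hex with hq
  have hqmin : ∀ j, m < j → j < q → h m ≤ h j := fun j h1 h2 => by
    have := Nat.find_min hex h2
    push Not at this
    exact this h1
  -- `q` is the first position after `m`, and `k` the last one before `m`, with a height below `h m`.
  obtain ⟨k, hk, hkmax⟩ := ((Finset.range m).filter fun j => h j < h m).exists_max_image id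
    ⟨0, by simp [hm0, H.zero, hpos]⟩
  simp only [Finset.mem_filter, Finset.mem_range, id] at hk hkmax
  have hkmin : ∀ j, k < j → j < m → h m ≤ h j := fun j h1 h2 => by
    by_contra hc
    have := hkmax j ⟨h2, not_le.1 hc⟩
    omega
  have hmin : ∀ j, k < j → j ≤ q - 1 → h m ≤ h j := fun j h1 h2 => by
    rcases lt_trichotomy j m with h3 | rfl | h3
    · exact hkmin j h1 h3
    · exact le_rfl
    · exact hqmin j h3 (by omega)
  refine ⟨k, q - 1, by omega, ⟨by omega, fun j h1 h2 => ?_⟩,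
    H.lt_of_le (by omega) hk.1 (by omega) hpos hmin⟩
  have := hmin j h1 h2
  have e : q - 1 + 1 = q := by omega
  rw [e]
  exact ⟨by linarith, by linarith [hk.2], by linarith⟩

end TreeSeq

namespace UpperArc

variable {h : ℕ → ℝ} {k l m : ℕ}

theorem not_neg (a : UpperArc h k l) {k' l' : ℕ} (b : UpperArc (-h) k' l') {j : ℕ}
    (h1 : k < j) (h2 : j ≤ l) (h3 : k' < j) (h4 : j ≤ l') : False := by
  have := (a.2 j h1 h2).1
  have := (b.2 j h3 h4).1
  simp only [Pi.neg_apply] at this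
  linarith

theorem left_child (a : UpperArc h k l) (hm : IsBottom h k l m) (hkm : k + 1 < m) :
    UpperArc h k (m - 1) := by
  refine ⟨by omega, fun j h1 h2 => ?_⟩
  have e : m - 1 + 1 = m := by omega
  have hj := a.2 j h1 (by have := hm.2.1; omega)
  rw [e]
  exact ⟨hj.1, hj.2.1, hm.2.2 j h1 (by have := hm.2.1; omega) (by omega)⟩

theorem right_child (a : UpperArc h k l) (hm : IsBottom h k l m) (hml : m < l) :
    UpperArc h m l := by
  refine ⟨hml, fun j h1 h2 => ?_⟩
  have hj := a.2 j (by have := hm.1; omega) h2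
  exact ⟨hj.1, hm.2.2 j (by have := hm.1; omega) h2 (by omega), hj.2.2⟩

/-- An arc is determined by its lowest step. -/
theorem eq_of_isBottom (a : UpperArc h k l) (hm : IsBottom h k l m) {k' l' : ℕ}
    (a' : UpperArc h k' l') (hm' : IsBottom h k' l' m) : k = k' ∧ l = l' := by
  obtain ⟨b1, b2, b3⟩ := hm
  obtain ⟨c1, c2, c3⟩ := hm'
  have ha := a.2 m b1 b2
  have ha' := a'.2 m c1 c2
  constructor
  · rcases lt_trichotomy k k' with hlt | he | hlt
    · have := b3 k' hlt (by omega) (by omega); linarith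
    · exact he
    · have := c3 k hlt (by omega) (by omega); linarith
  · rcases lt_trichotomy l l' with hlt | he | hlt
    · have := c3 (l + 1) (by omega) (by omega) (by omega); linarith
    · exact he
    · have := b3 (l' + 1) (by omega) (by omega) (by omega); linarith

/-- Between an arc and its left child there is no further arc with the same left end. -/
theorem le_of_left (hm : IsBottom h k l m) {l' : ℕ} (a : UpperArc h k l') (hl : l' < l) :
    l' ≤ m - 1 := by
  by_contra hc
  have := (a.2 m hm.1 (by omega)).2.2
  have := hm.2.2 (l' + 1) (by have := hm.1; omega) (by omega) (by omega)
  linarith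

theorem le_of_right (hm : IsBottom h k l m) {k' : ℕ} (a : UpperArc h k' l) (hk : k < k') :
    m ≤ k' := by
  by_contra hc
  have := (a.2 m (by omega) hm.2.1).2.1
  have := hm.2.2 k' hk (by have := a.1; omega) (by omega)
  linarith

end UpperArc

/-- An equivalence relation between neighboring numbers holds between the ends of the interval. -/
theorem Equivalence.of_steps {R : ℕ → ℕ → Prop} (hR : Equivalence R) {a b : ℕ} (hab : a ≤ b)
    (hs : ∀ j, a < j → j ≤ b → R (j - 1) j) : R a b := by
  induction b, hab using Nat.le_induction with
  | base => exact hR.refl a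
  | succ n hn ih =>
    exact hR.trans (ih fun j h1 h2 => hs j h1 (by omega)) (by simpa using hs (n + 1) (by omega) le_rfl)

/-- The ends of all arcs inside an upper arc, its own included, are linked by arcs. -/
theorem TreeSeq.step_of_upperArc {N : ℕ} {h : ℕ → ℝ} (H : TreeSeq N h) {R : ℕ → ℕ → Prop}
    (hR : Equivalence R) (harc : ∀ k l, l < N → UpperArc h k l → R k l) (n : ℕ) :
    ∀ k l, l - k ≤ n → l < N → UpperArc h k l → ∀ j, k < j → j ≤ l → R (j - 1) j := by
  induction n with
  | zero => intro k l h1 _ a; have := a.1; omega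
  | succ n ih =>
    intro k l hn hl a
    obtain ⟨m, hm⟩ := H.exists_bottom hl a
    have hm1 := hm.1
    have hm2 := hm.2.1
    have hleft : ∀ j, k < j → j ≤ m - 1 → R (j - 1) j := fun j h1 h2 =>
      ih k (m - 1) (by omega) (by omega) (a.left_child hm (by omega)) j h1 h2
    have hright : ∀ j, m < j → j ≤ l → R (j - 1) j := fun j h1 h2 =>
      ih m l (by omega) hl (a.right_child hm (by omega)) j h1 h2
    intro j h1 h2
    rcases lt_trichotomy j m with h3 | rfl | h3
    · exact hleft j h1 (by omega)
    -- The step at the bottom is linked through `k` on its left, the arc, and `l` on its right.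
    · exact hR.trans (hR.symm (hR.of_steps (by omega) hleft))
        (hR.trans (harc k l hl a) (hR.symm (hR.of_steps (by omega) hright)))
    · exact hright j h3 h2

theorem TreeSeq.exists_arc {N : ℕ} {h : ℕ → ℝ} (H : TreeSeq N h) {m : ℕ} (hm0 : 0 < m)
    (hm : m < N) : ∃ k l, l < N ∧ (UpperArc h k l ∧ IsBottom h k l m ∨
      UpperArc (-h) k l ∧ IsBottom (-h) k l m) := by
  rcases lt_or_gt_of_ne (H.ne_zero m hm0 hm) with hlt | hlt
  · obtain ⟨k, l, h1, h2⟩ := H.negate.exists_upperArc hm (by simpa using hlt)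
    exact ⟨k, l, h1, Or.inr h2⟩
  · obtain ⟨k, l, h1, h2⟩ := H.exists_upperArc hm hlt
    exact ⟨k, l, h1, Or.inl h2⟩

/-- An equivalence relation that identifies the ends of every arc identifies all positions. -/
theorem TreeSeq.rel_of_arc {N : ℕ} {h : ℕ → ℝ} (H : TreeSeq N h) {R : ℕ → ℕ → Prop}
    (hR : Equivalence R) (harc : ∀ k l, l < N → Arc h k l → R k l) {k : ℕ} (hk : k < N) :
    R 0 k := by
  refine hR.of_steps (Nat.zero_le _) fun j h1 h2 => ?_
  obtain ⟨k, l, hl, ⟨a, hm⟩ | ⟨a, hm⟩⟩ := H.exists_arc h1 (by omega)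
  · exact H.step_of_upperArc hR (fun k l h3 h4 => harc k l h3 (Or.inl h4)) _ k l le_rfl hl a j
      hm.1 hm.2.1
  · exact H.negate.step_of_upperArc hR (fun k l h3 h4 => harc k l h3 (Or.inr h4)) _ k l le_rfl hl
      a j hm.1 hm.2.1

/-! ### Heights of arcs and their sums -/

/-- The minimum of `h a, h (a + 1), …, h (a + n)`. -/
def runMin (h : ℕ → ℝ) (a : ℕ) : ℕ → ℝ
  | 0 => h a
  | n + 1 => min (runMin h a n) (h (a + n + 1))

theorem runMin_succ_left (h : ℕ → ℝ) (a n : ℕ) :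
    runMin h a (n + 1) = min (h a) (runMin h (a + 1) n) := by
  induction n with
  | zero => simp [runMin]
  | succ n ih =>
    rw [runMin, ih, runMin, min_assoc]
    congr 3
    ring

theorem lt_runMin_iff {h : ℕ → ℝ} {a n : ℕ} {c : ℝ} :
    c < runMin h a n ↔ ∀ j, a ≤ j → j ≤ a + n → c < h j := by
  induction n with
  | zero =>
    simp only [runMin, Nat.add_zero]
    exact ⟨fun hc j h1 h2 => (le_antisymm h1 h2) ▸ hc, fun hc => hc a le_rfl le_rfl⟩
  | succ n ih =>
    rw [runMin, lt_min_iff, ih]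
    constructor
    · rintro ⟨h1, h2⟩ j h3 h4
      rcases Nat.lt_or_ge j (a + n + 1) with h5 | h5
      · exact h1 j h3 (by omega)
      · have : j = a + n + 1 := by omega
        exact this ▸ h2
    · exact fun hc => ⟨fun j h1 h2 => hc j h1 (by omega), hc _ (by omega) (by omega)⟩

/-- The height of the rectangle spanned by an upper arc, and `0` if there is no upper arc. -/
noncomputable def arcHeight (h : ℕ → ℝ) (k l : ℕ) : ℝ :=
  if k < l then max 0 (runMin h (k + 1) (l - k - 1) - max 0 (max (h k) (h (l + 1)))) else 0

theorem upperArc_iff {h : ℕ → ℝ} {k l : ℕ} : UpperArc h k l ↔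
    k < l ∧ max 0 (max (h k) (h (l + 1))) < runMin h (k + 1) (l - k - 1) := by
  unfold UpperArc
  refine and_congr_right fun hkl => ?_
  rw [lt_runMin_iff]
  have e : k + 1 + (l - k - 1) = l := by omega
  simp only [e, max_lt_iff]
  exact Iff.rfl

theorem arcHeight_pos_iff {h : ℕ → ℝ} {k l : ℕ} : 0 < arcHeight h k l ↔ UpperArc h k l := by
  rw [upperArc_iff, arcHeight]
  split_ifs with hkl
  · simp [hkl]
  · simp [hkl]

theorem arcHeight_nonneg (h : ℕ → ℝ) (k l : ℕ) : 0 ≤ arcHeight h k l := by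
  rw [arcHeight]
  split_ifs
  · exact le_max_left _ _
  · exact le_rfl

theorem arcHeight_eq_zero {h : ℕ → ℝ} {k l : ℕ} (a : ¬ UpperArc h k l) : arcHeight h k l = 0 :=
  le_antisymm (not_lt.1 fun h0 => a (arcHeight_pos_iff.1 h0)) (arcHeight_nonneg h k l)

theorem max_sub_max_min (x y c : ℝ) : max c x - max c (min x y) = max 0 (x - max c y) := by
  rcases le_total x y with h1 | h1 <;> rcases le_total c x with h2 | h2 <;>
    rcases le_total c y with h3 | h3 <;>
    simp [h1, h2, h3] <;> linarith

/-- The heights of the upper arcs that start at `k` telescope. -/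
theorem sum_arcHeight_right {N : ℕ} {h : ℕ → ℝ} (hN : h N = 0) {k : ℕ} (hk : k < N) :
    ∑ l ∈ Finset.range N, arcHeight h k l = max (max 0 (h k)) (h (k + 1)) - max 0 (h k) := by
  -- The sum of the arcs that end before position `k + 1 + n` telescopes; beyond it, only the running
  -- minimum of the heights matters, which is at most `0` once it includes `h N = 0`.
  have key : ∀ n, ∑ l ∈ Finset.range (k + 1 + n), arcHeight h k l =
      max (max 0 (h k)) (h (k + 1)) - max (max 0 (h k)) (runMin h (k + 1) n) := by
    intro n
    induction n with
    | zero =>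
      rw [Finset.sum_eq_zero fun l hl => ?_]
      · simp [runMin]
      · rw [arcHeight, if_neg]
        have := Finset.mem_range.1 hl
        omega
    | succ n ih =>
      rw [← Nat.add_assoc, Finset.sum_range_succ, ih, arcHeight, if_pos (by omega), runMin]
      have e : k + 1 + n - k - 1 = n := by omega
      rw [e, ← max_assoc, ← max_sub_max_min]
      ring
  obtain ⟨n, rfl⟩ : ∃ n, N = k + 1 + n := ⟨N - k - 1, by omega⟩
  rw [key n]
  have : runMin h (k + 1) n ≤ 0 := by
    by_contra hc
    have := lt_runMin_iff.1 (not_le.1 hc) (k + 1 + n) (by omega) le_rfl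
    linarith
  rw [max_eq_left (a := max 0 (h k)) (this.trans (le_max_left _ _))]

/-- The heights of the upper arcs that end at `l` telescope. -/
theorem sum_arcHeight_left {N : ℕ} {h : ℕ → ℝ} (h0 : h 0 = 0) {l : ℕ} (hl : l < N) :
    ∑ k ∈ Finset.range N, arcHeight h k l = max (max 0 (h (l + 1))) (h l) - max 0 (h (l + 1)) := by
  have key : ∀ n, n ≤ l → ∑ k ∈ Finset.Ico (l - n) N, arcHeight h k l =
      max (max 0 (h (l + 1))) (h l) - max (max 0 (h (l + 1))) (runMin h (l - n) n) := by
    intro n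
    induction n with
    | zero =>
      intro _
      rw [Finset.sum_eq_zero fun k hk => ?_]
      · simp [runMin]
      · rw [arcHeight, if_neg]
        have := Finset.mem_Ico.1 hk
        omega
    | succ n ih =>
      intro hn
      rw [Finset.sum_eq_sum_Ico_succ_bot (by omega)]
      have e : l - (n + 1) + 1 = l - n := by omega
      have e2 : l - (l - (n + 1)) - 1 = n := by omega
      rw [e, ih (by omega), arcHeight, if_pos (by omega), runMin_succ_left, e, e2,
        max_comm (h (l - (n + 1))) (h (l + 1)), ← max_assoc, ← max_sub_max_min,
        min_comm (runMin h (l - n) n)]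
      ring
  have := key l le_rfl
  rw [Nat.sub_self, ← Finset.range_eq_Ico] at this
  rw [this]
  have : runMin h 0 l ≤ 0 := by
    by_contra hc
    have := lt_runMin_iff.1 (not_le.1 hc) 0 le_rfl (by omega)
    linarith
  rw [max_eq_left (a := max 0 (h (l + 1))) (this.trans (le_max_left _ _))]

/-! ### Horizontal rectangles are arcs -/

namespace FullPassport

variable {N : ℕ} (Ξ : FullPassport N) (P : Equiv.Perm (Fin N))

theorem cumSum_zero : Ξ.cumSum P 0 = 0 := by simp [cumSum]

theorem cumSum_last : Ξ.cumSum P N = 0 := by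
  simp only [cumSum, Fin.is_lt, Finset.filter_true]
  rw [Equiv.sum_comp P Ξ.wt, Ξ.sum_wt]

theorem cumSum_succ (k : Fin N) : Ξ.cumSum P (k + 1) = Ξ.cumSum P k + Ξ.wt (P k) := by
  have e : (Finset.univ.filter fun j : Fin N => j.val < k + 1) =
      insert k (Finset.univ.filter fun j : Fin N => j.val < k) := by
    ext j
    simp [Fin.ext_iff]
    omega
  rw [cumSum, e, Finset.sum_insert (by simp), cumSum, add_comm]

/-- The passport with all weights negated; it mirrors the pictures in the axis. -/
def neg : FullPassport N where
  wt s := -Ξ.wt s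
  nonempty := Ξ.nonempty
  wt_ne_zero s := neg_ne_zero.2 (Ξ.wt_ne_zero s)
  sum_wt := by simp [Ξ.sum_wt]

theorem cumSum_neg (i : ℕ) : Ξ.neg.cumSum P i = -Ξ.cumSum P i := by
  simp [cumSum, neg]

theorem cumSum_neg_eq : Ξ.neg.cumSum P = -Ξ.cumSum P := by
  ext i; simp [cumSum_neg]

variable {Ξ P}

theorem neg_mem_uIcc_neg {a b y : ℝ} : -y ∈ Set.uIcc (-a) (-b) ↔ y ∈ Set.uIcc a b := by
  simp only [Set.mem_uIcc, neg_le_neg_iff]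
  constructor <;> rintro (⟨h1, h2⟩ | ⟨h1, h2⟩) <;> simp [h1, h2]

theorem mem_region {x y : ℝ} : (x, y) ∈ Ξ.region P ↔
    ∃ k : Fin N, (k : ℝ) ≤ x ∧ x ≤ k + 1 ∧ y ∈ Set.uIcc 0 (Ξ.cumSum P (k + 1)) := by
  simp [region, verticalRect, and_assoc]

theorem mem_lineCut {i : Fin N} {x y : ℝ} : (x, y) ∈ Ξ.lineCut P i ↔
    y = Ξ.cumSum P (i + 1) ∧ ∀ x' ∈ Set.uIcc (i : ℝ) x, (x', y) ∈ Ξ.region P := by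
  simp only [lineCut, Set.mem_ofPred_eq]
  refine and_congr_right fun _ => ⟨fun h x' hx' => h ⟨hx', rfl⟩, ?_⟩
  rintro h ⟨x', y'⟩ ⟨h1, h2⟩
  obtain rfl : y' = y := h2
  exact h x' h1

theorem mem_cuts {x y : ℝ} : (x, y) ∈ Ξ.cuts P ↔
    (∃ i : Fin N, (x, y) ∈ Ξ.lineCut P i) ∨ (0 ≤ x ∧ x ≤ N - 1 ∧ y = 0) := by
  simp [cuts, and_assoc]

theorem mem_region_neg {x y : ℝ} : (x, -y) ∈ Ξ.neg.region P ↔ (x, y) ∈ Ξ.region P := by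
  simp only [mem_region, cumSum_neg]
  refine exists_congr fun k => and_congr_right fun _ => and_congr_right fun _ => ?_
  conv_lhs => rw [← neg_zero (G := ℝ)]
  exact neg_mem_uIcc_neg

theorem mem_lineCut_neg {i : Fin N} {x y : ℝ} :
    (x, -y) ∈ Ξ.neg.lineCut P i ↔ (x, y) ∈ Ξ.lineCut P i := by
  simp only [mem_lineCut, mem_region_neg, cumSum_neg, neg_inj]

theorem mem_cuts_neg {x y : ℝ} : (x, -y) ∈ Ξ.neg.cuts P ↔ (x, y) ∈ Ξ.cuts P := by
  simp only [mem_cuts, mem_lineCut_neg, neg_eq_zero]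

theorem IsHorizontalRect.neg {k l : Fin N} {y₀ y₁ : ℝ} (h : Ξ.IsHorizontalRect P k l y₀ y₁) :
    Ξ.neg.IsHorizontalRect P k l (-y₁) (-y₀) where
  pos_lt := h.pos_lt
  height_lt := neg_lt_neg h.height_lt
  subset_region := by
    rintro ⟨x, y⟩ ⟨h1, h2, h3⟩
    rw [← neg_neg y, mem_region_neg]
    exact h.subset_region ⟨h1, le_neg.1 h3, neg_le.1 h2⟩
  left_side := by
    rintro ⟨x, y⟩ ⟨h1, h2, h3⟩
    have := (h.left_side (a := (x, -y)) ⟨h1, le_neg.1 h3, neg_le.1 h2⟩).2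
    refine ⟨h1, ?_⟩
    simp only [cumSum_neg] at this ⊢
    rw [← neg_neg y]
    exact neg_mem_uIcc_neg.2 this
  right_side := by
    rintro ⟨x, y⟩ ⟨h1, h2, h3⟩
    have := (h.right_side (a := (x, -y)) ⟨h1, le_neg.1 h3, neg_le.1 h2⟩).2
    refine ⟨h1, ?_⟩
    simp only [cumSum_neg] at this ⊢
    rw [← neg_neg y]
    exact neg_mem_uIcc_neg.2 this
  lower_side := by
    rintro ⟨x, y⟩ ⟨h1, h2⟩
    obtain rfl : y = -y₁ := h2
    exact mem_cuts_neg.2 (h.upper_side ⟨h1, rfl⟩)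
  upper_side := by
    rintro ⟨x, y⟩ ⟨h1, h2⟩
    obtain rfl : y = -y₀ := h2
    exact mem_cuts_neg.2 (h.lower_side ⟨h1, rfl⟩)
  interior := by
    rw [Set.disjoint_left]
    rintro ⟨x, y⟩ ⟨h1, h2, h3⟩ h4
    rw [← neg_neg y, mem_cuts_neg] at h4
    have h5 : (x, -y) ∈ Set.Ioo (k : ℝ) l ×ˢ Set.Ioo y₀ y₁ := ⟨h1, lt_neg.1 h3, neg_lt.1 h2⟩
    exact Set.disjoint_left.1 h.interior h5 h4

theorem neg_neg_passport : Ξ.neg.neg = Ξ := by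
  cases Ξ; simp [FullPassport.neg]

/-- Over the middle of a unit interval, the region is one vertical segment. -/
theorem le_of_mem_region {j : ℕ} {y : ℝ} (hy : 0 < y) (hm : ((j : ℝ) + 1 / 2, y) ∈ Ξ.region P) :
    y ≤ Ξ.cumSum P (j + 1) := by
  obtain ⟨k, h1, h2, h3⟩ := mem_region.1 hm
  have e1 : (k : ℕ) < j + 1 := by
    have : ((k : ℕ) : ℝ) < ((j + 1 : ℕ) : ℝ) := by push_cast; linarith
    exact_mod_cast this
  have e2 : j < (k : ℕ) + 1 := by
    have : (j : ℝ) < (((k : ℕ) + 1 : ℕ) : ℝ) := by push_cast; linarith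
    exact_mod_cast this
  have e : j = k := by omega
  rw [e]
  rcases Set.mem_uIcc.1 h3 with ⟨_, h⟩ | ⟨_, h⟩
  · exact h
  · linarith

/-- A cut at a positive height that meets the strip between two positions, outside of which
the histogram is lower, comes from a step between the two positions. -/
theorem mem_of_lineCut {k l i : Fin N} {x y : ℝ} (hy : 0 < y) (hk : Ξ.cumSum P k < y)
    (hl : Ξ.cumSum P (l + 1) < y) (hkx : (k : ℝ) < x) (hxl : x < l)
    (hc : (x, y) ∈ Ξ.lineCut P i) : k ≤ i ∧ i < l := by
  obtain ⟨he, hr⟩ := mem_lineCut.1 hc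
  constructor
  · by_contra hik
    rw [not_le, Fin.lt_def] at hik
    -- A cut from further left would cross the lower part of the histogram just before `k`.
    rcases Nat.lt_or_ge (i + 1) k with h1 | h1
    · obtain ⟨j, hj⟩ : ∃ j : ℕ, (k : ℕ) = j + 1 := ⟨k - 1, by omega⟩
      have hij : ((i : ℕ) : ℝ) ≤ j := by exact_mod_cast (by omega)
      have hkj : ((k : ℕ) : ℝ) = j + 1 := by exact_mod_cast hj
      have := le_of_mem_region hy (hr (j + 1 / 2)
        (Set.mem_uIcc.2 (Or.inl ⟨by linarith, by linarith⟩)))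
      rw [← hj] at this
      linarith
    · have : (i : ℕ) + 1 = k := by omega
      rw [this] at he
      linarith
  · by_contra hil
    rw [not_lt, Fin.le_def] at hil
    -- A cut from further right would cross the lower part of the histogram just after `l`.
    rcases Nat.lt_or_ge l i with h1 | h1
    · have hij : ((l : ℕ) : ℝ) + 1 ≤ i := by exact_mod_cast h1
      have := le_of_mem_region hy (hr ((l : ℕ) + 1 / 2)
        (Set.mem_uIcc.2 (Or.inr ⟨by linarith, by linarith⟩)))
      linarith
    · have : (i : ℕ) = l := by omega
      rw [this] at he
      linarith

namespace IsHorizontalRect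

variable {k l : Fin N} {y₀ y₁ : ℝ}

theorem mid_mem (hkl : k < l) : (k : ℝ) < (k : ℕ) + 1 / 2 ∧ ((k : ℕ) : ℝ) + 1 / 2 < l := by
  have : ((k : ℕ) : ℝ) + 1 ≤ l := by exact_mod_cast hkl
  constructor <;> linarith

theorem nonneg_or_nonpos (h : Ξ.IsHorizontalRect P k l y₀ y₁) : 0 ≤ y₀ ∨ y₁ ≤ 0 := by
  by_contra hc
  push Not at hc
  obtain ⟨h1, h2⟩ := mid_mem h.pos_lt
  have h3 : ((l : ℕ) : ℝ) + 1 ≤ N := by exact_mod_cast l.2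
  have h4 : (0 : ℝ) ≤ (k : ℕ) := Nat.cast_nonneg _
  have h5 : (((k : ℕ) : ℝ) + 1 / 2, (0 : ℝ)) ∈ Set.Ioo (k : ℝ) l ×ˢ Set.Ioo y₀ y₁ :=
    ⟨⟨h1, h2⟩, hc⟩
  exact Set.disjoint_left.1 h.interior h5
    (mem_cuts.2 (Or.inr ⟨by linarith, by linarith, rfl⟩))

theorem le_step (h : Ξ.IsHorizontalRect P k l y₀ y₁) (h0 : 0 ≤ y₀) {j : ℕ} (hkj : k < j)
    (hjl : j ≤ l) : y₁ ≤ Ξ.cumSum P j := by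
  obtain ⟨i, rfl⟩ : ∃ i, j = i + 1 := ⟨j - 1, by omega⟩
  have h1 : ((k : ℕ) : ℝ) ≤ i := by exact_mod_cast (by omega)
  have h2 : (i : ℝ) + 1 ≤ (l : ℕ) := by exact_mod_cast hjl
  have := h.height_lt
  exact le_of_mem_region (by linarith) (h.subset_region (a := ((i : ℝ) + 1 / 2, y₁))
    ⟨⟨by linarith, by linarith⟩, h.height_lt.le, le_rfl⟩)

theorem left_le (h : Ξ.IsHorizontalRect P k l y₀ y₁) (h0 : 0 ≤ y₀) : Ξ.cumSum P k ≤ y₀ := by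
  have h1 := (h.left_side (a := ((k : ℝ), y₀)) ⟨rfl, le_rfl, h.height_lt.le⟩).2
  have h2 := h.le_step h0 (j := k + 1) (by omega) h.pos_lt
  have := h.height_lt
  rcases Set.mem_uIcc.1 h1 with ⟨h3, _⟩ | ⟨h3, _⟩
  · exact h3
  · simp only at h3
    linarith

theorem right_le (h : Ξ.IsHorizontalRect P k l y₀ y₁) (h0 : 0 ≤ y₀) :
    Ξ.cumSum P (l + 1) ≤ y₀ := by
  have h1 := (h.right_side (a := ((l : ℝ), y₀)) ⟨rfl, le_rfl, h.height_lt.le⟩).2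
  have h2 := h.le_step h0 (j := l) h.pos_lt le_rfl
  have := h.height_lt
  rcases Set.mem_uIcc.1 h1 with ⟨h3, _⟩ | ⟨h3, _⟩
  · simp only at h3
    linarith
  · exact h3

theorem upperArc (h : Ξ.IsHorizontalRect P k l y₀ y₁) (h0 : 0 ≤ y₀) :
    UpperArc (Ξ.cumSum P) k l := by
  refine ⟨h.pos_lt, fun j h1 h2 => ?_⟩
  have := h.le_step h0 h1 h2
  have := h.height_lt
  exact ⟨by linarith, by linarith [h.left_le h0], by linarith [h.right_le h0]⟩

theorem lower_eq (h : Ξ.IsHorizontalRect P k l y₀ y₁) (h0 : 0 ≤ y₀) :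
    y₀ = max 0 (max (Ξ.cumSum P k) (Ξ.cumSum P (l + 1))) := by
  refine le_antisymm ?_ (max_le h0 (max_le (h.left_le h0) (h.right_le h0)))
  by_contra hc
  simp only [le_max_iff, not_or, not_le] at hc
  obtain ⟨h1, h2⟩ := mid_mem h.pos_lt
  rcases mem_cuts.1 (h.lower_side (a := (((k : ℕ) : ℝ) + 1 / 2, y₀)) ⟨⟨h1.le, h2.le⟩, rfl⟩) with
    ⟨i, hi⟩ | hi
  · obtain ⟨h3, h4⟩ := mem_of_lineCut hc.1 hc.2.1 hc.2.2 h1 h2 hi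
    have h5 := h.le_step h0 (j := i + 1) (by rw [Fin.le_def] at h3; omega) h4
    have h6 := (mem_lineCut.1 hi).1
    have := h.height_lt
    linarith
  · linarith [hc.1, hi.2.2]

theorem upper_eq (h : Ξ.IsHorizontalRect P k l y₀ y₁) (h0 : 0 ≤ y₀) :
    y₁ = runMin (Ξ.cumSum P) (k + 1) (l - k - 1) := by
  have hlt := h.height_lt
  have hkl := h.pos_lt
  rw [Fin.lt_def] at hkl
  refine eq_of_forall_lt_iff fun c => ?_
  rw [lt_runMin_iff]
  constructor
  · intro hc j h1 h2
    have := h.le_step h0 (j := j) (by omega) (by omega)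
    linarith
  · intro hc
    obtain ⟨h1, h2⟩ := mid_mem h.pos_lt
    rcases mem_cuts.1 (h.upper_side (a := (((k : ℕ) : ℝ) + 1 / 2, y₁)) ⟨⟨h1.le, h2.le⟩, rfl⟩) with
      ⟨i, hi⟩ | hi
    · obtain ⟨h3, h4⟩ := mem_of_lineCut (by linarith) (by linarith [h.left_le h0])
        (by linarith [h.right_le h0]) h1 h2 hi
      rw [(mem_lineCut.1 hi).1]
      rw [Fin.le_def] at h3
      rw [Fin.lt_def] at h4
      exact hc _ (by omega) (by omega)
    · linarith [hi.2.2]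

end IsHorizontalRect

/-- The converse of `IsHorizontalRect.upperArc`: an upper arc spans a horizontal rectangle. -/
theorem isHorizontalRect_of_upperArc {k l : Fin N} (a : UpperArc (Ξ.cumSum P) k l) :
    Ξ.IsHorizontalRect P k l (max 0 (max (Ξ.cumSum P k) (Ξ.cumSum P (l + 1))))
      (runMin (Ξ.cumSum P) (k + 1) (l - k - 1)) := by
  obtain ⟨hkl, hlt⟩ := upperArc_iff.1 a
  have hmin : ∀ j, (k : ℕ) < j → j ≤ l →
      runMin (Ξ.cumSum P) (k + 1) (l - k - 1) ≤ Ξ.cumSum P j := fun j h1 h2 =>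
    le_of_forall_lt fun c hc => lt_runMin_iff.1 hc j (by omega) (by omega)
  set y₁ := runMin (Ξ.cumSum P) (k + 1) (l - k - 1) with hy₁
  set y₀ := max 0 (max (Ξ.cumSum P k) (Ξ.cumSum P (l + 1))) with hy₀
  have h0 : 0 ≤ y₀ := le_max_left _ _
  have h0k : Ξ.cumSum P k ≤ y₀ := (le_max_left _ _).trans (le_max_right _ _)
  have h0l : Ξ.cumSum P (l + 1) ≤ y₀ := (le_max_right _ _).trans (le_max_right _ _)
  have hk1 := hmin (k + 1) (by omega) (by omega)
  have hl1 := hmin l (by omega) le_rfl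
  have hreg : ∀ x y : ℝ, (k : ℝ) ≤ x → x ≤ l → 0 ≤ y → y ≤ y₁ → (x, y) ∈ Ξ.region P := by
    intro x y h1 h2 h3 h4
    have hx0 : 0 ≤ x := (Nat.cast_nonneg _).trans h1
    by_cases hx : x < l
    · have hf1 : (k : ℕ) ≤ ⌊x⌋₊ := Nat.le_floor h1
      have hf2 : ⌊x⌋₊ < l := (Nat.floor_lt hx0).2 hx
      refine mem_region.2 ⟨⟨⌊x⌋₊, by omega⟩, Nat.floor_le hx0, (Nat.lt_floor_add_one x).le, ?_⟩
      exact Set.mem_uIcc.2 (Or.inl ⟨h3, h4.trans (hmin _ (by simp; omega) (by simp; omega))⟩)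
    · obtain rfl : x = l := le_antisymm h2 (not_lt.1 hx)
      have e : (l : ℕ) - 1 + 1 = l := by omega
      have e' : (((l : ℕ) - 1 : ℕ) : ℝ) + 1 = (l : ℕ) := by exact_mod_cast e
      refine mem_region.2 ⟨⟨l - 1, by omega⟩, by simp only; linarith, by simp only; linarith, ?_⟩
      simp only [e]
      exact Set.mem_uIcc.2 (Or.inl ⟨h3, h4.trans hl1⟩)
  have hlR : ((l : ℕ) : ℝ) + 1 ≤ N := by exact_mod_cast l.2
  have hkR : (0 : ℝ) ≤ (k : ℕ) := Nat.cast_nonneg _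
  have hklR : ((k : ℕ) : ℝ) + 1 ≤ l := by exact_mod_cast hkl
  refine ⟨hkl, hlt, ?_, ?_, ?_, ?_, ?_, ?_⟩
  · rintro ⟨x, y⟩ ⟨⟨h1, h2⟩, h3, h4⟩
    exact hreg x y h1 h2 (h0.trans h3) h4
  · rintro ⟨x, y⟩ ⟨h1, h3, h4⟩
    exact ⟨h1, Set.mem_uIcc.2 (Or.inl ⟨h0k.trans h3, le_trans h4 hk1⟩)⟩
  · rintro ⟨x, y⟩ ⟨h1, h3, h4⟩
    exact ⟨h1, Set.mem_uIcc.2 (Or.inr ⟨h0l.trans h3, le_trans h4 hl1⟩)⟩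
  · rintro ⟨x, y⟩ ⟨⟨h1, h2⟩, h3⟩
    obtain rfl : y = y₀ := h3
    simp only at h1 h2
    -- The lower side lies on the axis or on the cut through the neighboring step that is higher.
    rcases max_choice 0 (max (Ξ.cumSum P k) (Ξ.cumSum P (l + 1))) with hc | hc
    · exact mem_cuts.2 (Or.inr ⟨by linarith, by linarith, hc⟩)
    · rcases max_choice (Ξ.cumSum P k) (Ξ.cumSum P (l + 1)) with hd | hd
      · have hyk : y₀ = Ξ.cumSum P k := hc.trans hd
        rcases Nat.eq_zero_or_pos k with hk0 | hk0
        · have : y₀ = 0 := by rw [hyk, hk0, cumSum_zero]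
          exact mem_cuts.2 (Or.inr ⟨by linarith, by linarith, this⟩)
        · have e : (k : ℕ) - 1 + 1 = k := by omega
          have e' : (((k : ℕ) - 1 : ℕ) : ℝ) + 1 = (k : ℕ) := by exact_mod_cast e
          refine mem_cuts.2 (Or.inl ⟨⟨k - 1, by omega⟩, mem_lineCut.2 ⟨?_, fun x' hx' => ?_⟩⟩)
          · simp only [e]
            exact hyk
          · rw [Set.uIcc_of_le (by simp only; linarith)] at hx'
            by_cases hx : x' ≤ k
            · refine mem_region.2 ⟨⟨k - 1, by omega⟩, hx'.1, by simp only; linarith, ?_⟩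
              simp only [e]
              exact Set.mem_uIcc.2 (Or.inl ⟨h0, hyk.le⟩)
            · exact hreg x' y₀ (not_le.1 hx).le (hx'.2.trans h2) h0 hlt.le
      · have hyl : y₀ = Ξ.cumSum P (l + 1) := hc.trans hd
        refine mem_cuts.2 (Or.inl ⟨l, mem_lineCut.2 ⟨hyl, fun x' hx' => ?_⟩⟩)
        rw [Set.uIcc_of_ge h2] at hx'
        exact hreg x' y₀ (h1.trans hx'.1) hx'.2 h0 hlt.le
  · rintro ⟨x, y⟩ ⟨⟨h1, h2⟩, h3⟩
    obtain rfl : y = y₁ := h3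
    -- The upper side lies on the cut through the lowest step `j`.
    obtain ⟨j, hj1, hj2, hj3⟩ : ∃ j, (k : ℕ) < j ∧ j ≤ l ∧ Ξ.cumSum P j ≤ y₁ := by
      by_contra hc
      push Not at hc
      exact lt_irrefl _ (lt_runMin_iff.2 fun j h1 h2 => hc j (by omega) (by omega) :
        y₁ < runMin (Ξ.cumSum P) (k + 1) (l - k - 1))
    have hj4 := le_antisymm hj3 (hmin j hj1 hj2)
    have e : j - 1 + 1 = j := by omega
    have e' : ((j - 1 : ℕ) : ℝ) + 1 = j := by exact_mod_cast e
    have b1 : ((k : ℕ) : ℝ) + 1 ≤ j := by exact_mod_cast hj1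
    have b2 : (j : ℝ) ≤ (l : ℕ) := by exact_mod_cast hj2
    refine mem_cuts.2 (Or.inl ⟨⟨j - 1, by omega⟩, mem_lineCut.2 ⟨?_, fun x' hx' => ?_⟩⟩)
    · simp only [e]
      exact hj4.symm
    · rcases Set.mem_uIcc.1 hx' with ⟨h3, h4⟩ | ⟨h3, h4⟩ <;> simp only at h1 h2 h3 h4 <;>
        exact hreg x' y₁ (by linarith) (by linarith) (h0.trans hlt.le) le_rfl
  · rw [Set.disjoint_left]
    rintro ⟨x, y⟩ ⟨⟨h1, h2⟩, h3, h4⟩ hc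
    simp only at h1 h2 h3 h4
    rcases mem_cuts.1 hc with ⟨i, hi⟩ | hi
    · obtain ⟨h5, h6⟩ := mem_of_lineCut (by linarith) (by linarith) (by linarith) h1 h2 hi
      rw [Fin.le_def] at h5
      rw [Fin.lt_def] at h6
      have := hmin (i + 1) (by omega) (by omega)
      have := (mem_lineCut.1 hi).1
      linarith
    · linarith [hi.2.2]

/-- Horizontal rectangles are arcs of the sequence of cumulative sums. -/
theorem hasRect_iff {k l : Fin N} : Ξ.HasRect P k l ↔ Arc (Ξ.cumSum P) k l := by
  constructor
  · rintro ⟨⟨y₀, y₁⟩, h⟩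
    rcases h.nonneg_or_nonpos with h0 | h0
    · exact Or.inl (h.upperArc h0)
    · right
      rw [← cumSum_neg_eq]
      exact h.neg.upperArc (by simpa using h0)
  · rintro (a | a)
    · exact ⟨(_, _), isHorizontalRect_of_upperArc a⟩
    · rw [← cumSum_neg_eq] at a
      have := (isHorizontalRect_of_upperArc a).neg
      rw [neg_neg_passport] at this
      exact ⟨(_, _), this⟩

theorem rectExtent_spec {k l : Fin N} (h : Ξ.HasRect P k l) :
    Ξ.IsHorizontalRect P k l (Ξ.rectExtent P k l).1 (Ξ.rectExtent P k l).2 := by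
  rw [rectExtent, dif_pos h]
  exact h.choose_spec

theorem IsHorizontalRect.nonneg_of_upperArc {k l : Fin N} {y₀ y₁ : ℝ}
    (h : Ξ.IsHorizontalRect P k l y₀ y₁) (a : UpperArc (Ξ.cumSum P) k l) : 0 ≤ y₀ := by
  rcases h.nonneg_or_nonpos with h0 | h0
  · exact h0
  · have b := h.neg.upperArc (by simpa using h0)
    rw [cumSum_neg_eq] at b
    exact (a.not_neg b (Nat.lt_succ_self _) a.1 (Nat.lt_succ_self _) a.1).elim

/-- The vertical extent of a rectangle above the axis. -/
theorem rectExtent_of_upperArc {k l : Fin N} (a : UpperArc (Ξ.cumSum P) k l) :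
    Ξ.rectExtent P k l = (max 0 (max (Ξ.cumSum P k) (Ξ.cumSum P (l + 1))),
      runMin (Ξ.cumSum P) (k + 1) (l - k - 1)) := by
  have h := rectExtent_spec (hasRect_iff.2 (Or.inl a))
  have h0 := h.nonneg_of_upperArc a
  exact Prod.ext (h.lower_eq h0) (h.upper_eq h0)

/-- The vertical extent of a rectangle below the axis. -/
theorem rectExtent_of_lowerArc {k l : Fin N} (a : UpperArc (-Ξ.cumSum P) k l) :
    Ξ.rectExtent P k l = (-runMin (-Ξ.cumSum P) (k + 1) (l - k - 1),
      -max 0 (max (-Ξ.cumSum P k) (-Ξ.cumSum P (l + 1)))) := by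
  have h := (rectExtent_spec (hasRect_iff.2 (Or.inr a))).neg
  rw [← cumSum_neg_eq] at a
  have h0 := h.nonneg_of_upperArc a
  have h1 := h.lower_eq h0
  have h2 := h.upper_eq h0
  simp only [cumSum_neg_eq, Pi.neg_apply] at h1 h2
  exact Prod.ext (neg_eq_iff_eq_neg.1 h2) (neg_eq_iff_eq_neg.1 h1)

theorem rectHeight_eq (k l : Fin N) :
    Ξ.rectHeight P k l = arcHeight (Ξ.cumSum P) k l + arcHeight (-Ξ.cumSum P) k l := by
  by_cases a : UpperArc (Ξ.cumSum P) k l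
  · have b : ¬ UpperArc (-Ξ.cumSum P) k l := fun b =>
      a.not_neg b (Nat.lt_succ_self _) a.1 (Nat.lt_succ_self _) a.1
    rw [arcHeight_eq_zero b, rectHeight, rectExtent_of_upperArc a, arcHeight, if_pos a.1, add_zero,
      max_eq_right (sub_nonneg.2 (upperArc_iff.1 a).2.le)]
  · rw [arcHeight_eq_zero a]
    by_cases b : UpperArc (-Ξ.cumSum P) k l
    · rw [rectHeight, rectExtent_of_lowerArc b, arcHeight, if_pos b.1, zero_add,
        max_eq_right (sub_nonneg.2 (upperArc_iff.1 b).2.le)]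
      simp only [Pi.neg_apply]
      ring
    · rw [arcHeight_eq_zero b, rectHeight, rectExtent, dif_neg fun h => ?_]
      · simp
      · exact (hasRect_iff.1 h).elim a b

end FullPassport

/-! ### Consecutive entries of sorted lists -/

/-- In a list that is sorted by `r`, two entries without an entry between them are consecutive. -/
theorem List.exists_append_cons_cons {α : Type*} {r : α → α → Prop}
    (hr : ∀ a b, r a b → ¬ r b a) {A : List α} (hA : A.Pairwise r) {x y : α} (hx : x ∈ A)
    (hy : y ∈ A) (hxy : r x y) (hno : ∀ z ∈ A, r x z → ¬ r z y) :
    ∃ A₁ A₂, A = A₁ ++ x :: y :: A₂ := by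
  induction A with
  | nil => simp at hx
  | cons a t ih =>
    rw [List.pairwise_cons] at hA
    by_cases hax : a = x
    · subst hax
      have hyt : y ∈ t := by
        rcases List.mem_cons.1 hy with rfl | h
        · exact absurd hxy (hr _ _ hxy)
        · exact h
      cases t with
      | nil => simp at hyt
      | cons b t =>
        rcases List.mem_cons.1 hyt with rfl | h
        · exact ⟨[], t, rfl⟩
        · exact absurd ((List.pairwise_cons.1 hA.2).1 y h) (hno b (by simp) (hA.1 b (by simp)))
    · have hxt : x ∈ t := (List.mem_cons.1 hx).resolve_left fun h => hax h.symm
      have hyt : y ∈ t := by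
        rcases List.mem_cons.1 hy with rfl | h
        · exact absurd (hA.1 x hxt) (hr _ _ hxy)
        · exact h
      obtain ⟨A₁, A₂, h⟩ := ih hA.2 hxt hyt fun z hz => hno z (List.mem_cons_of_mem _ hz)
      exact ⟨a :: A₁, A₂, by rw [h, List.cons_append]⟩

theorem List.formPerm_append_cons_cons {α : Type*} [DecidableEq α] {A B : List α} {x y : α}
    (h : (A ++ x :: y :: B).Nodup) : (A ++ x :: y :: B).formPerm x = y := by
  have := List.formPerm_apply_lt_getElem (A ++ x :: y :: B) h A.length (by simp)
  simpa using this

theorem runMin_le {h : ℕ → ℝ} {a n j : ℕ} (h1 : a ≤ j) (h2 : j ≤ a + n) : runMin h a n ≤ h j :=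
  le_of_forall_lt fun _ hc => lt_runMin_iff.1 hc j h1 h2

namespace FullPassport

variable {N : ℕ} {Ξ : FullPassport N} {P : Equiv.Perm (Fin N)}

theorem cumSum_succ_ne {i : ℕ} (hi : i < N) : Ξ.cumSum P (i + 1) ≠ Ξ.cumSum P i := by
  have h := Ξ.cumSum_succ P ⟨i, hi⟩
  have h0 := Ξ.wt_ne_zero (P ⟨i, hi⟩)
  simp only at h
  rw [h]
  simpa using h0

theorem IsTreePermutation.treeSeq (hP : Ξ.IsTreePermutation P) : TreeSeq N (Ξ.cumSum P) where
  zero := Ξ.cumSum_zero P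
  last := Ξ.cumSum_last P
  ne_zero := hP.ne_zero
  pos i j hij hj he hp := by
    have e : j - 1 + 1 = j := by omega
    rcases Nat.lt_or_ge (i + 1) j with h1 | h1
    · obtain ⟨q, h2, h3, h4⟩ := hP.pos ⟨i, by omega⟩ ⟨j - 1, by omega⟩
        (by rw [Fin.lt_def]; simp only; omega) (by simpa only [e] using he) hp
      simp only at h2 h3 h4
      exact ⟨q, h2, by omega, h4⟩
    · obtain rfl : j = i + 1 := by omega
      exact absurd he.symm (cumSum_succ_ne hj)
  neg i j hij hj he hp := by
    have e : j - 1 + 1 = j := by omega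
    rcases Nat.lt_or_ge (i + 1) j with h1 | h1
    · obtain ⟨q, h2, h3, h4⟩ := hP.neg ⟨i, by omega⟩ ⟨j - 1, by omega⟩
        (by rw [Fin.lt_def]; simp only; omega) (by simpa only [e] using he) hp
      simp only at h2 h3 h4
      exact ⟨q, h2, by omega, h4⟩
    · obtain rfl : j = i + 1 := by omega
      exact absurd he.symm (cumSum_succ_ne hj)

theorem wt_pos_of_upperArc_left {k : Fin N} {l : ℕ} (a : UpperArc (Ξ.cumSum P) k l) :
    0 < Ξ.wt (P k) := by
  have := (a.2 (k + 1) (Nat.lt_succ_self _) a.1).2.1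
  rw [cumSum_succ] at this
  linarith

theorem wt_neg_of_upperArc_right {k : ℕ} {l : Fin N} (a : UpperArc (Ξ.cumSum P) k l) :
    Ξ.wt (P l) < 0 := by
  have := (a.2 l a.1 le_rfl).2.2
  rw [cumSum_succ] at this
  linarith

theorem wt_neg_of_lowerArc_left {k : Fin N} {l : ℕ} (a : UpperArc (-Ξ.cumSum P) k l) :
    Ξ.wt (P k) < 0 := by
  rw [← cumSum_neg_eq] at a
  simpa [FullPassport.neg] using wt_pos_of_upperArc_left a

theorem wt_pos_of_lowerArc_right {k : ℕ} {l : Fin N} (a : UpperArc (-Ξ.cumSum P) k l) :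
    0 < Ξ.wt (P l) := by
  rw [← cumSum_neg_eq] at a
  simpa [FullPassport.neg] using wt_neg_of_upperArc_right a

/-! ### The rotation of the combed graph -/

theorem mem_rightList {i l : Fin N} : l ∈ Ξ.rightList P i ↔ Ξ.HasRect P i l := by
  simp [rightList, List.mem_insertionSort]

theorem mem_leftList {i k : Fin N} : k ∈ Ξ.leftList P i ↔ Ξ.HasRect P k i := by
  simp [leftList, List.mem_insertionSort]

theorem HasRect.lt {k l : Fin N} (h : Ξ.HasRect P k l) : k < l := by
  obtain ⟨_, h⟩ := h
  exact h.pos_lt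

theorem nodup_rightList (i : Fin N) : (Ξ.rightList P i).Nodup :=
  ((List.perm_insertionSort _ _).nodup_iff).2 ((List.nodup_finRange N).filter _)

theorem nodup_leftList (i : Fin N) : (Ξ.leftList P i).Nodup :=
  ((List.perm_insertionSort _ _).nodup_iff).2 ((List.nodup_finRange N).filter _)

theorem nodup_lists (i : Fin N) : (Ξ.rightList P i ++ Ξ.leftList P i).Nodup := by
  refine List.Nodup.append (nodup_rightList i) (nodup_leftList i) fun x h1 h2 => ?_
  exact lt_asymm (mem_rightList.1 h1).lt (mem_leftList.1 h2).lt

theorem pairwise_rightList (i : Fin N) : (Ξ.rightList P i).Pairwise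
    fun l m => (Ξ.rectExtent P i l).1 ≤ (Ξ.rectExtent P i m).1 := by
  have : Std.Total fun l m => (Ξ.rectExtent P i l).1 ≤ (Ξ.rectExtent P i m).1 :=
    ⟨fun _ _ => le_total _ _⟩
  have : IsTrans _ fun l m => (Ξ.rectExtent P i l).1 ≤ (Ξ.rectExtent P i m).1 :=
    ⟨fun _ _ _ => le_trans⟩
  exact List.pairwise_insertionSort _ _

theorem pairwise_leftList (i : Fin N) : (Ξ.leftList P i).Pairwise
    fun k m => (Ξ.rectExtent P m i).1 ≤ (Ξ.rectExtent P k i).1 := by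
  have : Std.Total fun k m => (Ξ.rectExtent P m i).1 ≤ (Ξ.rectExtent P k i).1 :=
    ⟨fun _ _ => le_total _ _⟩
  have : IsTrans _ fun k m => (Ξ.rectExtent P m i).1 ≤ (Ξ.rectExtent P k i).1 :=
    ⟨fun _ _ _ h1 h2 => le_trans h2 h1⟩
  exact List.pairwise_insertionSort _ _

theorem extent_right_lt_of_upper {i l m : Fin N} (hlm : l < m) (a : UpperArc (Ξ.cumSum P) i l)
    (b : UpperArc (Ξ.cumSum P) i m) : (Ξ.rectExtent P i m).1 < (Ξ.rectExtent P i l).1 := by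
  rw [rectExtent_of_upperArc a, rectExtent_of_upperArc b]
  have h1 := b.2 (l + 1) (by have := a.1; omega) hlm
  exact (max_lt h1.1 (max_lt h1.2.1 h1.2.2)).trans_le
    ((le_max_right _ _).trans (le_max_right _ _))

theorem extent_left_lt_of_upper {i k m : Fin N} (hkm : k < m) (a : UpperArc (Ξ.cumSum P) k i)
    (b : UpperArc (Ξ.cumSum P) m i) : (Ξ.rectExtent P k i).1 < (Ξ.rectExtent P m i).1 := by
  rw [rectExtent_of_upperArc a, rectExtent_of_upperArc b]
  have h1 := a.2 m hkm b.1.le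
  exact (max_lt h1.1 (max_lt h1.2.1 h1.2.2)).trans_le
    ((le_max_left _ _).trans (le_max_right _ _))

theorem extent_right_lt_of_lower {i l m : Fin N} (hlm : l < m) (a : UpperArc (-Ξ.cumSum P) i l)
    (b : UpperArc (-Ξ.cumSum P) i m) : (Ξ.rectExtent P i l).1 < (Ξ.rectExtent P i m).1 := by
  rw [rectExtent_of_lowerArc a, rectExtent_of_lowerArc b]
  have ha := a.1
  have hb := b.1
  rw [Fin.lt_def] at hlm
  refine neg_lt_neg ((runMin_le (j := l + 1) (by omega) (by omega)).trans_lt ?_)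
  exact lt_runMin_iff.2 fun j h1 h2 => (a.2 j (by omega) (by omega)).2.2

theorem extent_left_lt_of_lower {i k m : Fin N} (hkm : k < m) (a : UpperArc (-Ξ.cumSum P) k i)
    (b : UpperArc (-Ξ.cumSum P) m i) : (Ξ.rectExtent P m i).1 < (Ξ.rectExtent P k i).1 := by
  rw [rectExtent_of_lowerArc a, rectExtent_of_lowerArc b]
  have ha := a.1
  have hb := b.1
  rw [Fin.lt_def] at hkm
  refine neg_lt_neg ((runMin_le (j := m) (by omega) (by omega)).trans_lt ?_)
  exact lt_runMin_iff.2 fun j h1 h2 => (b.2 j (by omega) (by omega)).2.1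

theorem upperArc_of_left {i l : Fin N} (h : Ξ.HasRect P i l) (hi : 0 < Ξ.wt (P i)) :
    UpperArc (Ξ.cumSum P) i l :=
  (hasRect_iff.1 h).resolve_right fun a => lt_asymm hi (wt_neg_of_lowerArc_left a)

theorem lowerArc_of_left {i l : Fin N} (h : Ξ.HasRect P i l) (hi : Ξ.wt (P i) < 0) :
    UpperArc (-Ξ.cumSum P) i l :=
  (hasRect_iff.1 h).resolve_left fun a => lt_asymm hi (wt_pos_of_upperArc_left a)

theorem upperArc_of_right {i k : Fin N} (h : Ξ.HasRect P k i) (hi : Ξ.wt (P i) < 0) :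
    UpperArc (Ξ.cumSum P) k i :=
  (hasRect_iff.1 h).resolve_right fun a => lt_asymm hi (wt_pos_of_lowerArc_right a)

theorem lowerArc_of_right {i k : Fin N} (h : Ξ.HasRect P k i) (hi : 0 < Ξ.wt (P i)) :
    UpperArc (-Ξ.cumSum P) k i :=
  (hasRect_iff.1 h).resolve_left fun a => lt_asymm hi (wt_neg_of_upperArc_right a)

theorem _root_.List.Pairwise.strict {α : Type*} {r s : α → α → Prop} {A : List α}
    (hA : A.Pairwise r) (hn : A.Nodup) (h : ∀ a ∈ A, ∀ b ∈ A, a ≠ b → r a b → s a b) :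
    A.Pairwise s :=
  (List.Pairwise.and hA hn).imp_of_mem fun ha hb hab => h _ ha _ hb hab.2 hab.1

/-- The rectangles on the right of a black vertex are listed from the farthest to the nearest. -/
theorem rightList_black {i : Fin N} (hi : 0 < Ξ.wt (P i)) :
    (Ξ.rightList P i).Pairwise fun l m => m < l := by
  refine (pairwise_rightList i).strict (nodup_rightList i) fun l hl m hm hne hlm => ?_
  refine lt_of_le_of_ne (not_lt.1 fun hlt => ?_) hne.symm
  exact (extent_right_lt_of_upper hlt (upperArc_of_left (mem_rightList.1 hl) hi)
    (upperArc_of_left (mem_rightList.1 hm) hi)).not_ge hlm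

theorem rightList_white {i : Fin N} (hi : Ξ.wt (P i) < 0) :
    (Ξ.rightList P i).Pairwise fun l m => l < m := by
  refine (pairwise_rightList i).strict (nodup_rightList i) fun l hl m hm hne hlm => ?_
  refine lt_of_le_of_ne (not_lt.1 fun hlt => ?_) hne
  exact (extent_right_lt_of_lower hlt (lowerArc_of_left (mem_rightList.1 hm) hi)
    (lowerArc_of_left (mem_rightList.1 hl) hi)).not_ge hlm

theorem leftList_black {i : Fin N} (hi : 0 < Ξ.wt (P i)) :
    (Ξ.leftList P i).Pairwise fun l m => l < m := by
  refine (pairwise_leftList i).strict (nodup_leftList i) fun l hl m hm hne hlm => ?_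
  refine lt_of_le_of_ne (not_lt.1 fun hlt => ?_) hne
  exact (extent_left_lt_of_lower hlt (lowerArc_of_right (mem_leftList.1 hm) hi)
    (lowerArc_of_right (mem_leftList.1 hl) hi)).not_ge hlm

theorem leftList_white {i : Fin N} (hi : Ξ.wt (P i) < 0) :
    (Ξ.leftList P i).Pairwise fun l m => m < l := by
  refine (pairwise_leftList i).strict (nodup_leftList i) fun l hl m hm hne hlm => ?_
  refine lt_of_le_of_ne (not_lt.1 fun hlt => ?_) hne.symm
  exact (extent_left_lt_of_upper hlt (upperArc_of_right (mem_leftList.1 hl) hi)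
    (upperArc_of_right (mem_leftList.1 hm) hi)).not_ge hlm

theorem formPerm_of_mem_left {α : Type*} [DecidableEq α] {r : α → α → Prop}
    (hr : ∀ a b, r a b → ¬ r b a) {A B : List α} (hn : (A ++ B).Nodup) (hA : A.Pairwise r) {x y : α}
    (hx : x ∈ A) (hy : y ∈ A) (hxy : r x y) (hno : ∀ z ∈ A, r x z → ¬ r z y) :
    (A ++ B).formPerm x = y := by
  obtain ⟨A₁, A₂, rfl⟩ := List.exists_append_cons_cons hr hA hx hy hxy hno
  rw [List.append_assoc, List.cons_append, List.cons_append] at hn ⊢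
  exact List.formPerm_append_cons_cons hn

theorem formPerm_of_mem_right {α : Type*} [DecidableEq α] {r : α → α → Prop}
    (hr : ∀ a b, r a b → ¬ r b a) {A B : List α} (hn : (B ++ A).Nodup) (hA : A.Pairwise r) {x y : α}
    (hx : x ∈ A) (hy : y ∈ A) (hxy : r x y) (hno : ∀ z ∈ A, r x z → ¬ r z y) :
    (B ++ A).formPerm x = y := by
  obtain ⟨A₁, A₂, rfl⟩ := List.exists_append_cons_cons hr hA hx hy hxy hno
  rw [← List.append_assoc] at hn ⊢
  exact List.formPerm_append_cons_cons hn

theorem turn_comb_black {i x y : Fin N} (hi : 0 < Ξ.wt (P i)) (h : Ξ.posRot P i x = y) :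
    (Ξ.combGraph P).turn (P i) (P x) = P y := by
  have : P i ∈ (Ξ.combGraph P).black := hi
  rw [RibbonGraph.turn, if_pos this]
  simp [combGraph, h]

theorem turn_comb_white {i x y : Fin N} (hi : Ξ.wt (P i) < 0) (h : Ξ.posRot P i y = x) :
    (Ξ.combGraph P).turn (P i) (P x) = P y := by
  have : P i ∉ (Ξ.combGraph P).black := fun h0 => lt_asymm hi h0
  rw [RibbonGraph.turn, if_neg this, Equiv.Perm.inv_eq_iff_eq]
  simp [combGraph, h]

/-- Around a vertex, the turn on the right side leads to the next nearer rectangle. -/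
theorem turn_comb_right {i l l' : Fin N} (h : Ξ.HasRect P i l) (h' : Ξ.HasRect P i l') (hl : l' < l)
    (hno : ∀ z, Ξ.HasRect P i z → z < l → ¬ l' < z) :
    (Ξ.combGraph P).turn (P i) (P l) = P l' := by
  rcases lt_or_gt_of_ne (Ξ.wt_ne_zero (P i)) with hi | hi
  · refine turn_comb_white hi (formPerm_of_mem_left (fun a b => lt_asymm) (nodup_lists i)
      (rightList_white hi) (mem_rightList.2 h') (mem_rightList.2 h) hl fun z hz h1 h2 => ?_)
    exact hno z (mem_rightList.1 hz) h2 h1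
  · refine turn_comb_black hi (formPerm_of_mem_left (fun a b h1 h2 => lt_asymm h1 h2)
      (nodup_lists i) (rightList_black hi) (mem_rightList.2 h) (mem_rightList.2 h') hl
      fun z hz h1 h2 => ?_)
    exact hno z (mem_rightList.1 hz) h1 h2

/-- Around a vertex, the turn on the left side leads to the next nearer rectangle. -/
theorem turn_comb_left {i k k' : Fin N} (h : Ξ.HasRect P k i) (h' : Ξ.HasRect P k' i) (hk : k < k')
    (hno : ∀ z, Ξ.HasRect P z i → k < z → ¬ z < k') :
    (Ξ.combGraph P).turn (P i) (P k) = P k' := by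
  rcases lt_or_gt_of_ne (Ξ.wt_ne_zero (P i)) with hi | hi
  · refine turn_comb_white hi (formPerm_of_mem_right (fun a b h1 h2 => lt_asymm h1 h2)
      (nodup_lists i) (leftList_white hi) (mem_leftList.2 h') (mem_leftList.2 h) hk
      fun z hz h1 h2 => ?_)
    exact hno z (mem_leftList.1 hz) h2 h1
  · refine turn_comb_black hi (formPerm_of_mem_right (fun a b => lt_asymm)
      (nodup_lists i) (leftList_black hi) (mem_leftList.2 h) (mem_leftList.2 h') hk
      fun z hz h1 h2 => ?_)
    exact hno z (mem_leftList.1 hz) h1 h2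

/-! ### The combed graph is a tree -/

theorem combGraph_adj {k l : Fin N} :
    (Ξ.combGraph P).graph.Adj (P k) (P l) ↔ Ξ.HasRect P k l ∨ Ξ.HasRect P l k := by
  simp [combGraph]

theorem combGraph_adj' {u v : Fin N} : (Ξ.combGraph P).graph.Adj u v ↔
    Ξ.HasRect P (P.symm u) (P.symm v) ∨ Ξ.HasRect P (P.symm v) (P.symm u) := Iff.rfl

theorem combGraph_weight {u v : Fin N} : (Ξ.combGraph P).weight s(u, v) =
    Ξ.rectHeight P (P.symm u) (P.symm v) + Ξ.rectHeight P (P.symm v) (P.symm u) := rfl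

theorem rectHeight_pos {k l : Fin N} (h : Ξ.HasRect P k l) : 0 < Ξ.rectHeight P k l := by
  rw [rectHeight_eq]
  rcases hasRect_iff.1 h with a | a
  · exact add_pos_of_pos_of_nonneg (arcHeight_pos_iff.2 a) (arcHeight_nonneg _ _ _)
  · exact add_pos_of_nonneg_of_pos (arcHeight_nonneg _ _ _) (arcHeight_pos_iff.2 a)

theorem rectHeight_nonneg (k l : Fin N) : 0 ≤ Ξ.rectHeight P k l := by
  rw [rectHeight_eq]
  exact add_nonneg (arcHeight_nonneg _ _ _) (arcHeight_nonneg _ _ _)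

theorem rectHeight_eq_zero {k l : Fin N} (h : ¬ Ξ.HasRect P k l) : Ξ.rectHeight P k l = 0 := by
  rw [hasRect_iff] at h
  rw [rectHeight_eq, arcHeight_eq_zero fun a => h (Or.inl a),
    arcHeight_eq_zero fun a => h (Or.inr a), add_zero]

/-- The heights of the rectangles at a vertical line add up to its length: on either side and on
either side of the axis, they telescope. -/
theorem sum_weight (i : Fin N) :
    ∑ u, (Ξ.combGraph P).weight s(P i, u) = |Ξ.wt (P i)| := by
  rw [← Equiv.sum_comp P]
  simp only [combGraph_weight, Equiv.symm_apply_apply, rectHeight_eq, Finset.sum_add_distrib]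
  have hN : (-Ξ.cumSum P) N = 0 := by simp [cumSum_last]
  have h0 : (-Ξ.cumSum P) 0 = 0 := by simp [cumSum_zero]
  have e1 := sum_arcHeight_right (Ξ.cumSum_last P) i.2
  have e2 := sum_arcHeight_right hN i.2
  have e3 := sum_arcHeight_left (Ξ.cumSum_zero P) i.2
  have e4 := sum_arcHeight_left h0 i.2
  rw [Finset.sum_range] at e1 e2 e3 e4
  rw [e1, e2, e3, e4]
  simp only [Pi.neg_apply]
  have hs := Ξ.cumSum_succ P i
  generalize Ξ.cumSum P (i + 1) = y at *
  generalize Ξ.cumSum P i = x at *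
  have : Ξ.wt (P i) = y - x := by linarith
  rw [this]
  rcases le_total x y with h1 | h1 <;> rcases le_total 0 x with h2 | h2 <;>
    rcases le_total 0 y with h3 | h3 <;>
    simp only [abs_of_nonneg, abs_of_nonpos, h1, h2, h3, max_eq_left, max_eq_right, sub_nonneg,
      sub_nonpos, neg_nonneg, neg_nonpos, neg_le_neg_iff] <;>
    linarith

theorem posRot_isCycleOn (i : Fin N) :
    (Ξ.posRot P i).IsCycleOn {j | Ξ.HasRect P i j ∨ Ξ.HasRect P j i} := by
  have := (nodup_lists (Ξ := Ξ) (P := P) i).isCycleOn_formPerm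
  unfold posRot
  simpa only [List.mem_append, mem_rightList, mem_leftList] using this

theorem combGraph_isForest (hac : (Ξ.combGraph P).graph.IsAcyclic) :
    Ξ.IsForest (Ξ.combGraph P) where
  acyclic := hac
  bicolored u v h := by
    obtain ⟨k, rfl⟩ := P.surjective u
    obtain ⟨l, rfl⟩ := P.surjective v
    change 0 < Ξ.wt (P k) ↔ ¬ 0 < Ξ.wt (P l)
    rcases combGraph_adj.1 h with h | h <;> rcases hasRect_iff.1 h with a | a
    · exact iff_of_true (wt_pos_of_upperArc_left a) (wt_neg_of_upperArc_right a).not_gt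
    · exact iff_of_false (wt_neg_of_lowerArc_left a).not_gt (not_not.2 (wt_pos_of_lowerArc_right a))
    · exact iff_of_false (wt_neg_of_upperArc_right a).not_gt (not_not.2 (wt_pos_of_upperArc_left a))
    · exact iff_of_true (wt_pos_of_lowerArc_right a) (wt_neg_of_lowerArc_left a).not_gt
  weight_pos e he := by
    induction e with | _ u v
    rw [SimpleGraph.mem_edgeSet, combGraph_adj'] at he
    rw [combGraph_weight]
    rcases he with h | h
    · exact add_pos_of_pos_of_nonneg (rectHeight_pos h) (rectHeight_nonneg _ _)
    · exact add_pos_of_nonneg_of_pos (rectHeight_nonneg _ _) (rectHeight_pos h)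
  weight_eq_zero e he := by
    induction e with | _ u v
    rw [SimpleGraph.mem_edgeSet, combGraph_adj', not_or] at he
    rw [combGraph_weight, rectHeight_eq_zero he.1, rectHeight_eq_zero he.2, add_zero]
  rot_isCycleOn v := by
    obtain ⟨i, rfl⟩ := P.surjective v
    have h := (posRot_isCycleOn (Ξ := Ξ) (P := P) i).conj (g := P)
    have e1 : (Ξ.combGraph P).rot (P i) = P * Ξ.posRot P i * P⁻¹ := by
      ext x; simp [combGraph]
    have e2 : (Ξ.combGraph P).graph.neighborSet (P i) =
        P '' {j | Ξ.HasRect P i j ∨ Ξ.HasRect P j i} := by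
      ext x
      obtain ⟨j, rfl⟩ := P.surjective x
      simp [combGraph_adj]
    rw [e1, e2]
    exact h
  rot_eq_self v u h := by
    obtain ⟨i, rfl⟩ := P.surjective v
    obtain ⟨j, rfl⟩ := P.surjective u
    rw [combGraph_adj, not_or] at h
    have : Ξ.posRot P i j = j := List.formPerm_apply_of_notMem (by
      simp [mem_rightList, mem_leftList, h])
    simp [combGraph, this]
  wt_black v hv := by
    obtain ⟨i, rfl⟩ := P.surjective v
    rw [sum_weight, abs_of_pos hv]
  wt_white v hv := by
    obtain ⟨i, rfl⟩ := P.surjective v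
    rw [sum_weight, abs_of_nonpos (not_lt.1 hv), neg_neg]

theorem combGraph_connected (hP : Ξ.IsTreePermutation P) : (Ξ.combGraph P).graph.Connected := by
  have hN := Ξ.nonempty
  let Q : ℕ → Fin N := fun k => if h : k < N then P ⟨k, h⟩ else P ⟨0, hN⟩
  have hQ : ∀ k : Fin N, Q k = P k := fun k => by simp [Q]
  have hR : Equivalence fun k l => (Ξ.combGraph P).graph.Reachable (Q k) (Q l) :=
    ⟨fun _ => .rfl, fun h => h.symm, fun h h' => h.trans h'⟩
  have key : ∀ k : Fin N, (Ξ.combGraph P).graph.Reachable (P ⟨0, hN⟩) (P k) := fun k => by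
    have := hP.treeSeq.rel_of_arc hR (fun k l hl a => ?_) k.2
    · simpa only [hQ k, hQ ⟨0, hN⟩] using! this
    · have hk := a.lt
      have h1 := hQ ⟨k, by omega⟩
      have h2 := hQ ⟨l, hl⟩
      simp only at h1 h2
      simp only [h1, h2]
      exact (combGraph_adj.2 (Or.inl (hasRect_iff.2 a))).reachable
  have : Nonempty (Fin N) := ⟨⟨0, hN⟩⟩
  refine ⟨fun u v => ?_⟩
  obtain ⟨i, rfl⟩ := P.surjective u
  obtain ⟨j, rfl⟩ := P.surjective v
  exact (key i).symm.trans (key j)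

/-- The edge `e` comes from an arc with lowest (highest) step `m`. -/
def HasBottom (Ξ : FullPassport N) (P : Equiv.Perm (Fin N)) (e : Sym2 (Fin N)) (m : ℕ) : Prop :=
  ∃ k l : Fin N, e = s(P k, P l) ∧
    (UpperArc (Ξ.cumSum P) k l ∧ IsBottom (Ξ.cumSum P) k l m ∨
      UpperArc (-Ξ.cumSum P) k l ∧ IsBottom (-Ξ.cumSum P) k l m)

theorem HasBottom.inj {e e' : Sym2 (Fin N)} {m : ℕ} (h : Ξ.HasBottom P e m)
    (h' : Ξ.HasBottom P e' m) : e = e' := by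
  obtain ⟨k, l, rfl, h⟩ := h
  obtain ⟨k', l', rfl, h'⟩ := h'
  have : (k : ℕ) = k' ∧ (l : ℕ) = l' := by
    rcases h with ⟨a, b⟩ | ⟨a, b⟩ <;> rcases h' with ⟨a', b'⟩ | ⟨a', b'⟩
    · exact a.eq_of_isBottom b a' b'
    · exact (a.not_neg a' b.1 b.2.1 b'.1 b'.2.1).elim
    · exact (a'.not_neg a b'.1 b'.2.1 b.1 b.2.1).elim
    · exact a.eq_of_isBottom b a' b'
  rw [Fin.ext this.1, Fin.ext this.2]

/-- There are at most as many arcs as steps, since an arc is determined by its lowest step. -/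
theorem card_edgeSet_le (hP : Ξ.IsTreePermutation P) :
    Nat.card (Ξ.combGraph P).graph.edgeSet ≤ N - 1 := by
  classical
  have hex : ∀ e : (Ξ.combGraph P).graph.edgeSet, ∃ m, Ξ.HasBottom P e m ∧ 0 < m ∧ m < N := by
    rintro ⟨e, he⟩
    have key : ∀ k l : Fin N, Ξ.HasRect P k l → ∃ m, Ξ.HasBottom P s(P k, P l) m ∧ 0 < m ∧ m < N := by
      intro k l h
      rcases hasRect_iff.1 h with a | a
      · obtain ⟨m, hm⟩ := hP.treeSeq.exists_bottom l.2 a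
        exact ⟨m, ⟨k, l, rfl, Or.inl ⟨a, hm⟩⟩, by have := hm.1; omega, by have := hm.2.1; omega⟩
      · obtain ⟨m, hm⟩ := hP.treeSeq.negate.exists_bottom l.2 a
        exact ⟨m, ⟨k, l, rfl, Or.inr ⟨a, hm⟩⟩, by have := hm.1; omega, by have := hm.2.1; omega⟩
    induction e with | _ u v
    obtain ⟨k, rfl⟩ := P.surjective u
    obtain ⟨l, rfl⟩ := P.surjective v
    rcases combGraph_adj.1 he with h | h
    · exact key k l h
    · simpa only [Sym2.eq_swap] using key l k h
  choose f hf hf0 hfN using hex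
  have hinj : Function.Injective fun e => (⟨f e - 1, by have := hf0 e; have := hfN e; omega⟩ :
      Fin (N - 1)) := by
    intro e e' hee
    have h1 : f e - 1 = f e' - 1 := congrArg Fin.val hee
    have h2 : f e = f e' := by have := hf0 e; have := hf0 e'; omega
    have h3 := hf e'
    rw [← h2] at h3
    exact Subtype.ext ((hf e).inj h3)
  simpa using Nat.card_le_card_of_injective _ hinj

theorem combGraph_isTree (hP : Ξ.IsTreePermutation P) : Ξ.IsTree (Ξ.combGraph P) := by
  have hc := combGraph_connected hP
  have ht : (Ξ.combGraph P).graph.IsTree := by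
    rw [SimpleGraph.isTree_iff_connected_and_card]
    refine ⟨hc, ?_⟩
    have h1 := card_edgeSet_le hP
    -- A connected graph on `N` vertices with at most `N - 1` edges is a tree.
    have h2 := hc.card_vert_le_card_edgeSet_add_one
    simp only [Nat.card_eq_fintype_card (α := Fin N), Fintype.card_fin] at h2 ⊢
    have := Ξ.nonempty
    omega
  exact { combGraph_isForest ht.isAcyclic with connected := hc }

theorem one_lt (Ξ : FullPassport N) : 1 < N := by
  rcases Nat.lt_or_ge 1 N with h | h
  · exact h
  · have h0 := Ξ.nonempty
    obtain rfl : N = 1 := by omega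
    exact absurd (by simpa using Ξ.sum_wt) (Ξ.wt_ne_zero 0)

theorem comb_mem (hP : Ξ.IsTreePermutation P) : Ξ.comb P ∈ Ξ.twiceMarkedTrees := by
  refine ⟨combGraph_isTree hP, fun h => ?_⟩
  have := P.injective h
  rw [Fin.mk.injEq] at this
  have := Ξ.one_lt
  omega

end FullPassport

/-! ### Trees: parents and weights -/

/-- In a tree, at most one neighbor of a vertex is closer to the root `a`. -/
theorem SimpleGraph.IsTree.parent_unique {V : Type*} {T : SimpleGraph V} (hT : T.IsTree) (a : V)
    {v u u' : V} (h : T.Adj v u) (h' : T.Adj v u') (hd : T.dist a v = T.dist a u + 1)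
    (hd' : T.dist a v = T.dist a u' + 1) : u = u' := by
  obtain ⟨p, hp, hpl⟩ := (hT.connected a v).exists_path_of_dist
  have key : ∀ w, T.Adj v w → T.dist a v = T.dist a w + 1 → w = p.penultimate := by
    intro w hw hdw
    obtain ⟨q, hq, hql⟩ := (hT.connected a w).exists_path_of_dist
    refine hT.isAcyclic.eq_penultimate_of_adj_end hp hw ?_
    refine hT.isAcyclic.mem_support_of_ne_mem_support_of_adj_of_isPath hp hq hw fun hv => ?_
    have := congrArg SimpleGraph.Walk.length (hT.isAcyclic.path_concat hp hq hw hv)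
    rw [SimpleGraph.Walk.length_concat] at this
    omega
  rw [key u h hd, key u' h' hd']

/-- On a tree, only the zero weight adds up to zero at every vertex. -/
theorem SimpleGraph.IsTree.eq_zero_of_sum_eq_zero {V : Type*} [Fintype V] {T : SimpleGraph V}
    (hT : T.IsTree) {d : Sym2 V → ℝ} (hd : ∀ e ∉ T.edgeSet, d e = 0)
    (hs : ∀ v, ∑ u, d s(v, u) = 0) : d = 0 := by
  classical
  by_contra hne
  obtain ⟨a⟩ := hT.connected.nonempty
  have hex : ∃ v u, d s(v, u) ≠ 0 ∧ T.dist a v = T.dist a u + 1 := by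
    obtain ⟨e, he⟩ := Function.ne_iff.1 hne
    induction e with | _ v u
    have hadj : T.Adj v u := by
      by_contra h
      exact he (hd _ h)
    rcases hT.dist_eq_dist_add_one_of_adj a hadj with h | h
    · exact ⟨v, u, he, h⟩
    · exact ⟨u, v, by rwa [Sym2.eq_swap], h⟩
  obtain ⟨v₀, u₀, h₀⟩ := hex
  -- At a vertex `v` of maximal distance from the root with a nonzero weight towards the root, this is
  -- the only nonzero weight.
  obtain ⟨v, hv, hmax⟩ := (Finset.univ.filter fun v => ∃ u, d s(v, u) ≠ 0 ∧
    T.dist a v = T.dist a u + 1).exists_max_image (T.dist a) ⟨v₀, by simpa using ⟨u₀, h₀⟩⟩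
  simp only [Finset.mem_filter, Finset.mem_univ, true_and] at hv hmax
  obtain ⟨u, hu, hdist⟩ := hv
  have hadj : ∀ {x y}, d s(x, y) ≠ 0 → T.Adj x y := fun {x y} h => by
    by_contra h'
    exact h (hd _ h')
  have := hs v
  rw [Finset.sum_eq_single u (fun w _ hw => ?_) (by simp)] at this
  · exact hu this
  · by_contra hvw
    rcases hT.dist_eq_dist_add_one_of_adj a (hadj hvw) with h | h
    · exact hw (hT.parent_unique a (hadj hvw) (hadj hu) h hdist)
    · have := hmax w ⟨v, by rwa [Sym2.eq_swap], h⟩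
      omega

/-! ### Cyclic permutations that agree up to two values -/

theorem Equiv.Perm.IsCycleOn.sign_eq {α : Type*} [Fintype α] [DecidableEq α] {f g : Equiv.Perm α}
    {s : Set α} (hs : s.Nontrivial) (hf : f.IsCycleOn s) (hg : g.IsCycleOn s)
    (hf' : ∀ x ∉ s, f x = x) (hg' : ∀ x ∉ s, g x = x) : f.sign = g.sign := by
  have hsupp : ∀ {k : Equiv.Perm α}, k.IsCycleOn s → (∀ x ∉ s, k x = x) →
      k.IsCycle ∧ (k.support : Set α) = s := by
    intro k hk hk'
    refine ⟨Equiv.Perm.isCycle_iff_exists_isCycleOn.2 ⟨s, hs, hk, fun x hx => ?_⟩, ?_⟩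
    · by_contra h
      exact hx (hk' x h)
    · ext x
      simp only [Finset.mem_coe, Equiv.Perm.mem_support]
      exact ⟨fun h => by_contra fun h' => h (hk' x h'), fun h => hk.apply_ne hs h⟩
  obtain ⟨h1, h2⟩ := hsupp hf hf'
  obtain ⟨h3, h4⟩ := hsupp hg hg'
  have : f.support = g.support := by exact_mod_cast h2.trans h4.symm
  rw [h1.sign, h3.sign, this]

/-- Two cyclic permutations of a set that agree wherever the first one does not take one of two
given values are equal: otherwise they differ by a transposition and have opposite signs. -/
theorem Equiv.Perm.IsCycleOn.eq_of_agree {α : Type*} [Fintype α] [DecidableEq α]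
    {f g : Equiv.Perm α} {s : Set α} (hf : f.IsCycleOn s) (hg : g.IsCycleOn s)
    (hf' : ∀ x ∉ s, f x = x) (hg' : ∀ x ∉ s, g x = x) {v v' : α} (hv : v ∈ s) (hv' : v' ∈ s)
    (h : ∀ x ∈ s, f x ≠ v → f x ≠ v' → f x = g x) : f = g := by
  have h1 : ∀ y, y ≠ v → y ≠ v' → g (f⁻¹ y) = y := fun y h1 h2 => by
    obtain ⟨x, rfl⟩ := f.surjective y
    rw [Equiv.Perm.inv_def, Equiv.symm_apply_apply]
    by_cases hx : x ∈ s
    · exact (h x hx h1 h2).symm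
    · rw [hf' x hx, hg' x hx]
  -- `k` fixes everything except possibly `v` and `v'`, so that it is the identity or their swap.
  set k : Equiv.Perm α := g * f⁻¹ with hk
  have hgk : g = k * f := by simp [hk]
  have h2 : ∀ y, y ≠ v → y ≠ v' → k y = y := h1
  have hkv : k v = v ∨ k v = v' := by
    by_contra hc
    push Not at hc
    exact hc.1 (k.injective (h2 _ hc.1 hc.2))
  have hkv' : k v' = v ∨ k v' = v' := by
    by_contra hc
    push Not at hc
    exact hc.2 (k.injective (h2 _ hc.1 hc.2))
  by_cases hvv : v = v'
  · subst hvv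
    have : k = 1 := by
      ext y
      by_cases hy : y = v
      · rw [hy]; simpa using hkv
      · exact h2 y hy hy
    rw [hgk, this, one_mul]
  · rcases hkv with e | e
    · have e' : k v' = v' := hkv'.resolve_left fun h => hvv (k.injective (e.trans h.symm))
      have : k = 1 := by
        ext y
        by_cases hy : y = v
        · rw [hy]; exact e
        · by_cases hy' : y = v'
          · rw [hy']; exact e'
          · exact h2 y hy hy'
      rw [hgk, this, one_mul]
    · have e' : k v' = v := hkv'.resolve_right fun h => hvv (k.injective (e.trans h.symm))
      have : k = Equiv.swap v v' := by
        ext y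
        by_cases hy : y = v
        · rw [hy, Equiv.swap_apply_left, e]
        · by_cases hy' : y = v'
          · rw [hy', Equiv.swap_apply_right, e']
          · rw [Equiv.swap_apply_of_ne_of_ne hy hy', h2 y hy hy']
      have hsign := hf.sign_eq ⟨v, hv, v', hv', hvv⟩ hg hf' hg'
      rw [hgk, this, Equiv.Perm.sign_mul, Equiv.Perm.sign_swap hvv] at hsign
      exact absurd hsign.symm (by simp)

/-! ### Noncrossing drawings of a tree -/

namespace RibbonGraph

variable {N : ℕ}

theorem colorSign_eq (G : RibbonGraph N) (v : Fin N) : G.colorSign v = 1 ∨ G.colorSign v = -1 := by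
  rw [colorSign]
  split_ifs <;> simp

theorem colorSign_mul_self (G : RibbonGraph N) (v : Fin N) : G.colorSign v * G.colorSign v = 1 := by
  rcases G.colorSign_eq v with h | h <;> rw [h] <;> norm_num

/-- If the vertices of `G` are placed on a line in the order `P`, then the edges can be drawn as
arcs without crossings, such that the arcs over any point of the line have their left ends all of
the same color. -/
structure Noncrossing (G : RibbonGraph N) (P : Equiv.Perm (Fin N)) : Prop where
  nest : ∀ k l i j : Fin N, G.graph.Adj (P k) (P l) → k < i → i < l → G.graph.Adj (P i) (P j) →
    k ≤ j ∧ j ≤ l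
  side : ∀ k l k' l' : Fin N, G.graph.Adj (P k) (P l) → G.graph.Adj (P k') (P l') → k < l →
    k' < l' → k < l' → k' < l → G.colorSign (P k) = G.colorSign (P k')

end RibbonGraph

namespace FullPassport

variable {N : ℕ} {Ξ : FullPassport N}

theorem IsForest.colorSign_of_adj {G : RibbonGraph N} (hG : Ξ.IsForest G) {u v : Fin N}
    (h : G.graph.Adj u v) : G.colorSign v = -G.colorSign u := by
  have := hG.bicolored u v h
  rw [RibbonGraph.colorSign, RibbonGraph.colorSign]
  by_cases hu : u ∈ G.black <;> by_cases hv : v ∈ G.black <;> simp_all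

theorem IsForest.wt_eq {G : RibbonGraph N} (hG : Ξ.IsForest G) (v : Fin N) :
    Ξ.wt v = G.colorSign v * ∑ u, G.weight s(v, u) := by
  rw [RibbonGraph.colorSign]
  split_ifs with h
  · rw [hG.wt_black v h, one_mul]
  · rw [hG.wt_white v h, neg_one_mul]

open Classical in
/-- The arcs over the step between the positions `i - 1` and `i`. -/
noncomputable def straddle (G : RibbonGraph N) (P : Equiv.Perm (Fin N)) (i : ℕ) :
    Finset (Fin N × Fin N) :=
  Finset.univ.filter fun x => G.graph.Adj (P x.1) (P x.2) ∧ x.1.val < i ∧ i ≤ x.2.val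

theorem mem_straddle {G : RibbonGraph N} {P : Equiv.Perm (Fin N)} {i : ℕ} {k l : Fin N} :
    (k, l) ∈ straddle G P i ↔ G.graph.Adj (P k) (P l) ∧ k.val < i ∧ i ≤ l.val := by
  simp [straddle]

section

variable {G : RibbonGraph N} {P : Equiv.Perm (Fin N)} (hG : Ξ.IsTree G)

include hG

/-- The height of a step is the signed weight of the arcs over it: the edges between two vertices
before the step cancel. -/
theorem IsTree.cumSum_eq (i : ℕ) : Ξ.cumSum P i =
    ∑ x ∈ straddle G P i, G.colorSign (P x.1) * G.weight s(P x.1, P x.2) := by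
  classical
  set f : Fin N → Fin N → ℝ := fun j l => G.colorSign (P j) * G.weight s(P j, P l) with hf
  have hanti : ∀ j l, f l j = -f j l := fun j l => by
    simp only [hf]
    by_cases h : G.graph.Adj (P j) (P l)
    · rw [hG.colorSign_of_adj h, Sym2.eq_swap, neg_mul]
    · rw [hG.weight_eq_zero s(P j, P l) h, hG.weight_eq_zero s(P l, P j) fun h' => h h'.symm]
      simp
  set A : Finset (Fin N) := Finset.univ.filter fun j => j.val < i with hA
  have h1 : Ξ.cumSum P i = ∑ j ∈ A, ∑ l, f j l := by
    rw [cumSum]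
    refine Finset.sum_congr rfl fun j _ => ?_
    rw [hG.wt_eq, ← Equiv.sum_comp P, Finset.mul_sum]
  have h2 : ∑ j ∈ A, ∑ l ∈ A, f j l = 0 := by
    have : ∑ j ∈ A, ∑ l ∈ A, f j l = -∑ j ∈ A, ∑ l ∈ A, f j l := by
      conv_lhs => rw [Finset.sum_comm]
      simp only [← Finset.sum_neg_distrib]
      exact Finset.sum_congr rfl fun j _ => Finset.sum_congr rfl fun l _ => hanti j l
    linarith
  have h3 : ∑ j ∈ A, ∑ l, f j l = ∑ j ∈ A, ∑ l ∈ Aᶜ, f j l := by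
    have : ∀ j ∈ A, ∑ l, f j l = ∑ l ∈ A, f j l + ∑ l ∈ Aᶜ, f j l := fun j _ =>
      (Finset.sum_add_sum_compl A _).symm
    rw [Finset.sum_congr rfl this, Finset.sum_add_distrib, h2, zero_add]
  rw [h1, h3, ← Finset.sum_product']
  symm
  refine Finset.sum_subset (fun x hx => ?_) fun x hx hx' => ?_
  · obtain ⟨k, l⟩ := x
    have := mem_straddle.1 hx
    simp [hA, this]
  · obtain ⟨k, l⟩ := x
    rw [mem_straddle] at hx'
    have hn : ¬ G.graph.Adj (P k) (P l) := fun h => hx' ⟨h, by simpa [hA] using hx⟩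
    simp only
    rw [hG.weight_eq_zero s(P k, P l) hn, mul_zero]

variable (hc : G.Noncrossing P)

include hc

theorem IsTree.color_mul_cumSum {i : ℕ} {x : Fin N × Fin N} (hx : x ∈ straddle G P i) :
    G.colorSign (P x.1) * Ξ.cumSum P i = ∑ y ∈ straddle G P i, G.weight s(P y.1, P y.2) := by
  rw [hG.cumSum_eq, Finset.mul_sum]
  refine Finset.sum_congr rfl fun y hy => ?_
  obtain ⟨k, l⟩ := x
  obtain ⟨k', l'⟩ := y
  rw [mem_straddle] at hx hy
  have := hc.side k l k' l' hx.1 hy.1 (by omega) (by omega) (by omega) (by omega)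
  simp only
  rw [this, ← mul_assoc, G.colorSign_mul_self, one_mul]

omit hc in
theorem IsTree.weight_pos_of_mem_straddle {i : ℕ} {x : Fin N × Fin N} (hx : x ∈ straddle G P i) :
    0 < G.weight s(P x.1, P x.2) :=
  hG.weight_pos _ (mem_straddle.1 hx).1

theorem IsTree.color_mul_cumSum_pos {i : ℕ} {x : Fin N × Fin N} (hx : x ∈ straddle G P i) :
    0 < G.colorSign (P x.1) * Ξ.cumSum P i := by
  rw [hG.color_mul_cumSum hc hx]
  exact Finset.sum_pos (fun y hy => hG.weight_pos_of_mem_straddle hy) ⟨x, hx⟩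

/-- Comparison of the heights of two steps through the arcs over them. -/
theorem IsTree.cumSum_lt {i j : ℕ} {k l : Fin N} (hx : (k, l) ∈ straddle G P j)
    (hi : (k, l) ∉ straddle G P i) (hsub : ∀ k' l', (k', l') ∈ straddle G P i →
      G.colorSign (P k') = G.colorSign (P k) → (k', l') ∈ straddle G P j) :
    G.colorSign (P k) * Ξ.cumSum P i < G.colorSign (P k) * Ξ.cumSum P j := by
  have hpos := hG.color_mul_cumSum_pos hc hx
  rcases (straddle G P i).eq_empty_or_nonempty with he | ⟨⟨k', l'⟩, hy⟩
  · rw [hG.cumSum_eq i, he]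
    simpa using hpos
  · have hposy := hG.color_mul_cumSum_pos hc hy
    simp only at hpos hposy
    by_cases hcol : G.colorSign (P k') = G.colorSign (P k)
    · have e1 := hG.color_mul_cumSum hc hx
      have e2 := hG.color_mul_cumSum hc hy
      simp only [hcol] at e1 e2
      rw [e1, e2]
      refine Finset.sum_lt_sum_of_subset (fun z hz => ?_) hx hi
        (hG.weight_pos_of_mem_straddle hx)
        fun z hz _ => (hG.weight_pos_of_mem_straddle hz).le
      obtain ⟨k'', l''⟩ := z
      refine hsub k'' l'' hz ?_
      rw [mem_straddle] at hy hz
      rw [← hcol]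
      exact hc.side _ _ _ _ hz.1 hy.1 (by omega) (by omega) (by omega) (by omega)
    · have : G.colorSign (P k') = -G.colorSign (P k) := by
        rcases G.colorSign_eq (P k) with h | h <;> rcases G.colorSign_eq (P k') with h' | h' <;>
          simp_all
      rw [this] at hposy
      linarith

/-- Every edge of a noncrossing drawing is an arc of the height sequence. -/
theorem IsTree.arc_of_adj {k l : Fin N} (hkl : k < l) (h : G.graph.Adj (P k) (P l)) :
    Arc (Ξ.cumSum P) k l := by
  have key : ∀ j, (k : ℕ) < j → j ≤ l → 0 < G.colorSign (P k) * Ξ.cumSum P j ∧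
      G.colorSign (P k) * Ξ.cumSum P k < G.colorSign (P k) * Ξ.cumSum P j ∧
      G.colorSign (P k) * Ξ.cumSum P (l + 1) < G.colorSign (P k) * Ξ.cumSum P j := by
    intro j h1 h2
    have hx : (k, l) ∈ straddle G P j := mem_straddle.2 ⟨h, h1, h2⟩
    refine ⟨hG.color_mul_cumSum_pos hc hx, hG.cumSum_lt hc hx
      (fun hk => lt_irrefl _ (mem_straddle.1 hk).2.1) fun k' l' hy hcol => ?_,
      hG.cumSum_lt hc hx (fun hl => Nat.not_succ_le_self _ (mem_straddle.1 hl).2.2)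
      fun k' l' hy hcol => ?_⟩
    · rw [mem_straddle] at hy ⊢
      have hne : l' ≠ k := fun e => by
        have := hG.colorSign_of_adj hy.1
        rw [e, hcol] at this
        rcases G.colorSign_eq (P k) with h | h <;> rw [h] at this <;> norm_num at this
      have := hc.nest k' l' k l hy.1 (by omega) (by omega) h
      exact ⟨hy.1, by omega, by omega⟩
    · rw [mem_straddle] at hy ⊢
      have hne : k' ≠ l := fun e => by
        have := hG.colorSign_of_adj h
        rw [← e, hcol] at this
        rcases G.colorSign_eq (P k) with h | h <;> rw [h] at this <;> norm_num at this
      have := hc.nest k' l' l k hy.1 (by omega) (by omega) h.symm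
      exact ⟨hy.1, by omega, by omega⟩
  rw [Fin.lt_def] at hkl
  rcases G.colorSign_eq (P k) with h | h
  · simp only [h, one_mul] at key
    exact Or.inl ⟨hkl, key⟩
  · simp only [h, neg_one_mul] at key
    exact Or.inr ⟨hkl, key⟩

/-- Two steps of the same nonzero height are separated by a step closer to the axis: otherwise the
arcs over the two steps would be the same, and the vertices between them would be disconnected
from the others. -/
theorem IsTree.exists_lower {i j : ℕ} (hi : 0 < i) (hij : i < j) (hj : j ≤ N) {s : ℝ}
    (hs : s = 1 ∨ s = -1) (he : Ξ.cumSum P i = Ξ.cumSum P j) (hpos : 0 < s * Ξ.cumSum P i) :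
    ∃ q, i < q ∧ q < j ∧ s * Ξ.cumSum P q < s * Ξ.cumSum P i := by
  by_contra hno
  push Not at hno
  have hcol : ∀ m, Ξ.cumSum P m = Ξ.cumSum P i → ∀ k l, (k, l) ∈ straddle G P m →
      G.colorSign (P k) = s := by
    intro m hm k l hx
    have := hG.color_mul_cumSum_pos hc hx
    simp only [hm] at this
    rcases hs with rfl | rfl <;> rcases G.colorSign_eq (P k) with h | h <;> rw [h] at this ⊢ <;>
      linarith
  -- An edge over the step `i` does not end before the step `j`: the step after its end `q` would be
  -- closer to the axis, since the arcs over it are among those over `i`, without this edge.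
  have caseA : ∀ k q : Fin N, (k, q) ∈ straddle G P i → ¬ (q : ℕ) < j := by
    intro k q hx hq
    have hk := hcol i rfl k q hx
    have hlt := hG.cumSum_lt hc hx (i := q + 1)
      (fun h => Nat.not_succ_le_self _ (mem_straddle.1 h).2.2) fun b e hy hb => ?_
    · rw [hk] at hlt
      rw [mem_straddle] at hx
      rcases Nat.lt_or_ge (q + 1) j with h1 | h1
      · exact (hno (q + 1) (by omega) h1).not_gt hlt
      · have : (q : ℕ) + 1 = j := by omega
        rw [this, he] at hlt
        exact lt_irrefl _ hlt
    · rw [mem_straddle] at hx hy ⊢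
      have hne : b ≠ q := fun h => by
        have := hG.colorSign_of_adj hx.1
        rw [← h, hb] at this
        rcases G.colorSign_eq (P k) with h | h <;> rw [h] at this <;> norm_num at this
      refine ⟨hy.1, ?_, by omega⟩
      by_contra hbi
      have := hc.nest k q b e hx.1 (by omega) (by omega) hy.1
      omega
  -- The mirror image: an edge over the step `j` does not start after the step `i`.
  have caseB : ∀ b e : Fin N, (b, e) ∈ straddle G P j → ¬ i ≤ (b : ℕ) := by
    intro b e hx hb
    have hk := hcol j he.symm b e hx
    have hlt := hG.cumSum_lt hc hx (i := b) (fun h => lt_irrefl _ (mem_straddle.1 h).2.1)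
      fun b' e' hy hb' => ?_
    · rw [hk, ← he] at hlt
      rw [mem_straddle] at hx
      rcases Nat.lt_or_ge i b with h1 | h1
      · exact (hno b h1 hx.2.1).not_gt hlt
      · have : (b : ℕ) = i := by omega
        rw [this] at hlt
        exact lt_irrefl _ hlt
    · rw [mem_straddle] at hx hy ⊢
      have hne : e' ≠ b := fun h => by
        have := hG.colorSign_of_adj hy.1
        rw [h, hb'] at this
        rcases G.colorSign_eq (P b) with h | h <;> rw [h] at this <;> norm_num at this
      have := hc.nest b' e' b e hy.1 (by omega) (by omega) hx.1
      exact ⟨hy.1, by omega, by omega⟩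
  -- Now some edge of a walk from position `i` to position `0` leaves the positions `i, …, j - 1`.
  obtain ⟨p⟩ := hG.connected (P ⟨i, by omega⟩) (P ⟨0, by omega⟩)
  obtain ⟨d, -, hd1, hd2⟩ := p.exists_boundary_dart
    {v | i ≤ (P.symm v).val ∧ (P.symm v).val < j} (by simpa using hij) (by simpa using by omega)
  have hadj := d.adj
  obtain ⟨x, hx⟩ := P.surjective d.fst
  obtain ⟨y, hy⟩ := P.surjective d.snd
  rw [← hx, ← hy] at hadj
  rw [Set.mem_ofPred_eq, ← hx, Equiv.symm_apply_apply] at hd1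
  rw [Set.mem_ofPred_eq, ← hy, Equiv.symm_apply_apply] at hd2
  rcases Nat.lt_or_ge y i with h | h
  · exact caseA y x (mem_straddle.2 ⟨hadj.symm, h, hd1.1⟩) hd1.2
  · exact caseB x y (mem_straddle.2 ⟨hadj, hd1.2, by omega⟩) hd1.1

/-- The order of the vertices in a noncrossing drawing is a tree permutation. No height vanishes, as
some edge lies over every step. -/
theorem IsTree.isTreePermutation : Ξ.IsTreePermutation P where
  ne_zero i h0 hN he := by
    obtain ⟨p⟩ := hG.connected (P ⟨0, by omega⟩) (P ⟨i, by omega⟩)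
    obtain ⟨d, -, hd1, hd2⟩ := p.exists_boundary_dart
      {v | (P.symm v).val < i} (by simpa using h0) (by simp)
    have hadj := d.adj
    obtain ⟨x, hx⟩ := P.surjective d.fst
    obtain ⟨y, hy⟩ := P.surjective d.snd
    rw [← hx, ← hy] at hadj
    rw [Set.mem_ofPred_eq, ← hx, Equiv.symm_apply_apply] at hd1
    rw [Set.mem_ofPred_eq, ← hy, Equiv.symm_apply_apply] at hd2
    have := hG.color_mul_cumSum_pos hc (mem_straddle.2 ⟨hadj, hd1, not_lt.1 hd2⟩)
    rw [he, mul_zero] at this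
    exact lt_irrefl _ this
  pos k l hkl he hpos := by
    have hk : 0 < (k : ℕ) := by
      by_contra h
      have : (k : ℕ) = 0 := by omega
      rw [this, cumSum_zero] at hpos
      exact lt_irrefl _ hpos
    obtain ⟨q, h1, h2, h3⟩ := hG.exists_lower hc hk (by omega) (by omega) (Or.inl rfl) he
      (by simpa using hpos)
    exact ⟨q, h1, by omega, by simpa using h3⟩
  neg k l hkl he hneg := by
    have hk : 0 < (k : ℕ) := by
      by_contra h
      have : (k : ℕ) = 0 := by omega
      rw [this, cumSum_zero] at hneg
      exact lt_irrefl _ hneg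
    obtain ⟨q, h1, h2, h3⟩ := hG.exists_lower hc hk (by omega) (by omega) (Or.inr rfl) he
      (by simpa using hneg)
    exact ⟨q, h1, by omega, by simpa using h3⟩

/-- The combed graph contains the tree `G` and is a tree itself, so that they are equal. -/
theorem IsTree.graph_combGraph : (Ξ.combGraph P).graph = G.graph := by
  have hT := (combGraph_isTree (hG.isTreePermutation hc))
  have hle : G.graph ≤ (Ξ.combGraph P).graph := by
    intro u v h
    obtain ⟨k, rfl⟩ := P.surjective u
    obtain ⟨l, rfl⟩ := P.surjective v
    rw [combGraph_adj]
    rcases lt_trichotomy k l with hkl | rfl | hkl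
    · exact Or.inl (hasRect_iff.2 (hG.arc_of_adj hc hkl h))
    · exact absurd h (SimpleGraph.irrefl _)
    · exact Or.inr (hasRect_iff.2 (hG.arc_of_adj hc hkl h.symm))
  have hmin := SimpleGraph.isTree_iff_minimal_connected.1 ⟨hT.connected, hT.acyclic⟩
  exact le_antisymm (hmin.2 hG.connected hle) hle

omit hc in
theorem IsTree.black_eq : G.black = {v | 0 < Ξ.wt v} := by
  have hpos : ∀ v, 0 ≤ ∑ u, G.weight s(v, u) := fun v => Finset.sum_nonneg fun u _ => by
    by_cases h : s(v, u) ∈ G.graph.edgeSet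
    · exact (hG.weight_pos _ h).le
    · exact (hG.weight_eq_zero _ h).ge
  ext v
  constructor
  · intro h
    have h0 := hG.wt_black v h
    exact lt_of_le_of_ne (h0 ▸ hpos v) (Ξ.wt_ne_zero v).symm
  · intro h
    by_contra hv
    have h0 := hG.wt_white v hv
    have := hpos v
    rw [Set.mem_ofPred_eq] at h
    linarith

theorem IsTree.weight_combGraph : (Ξ.combGraph P).weight = G.weight := by
  have hT := (combGraph_isTree (hG.isTreePermutation hc))
  have hg := hG.graph_combGraph hc
  refine sub_eq_zero.1 (SimpleGraph.IsTree.eq_zero_of_sum_eq_zero ⟨hG.connected, hG.acyclic⟩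
    (fun e he => ?_) fun v => ?_)
  · rw [Pi.sub_apply, hG.weight_eq_zero e he, hT.weight_eq_zero e (by rwa [hg]), sub_zero]
  · simp only [Pi.sub_apply, Finset.sum_sub_distrib]
    by_cases hv : v ∈ G.black
    · have hv' : v ∈ (Ξ.combGraph P).black := by rw [hT.black_eq, ← hG.black_eq]; exact hv
      rw [← hG.wt_black v hv, ← hT.wt_black v hv', sub_self]
    · have hv' : v ∉ (Ξ.combGraph P).black := by rw [hT.black_eq, ← hG.black_eq]; exact hv
      have h1 := hG.wt_white v hv
      have h2 := hT.wt_white v hv'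
      linarith

end

end FullPassport

/-! ### Rectangles drawn by the folding map -/

namespace RibbonGraph

variable {N : ℕ} {G : RibbonGraph N} {a b : Fin N}

/-- `u` hangs from `w` in the forest that the edges outside the path `p` form, rooted at the
vertices of `p`. -/
def Child (p : G.graph.Walk a b) (w u : Fin N) : Prop :=
  G.graph.Adj w u ∧ s(w, u) ∉ p.edges ∧ G.graph.dist a u = G.graph.dist a w + 1

/-- The edges at `w` from which stacks of rectangles at `w` start: the edges of the path, or the
edge towards the path. -/
def Stop (p : G.graph.Walk a b) (w v : Fin N) : Prop :=
  s(w, v) ∈ p.edges ∨ Child p v w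

/-- The first `i` edges that follow `v` around `w` belong to its stack. -/
def Free (p : G.graph.Walk a b) (w v : Fin N) (i : ℕ) : Prop :=
  ∀ j, 1 ≤ j → j ≤ i → ¬ Stop p w ((G.turn w ^ j) v)

end RibbonGraph

open RibbonGraph

/-- `p` is a nontrivial path in the plane tree `G` of passport `Ξ`. -/
structure FoldPath {N : ℕ} (Ξ : FullPassport N) (G : RibbonGraph N) {a b : Fin N}
    (p : G.graph.Walk a b) : Prop where
  tree : Ξ.IsTree G
  isPath : p.IsPath
  length_pos : 0 < p.length

namespace FoldPath

variable {N : ℕ} {Ξ : FullPassport N} {G : RibbonGraph N} {a b : Fin N} {p : G.graph.Walk a b}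
  (F : FoldPath Ξ G p)

include F

theorem isTree : G.graph.IsTree := ⟨F.tree.connected, F.tree.acyclic⟩

theorem dist_getVert {i : ℕ} (hi : i ≤ p.length) : G.graph.dist a (p.getVert i) = i := by
  obtain ⟨q, hq, hql⟩ := (F.tree.connected a (p.getVert i)).exists_path_of_dist
  have := F.isTree.existsUnique_path a (p.getVert i)
  rw [← hql, this.unique hq (F.isPath.take i), SimpleGraph.Walk.take_length]
  omega

theorem getVert_inj {i j : ℕ} (hi : i ≤ p.length) (hj : j ≤ p.length)
    (h : p.getVert i = p.getVert j) : i = j := by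
  rw [← F.dist_getVert hi, h, F.dist_getVert hj]

omit F in
theorem getVert_edge {i : ℕ} (hi : i < p.length) : s(p.getVert i, p.getVert (i + 1)) ∈ p.edges :=
  (p.mk_mem_edges_iff_exists).2 ⟨i, hi, rfl⟩

omit F in
theorem mem_edges {u v : Fin N} (h : s(u, v) ∈ p.edges) : ∃ i < p.length,
    (u = p.getVert i ∧ v = p.getVert (i + 1)) ∨ (u = p.getVert (i + 1) ∧ v = p.getVert i) := by
  obtain ⟨i, hi, h⟩ := (p.mk_mem_edges_iff_exists).1 h
  rw [Sym2.eq_iff] at h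
  rcases h with ⟨h1, h2⟩ | ⟨h1, h2⟩
  · exact ⟨i, hi, Or.inl ⟨h1.symm, h2.symm⟩⟩
  · exact ⟨i, hi, Or.inr ⟨h2.symm, h1.symm⟩⟩

theorem not_mem_support_of_child {w u : Fin N} (h : Child p w u) : u ∉ p.support := by
  intro hu
  obtain ⟨i, rfl, hi⟩ := SimpleGraph.Walk.mem_support_iff_exists_getVert.1 hu
  obtain ⟨h1, h2, h3⟩ := h
  rw [F.dist_getVert hi] at h3
  obtain ⟨i, rfl⟩ : ∃ k, i = k + 1 := ⟨i - 1, by omega⟩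
  have : w = p.getVert i := F.isTree.parent_unique a h1.symm (p.adj_getVert_succ (by omega)).symm
    (by rw [F.dist_getVert hi]; exact h3) (by rw [F.dist_getVert hi, F.dist_getVert (by omega)])
  exact h2 (this ▸ getVert_edge (by omega))

theorem child_unique {w w' u : Fin N} (h : Child p w u) (h' : Child p w' u) : w = w' :=
  F.isTree.parent_unique a h.1.symm h'.1.symm h.2.2 h'.2.2

theorem exists_child {u : Fin N} (hu : u ∉ p.support) : ∃ w, Child p w u := by
  obtain ⟨q, hq, hql⟩ := (F.tree.connected a u).exists_path_of_dist
  have hne : a ≠ u := fun h => hu (h ▸ p.start_mem_support)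
  have hnil : ¬ q.Nil := SimpleGraph.Walk.not_nil_of_ne hne
  have hadj := q.adj_penultimate hnil
  refine ⟨q.penultimate, hadj, fun h => hu (p.snd_mem_support_of_mem_edges h), ?_⟩
  rcases F.isTree.dist_eq_dist_add_one_of_adj a hadj with h | h
  · have h1 := SimpleGraph.dist_le q.dropLast
    have h2 := q.length_dropLast_add_one hnil
    omega
  · exact h

theorem adj_cases {u v : Fin N} (h : G.graph.Adj u v) :
    s(u, v) ∈ p.edges ∨ Child p u v ∨ Child p v u := by
  by_cases he : s(u, v) ∈ p.edges
  · exact Or.inl he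
  · rcases F.isTree.dist_eq_dist_add_one_of_adj a h with h1 | h1
    · exact Or.inr (Or.inr ⟨h.symm, by rwa [Sym2.eq_swap], h1⟩)
    · exact Or.inr (Or.inl ⟨h, he, h1⟩)

omit F in
theorem stop_adj {w v : Fin N} (h : Stop p w v) : G.graph.Adj w v := by
  rcases h with h | h
  · exact p.adj_of_mem_edges h
  · exact h.1.symm

theorem stop_or_child {w v : Fin N} (h : G.graph.Adj w v) : Stop p w v ∨ Child p w v := by
  rcases F.adj_cases h with h | h | h
  · exact Or.inl (Or.inl h)
  · exact Or.inr h
  · exact Or.inl (Or.inr h)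

omit F in
theorem not_stop_of_child {w u : Fin N} (h : Child p w u) : ¬ Stop p w u := by
  rintro (h' | h')
  · exact h.2.1 h'
  · have := h.2.2
    have := h'.2.2
    omega

/-- The stops at a vertex: one if it is an end of the path or not on the path, and otherwise two. -/
theorem stop_cases (w : Fin N) : ∃ v v', Stop p w v ∧ Stop p w v' ∧
    ∀ t, Stop p w t → t = v ∨ t = v' := by
  by_cases hw : w ∈ p.support
  · obtain ⟨i, rfl, hi⟩ := SimpleGraph.Walk.mem_support_iff_exists_getVert.1 hw
    have key : ∀ t, Stop p (p.getVert i) t → (i < p.length ∧ t = p.getVert (i + 1)) ∨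
        (0 < i ∧ t = p.getVert (i - 1)) := by
      rintro t (ht | ht)
      · obtain ⟨j, hj, ⟨h1, h2⟩ | ⟨h1, h2⟩⟩ := mem_edges ht
        · obtain rfl := F.getVert_inj hi hj.le h1
          exact Or.inl ⟨hj, h2⟩
        · obtain rfl := F.getVert_inj hi hj h1
          exact Or.inr ⟨by omega, by simpa using h2⟩
      · exact absurd hw (F.not_mem_support_of_child ht)
    have hr : i < p.length → Stop p (p.getVert i) (p.getVert (i + 1)) := fun h =>
      Or.inl (getVert_edge h)
    have hl : 0 < i → Stop p (p.getVert i) (p.getVert (i - 1)) := fun h => by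
      obtain ⟨k, rfl⟩ : ∃ k, i = k + 1 := ⟨i - 1, by omega⟩
      refine Or.inl ?_
      rw [Sym2.eq_swap, Nat.add_sub_cancel]
      exact getVert_edge (by omega)
    have hpos := F.length_pos
    rcases Nat.lt_or_ge i p.length with h1 | h1
    · rcases Nat.eq_zero_or_pos i with h2 | h2
      · refine ⟨_, _, hr h1, hr h1, fun t ht => ?_⟩
        rcases key t ht with h | h
        · exact Or.inl h.2
        · omega
      · refine ⟨_, _, hr h1, hl h2, fun t ht => ?_⟩
        rcases key t ht with h | h
        · exact Or.inl h.2
        · exact Or.inr h.2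
    · refine ⟨_, _, hl (by omega), hl (by omega), fun t ht => ?_⟩
      rcases key t ht with h | h
      · omega
      · exact Or.inl h.2
  · obtain ⟨v, hv⟩ := F.exists_child hw
    refine ⟨v, v, Or.inr hv, Or.inr hv, fun t ht => Or.inl ?_⟩
    rcases ht with ht | ht
    · exact absurd (p.fst_mem_support_of_mem_edges ht) hw
    · exact F.child_unique ht hv

theorem stop_eq_of_notMem {w v v' : Fin N} (hw : w ∉ p.support) (h : Stop p w v)
    (h' : Stop p w v') : v = v' := by
  rcases h with h | h
  · exact absurd (p.fst_mem_support_of_mem_edges h) hw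
  · rcases h' with h' | h'
    · exact absurd (p.fst_mem_support_of_mem_edges h') hw
    · exact F.child_unique h h'

theorem turn_isCycleOn (w : Fin N) : (G.turn w).IsCycleOn (G.graph.neighborSet w) := by
  rw [RibbonGraph.turn]
  split_ifs
  · exact F.tree.rot_isCycleOn w
  · exact (F.tree.rot_isCycleOn w).inv

theorem turn_eq_self {w x : Fin N} (h : x ∉ G.graph.neighborSet w) : G.turn w x = x := by
  have h1 := F.tree.rot_eq_self w x h
  rw [RibbonGraph.turn]
  split_ifs
  · exact h1
  · rw [Equiv.Perm.inv_eq_iff_eq, h1]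

theorem adj_turn_pow {w v : Fin N} (h : G.graph.Adj w v) (i : ℕ) :
    G.graph.Adj w ((G.turn w ^ i) v) :=
  (F.turn_isCycleOn w).1.mapsTo.perm_pow i h

/-- `Free` is the condition for attaching rectangles: off the path there is only one stop, so that the
rotation cannot reach a second one without returning to the first. -/
theorem free_iff {w v : Fin N} (h : Stop p w v) (i : ℕ) : Free p w v i ↔
    ∀ j ∈ Finset.Icc 1 i, (G.turn w ^ j) v ≠ v ∧ s(w, (G.turn w ^ j) v) ∉ p.edges := by
  constructor
  · intro hf j hj
    rw [Finset.mem_Icc] at hj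
    have := hf j hj.1 hj.2
    exact ⟨fun he => this (he.symm ▸ h), fun he => this (Or.inl he)⟩
  · rintro hf j h1 h2 (h' | h')
    · exact (hf j (by simp [h1, h2])).2 h'
    · exact (hf j (by simp [h1, h2])).1
        (F.stop_eq_of_notMem (F.not_mem_support_of_child h') (Or.inr h') h)

omit F in
/-- The stack and the index of an edge in its stack are unique. -/
theorem index_unique {w v v' : Fin N} {i i' : ℕ} (h : Stop p w v) (h' : Stop p w v')
    (hf : Free p w v i) (hf' : Free p w v' i') (he : (G.turn w ^ i) v = (G.turn w ^ i') v') :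
    v = v' ∧ i = i' := by
  wlog hle : i ≤ i' generalizing v v' i i'
  · have := this h' h hf' hf he.symm (by omega)
    exact ⟨this.1.symm, this.2.symm⟩
  obtain ⟨k, rfl⟩ := Nat.exists_eq_add_of_le hle
  rw [pow_add, Equiv.Perm.mul_apply, (G.turn w ^ i).injective.eq_iff] at he
  rcases Nat.eq_zero_or_pos k with rfl | hk
  · exact ⟨by simpa using he, rfl⟩
  · exact absurd (he ▸ h) (hf' k hk (by omega))

/-- Every edge at `w` belongs to a stack: turning back from it leads to a stop. -/
theorem exists_index {w u : Fin N} (h : G.graph.Adj w u) :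
    ∃ v i, Stop p w v ∧ Free p w v i ∧ (G.turn w ^ i) v = u := by
  classical
  obtain ⟨s, -, hs, -, -⟩ := F.stop_cases w
  obtain ⟨n, hn⟩ := (F.turn_isCycleOn w).exists_pow_eq' (Set.toFinite _) (stop_adj hs) h
  have hex : ∃ i, i ≤ n ∧ Stop p w ((G.turn w ^ (n - i)) s) := ⟨n, le_rfl, by simpa using hs⟩
  obtain ⟨h1, h2⟩ := Nat.find_spec hex
  refine ⟨_, Nat.find hex, h2, fun j hj1 hj2 hj3 => ?_, ?_⟩
  · refine Nat.find_min hex (m := Nat.find hex - j) (by omega) ⟨by omega, ?_⟩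
    rw [← Equiv.Perm.mul_apply, ← pow_add] at hj3
    have e : j + (n - Nat.find hex) = n - (Nat.find hex - j) := by omega
    rwa [e] at hj3
  · rw [← Equiv.Perm.mul_apply, ← pow_add, Nat.add_sub_cancel' h1, hn]

theorem exists_index_of_child {w u : Fin N} (h : Child p w u) :
    ∃ v i, 1 ≤ i ∧ Stop p w v ∧ Free p w v i ∧ (G.turn w ^ i) v = u := by
  obtain ⟨v, i, h1, h2, h3⟩ := F.exists_index h.1
  refine ⟨v, i, ?_, h1, h2, h3⟩
  by_contra hi
  obtain rfl : i = 0 := by omega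
  exact not_stop_of_child h (by simpa [← h3] using h1)

theorem child_turn_pow {w v : Fin N} {i : ℕ} (h : Stop p w v) (hf : Free p w v i) (hi : 1 ≤ i) :
    Child p w ((G.turn w ^ i) v) :=
  (F.stop_or_child (F.adj_turn_pow (stop_adj h) i)).resolve_left (hf i hi le_rfl)

/-! ### The drawn rectangles -/

theorem stop_of_drawn {v w : Fin N} {r : FoldRect} (h : G.Drawn p v w r) : Stop p w v := by
  induction h with
  | path i hi => exact Or.inl (by rw [Sym2.eq_swap]; exact getVert_edge hi)
  | path_symm i hi => exact Or.inl (getVert_edge hi)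
  | attach v w r h i hi hfree ih =>
    exact Or.inr (F.child_turn_pow ih ((F.free_iff ih i).2 hfree) hi)

omit F in
theorem drawn_cases {v w : Fin N} {r : FoldRect} (h : G.Drawn p v w r) :
    (∃ i < p.length, v = p.getVert i ∧ w = p.getVert (i + 1) ∧ r.xv = i ∧ r.xw = i + 1) ∨
    (∃ i < p.length, v = p.getVert (i + 1) ∧ w = p.getVert i ∧ r.xv = i + 1 ∧ r.xw = i) ∨
    ∃ v₀ r₀ i, G.Drawn p v₀ v r₀ ∧ 1 ≤ i ∧ (∀ j ∈ Finset.Icc 1 i, (G.turn v ^ j) v₀ ≠ v₀ ∧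
      s(v, (G.turn v ^ j) v₀) ∉ p.edges) ∧ w = (G.turn v ^ i) v₀ ∧ r.xv = r₀.xw ∧
      r.xw = r₀.xw + (r₀.xv - r₀.xw) / 3 ^ i := by
  cases h with
  | path i hi => exact Or.inl ⟨i, hi, rfl, rfl, rfl, rfl⟩
  | path_symm i hi => exact Or.inr (Or.inl ⟨i, hi, rfl, rfl, rfl, rfl⟩)
  | attach v w r h i hi hfree => exact Or.inr (Or.inr ⟨v, r, i, h, hi, hfree, rfl, rfl, rfl⟩)

omit F in
theorem exists_drawn_swap {v w : Fin N} {r : FoldRect} (h : G.Drawn p v w r) :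
    ∃ v' r', G.Drawn p v' v r' ∧ r'.xw = r.xv := by
  cases h with
  | path i hi => exact ⟨_, _, .path_symm i hi, rfl⟩
  | path_symm i hi => exact ⟨_, _, .path i hi, rfl⟩
  | attach v w r h i hi hfree => exact ⟨_, _, h, rfl⟩

theorem drawn_mem_support {v : Fin N} {i : ℕ} {r : FoldRect} (hi : i ≤ p.length)
    (h : G.Drawn p v (p.getVert i) r) : r.xw = i := by
  rcases drawn_cases h with ⟨j, hj, -, h1, -, h2⟩ | ⟨j, hj, -, h1, -, h2⟩ | ⟨v₀, r₀, j, h1, h2, h3, h4, -⟩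
  · rw [h2, F.getVert_inj hi hj h1]
    push_cast
    rfl
  · rw [h2, F.getVert_inj hi hj.le h1]
  · have hs := F.stop_of_drawn h1
    have := F.not_mem_support_of_child (F.child_turn_pow hs ((F.free_iff hs j).2 h3) h2)
    exact absurd (h4 ▸ p.getVert_mem_support i) this

/-- The vertical segment of a vertex is unique. -/
theorem drawn_unique {w : Fin N} : ∀ {v v' : Fin N} {r r' : FoldRect}, G.Drawn p v w r →
    G.Drawn p v' w r' → r.xw = r'.xw := by
  induction hn : G.graph.dist a w using Nat.strong_induction_on generalizing w with
  | _ n ih =>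
    have key : ∀ z, z ∈ p.support ∨ G.graph.dist a z < n → ∀ {v v' : Fin N} {r r' : FoldRect},
        G.Drawn p v z r → G.Drawn p v' z r' → r.xw = r'.xw := by
      rintro z (hz | hz) v v' r r' h h'
      · obtain ⟨i, rfl, hi⟩ := SimpleGraph.Walk.mem_support_iff_exists_getVert.1 hz
        rw [F.drawn_mem_support hi h, F.drawn_mem_support hi h']
      · exact ih _ hz rfl h h'
    intro v v' r r' h h'
    by_cases hw : w ∈ p.support
    · exact key w (Or.inl hw) h h'
    obtain rfl := F.stop_eq_of_notMem hw (F.stop_of_drawn h) (F.stop_of_drawn h')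
    have hc : Child p v w := (F.stop_of_drawn h).resolve_left
      fun he => hw (p.fst_mem_support_of_mem_edges he)
    rcases drawn_cases h with ⟨j, hj, -, h1, -⟩ | ⟨j, hj, -, h1, -⟩ | ⟨v₀, r₀, i, h1, h2, h3, h4, h5, h6⟩
    · exact absurd (h1 ▸ p.getVert_mem_support _) hw
    · exact absurd (h1 ▸ p.getVert_mem_support _) hw
    rcases drawn_cases h' with ⟨j, hj, -, g1, -⟩ | ⟨j, hj, -, g1, -⟩ | ⟨v₀', r₀', i', g1, g2, g3, g4, g5, g6⟩
    · exact absurd (g1 ▸ p.getVert_mem_support _) hw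
    · exact absurd (g1 ▸ p.getVert_mem_support _) hw
    have hs := F.stop_of_drawn h1
    have hs' := F.stop_of_drawn g1
    obtain ⟨rfl, rfl⟩ := index_unique hs hs' ((F.free_iff hs i).2 h3) ((F.free_iff hs' i').2 g3)
      (h4.symm.trans g4)
    have e1 : r₀.xw = r₀'.xw := key v (Or.inr (by have := hc.2.2; omega)) h1 g1
    -- The other end of the rectangle below is on the path or closer to it than `w`.
    have e2 : r₀.xv = r₀'.xv := by
      obtain ⟨y, s, hy, hy'⟩ := exists_drawn_swap h1
      obtain ⟨y', s', hz, hz'⟩ := exists_drawn_swap g1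
      rw [← hy', ← hz']
      refine key v₀ ?_ hy hz
      rcases hs with he | he
      · exact Or.inl (p.snd_mem_support_of_mem_edges he)
      · have := hc.2.2
        have := he.2.2
        exact Or.inr (by omega)
    rw [h6, g6, e1, e2]

theorem exists_drawn {w v : Fin N} (h : Stop p w v) : ∃ r, G.Drawn p v w r := by
  induction hn : G.graph.dist a w using Nat.strong_induction_on generalizing w v with
  | _ n ih =>
    rcases h with h | h
    · obtain ⟨i, hi, ⟨rfl, rfl⟩ | ⟨rfl, rfl⟩⟩ := mem_edges h
      · exact ⟨_, .path_symm i hi⟩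
      · exact ⟨_, .path i hi⟩
    · obtain ⟨s, i, h1, h2, h3, rfl⟩ := F.exists_index_of_child h
      obtain ⟨r, hr⟩ := ih _ (by have := h.2.2; omega) h2 rfl
      exact ⟨_, .attach s v r hr i h1 ((F.free_iff h2 i).1 h3)⟩

/-- A rectangle lies over the unit interval of one edge of the path, and its black end is on the
left if and only if the black end of this edge is. -/
theorem drawn_side {v w : Fin N} {r : FoldRect} (h : G.Drawn p v w r) : ∃ j < p.length,
    (j ≤ r.xv ∧ r.xv ≤ j + 1) ∧ (j ≤ r.xw ∧ r.xw ≤ j + 1) ∧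
    0 < (r.xw - r.xv) * (G.colorSign v * G.colorSign (p.getVert j)) := by
  induction h with
  | path i hi =>
    refine ⟨i, hi, by simp, by simp, ?_⟩
    rw [G.colorSign_mul_self]
    simp
  | path_symm i hi =>
    refine ⟨i, hi, by simp, by simp, ?_⟩
    rw [F.tree.colorSign_of_adj (p.adj_getVert_succ hi), neg_mul, G.colorSign_mul_self]
    simp
  | attach v w r h i hi hfree ih =>
    obtain ⟨j, hj, ⟨h1, h2⟩, ⟨h3, h4⟩, h5⟩ := ih
    have hcol := F.tree.colorSign_of_adj (stop_adj (F.stop_of_drawn h)).symm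
    have h6 : (0 : ℝ) < 1 / 3 ^ i := by positivity
    have h7 : (1 : ℝ) / 3 ^ i ≤ 1 := by
      rw [div_le_one (by positivity)]
      exact one_le_pow₀ (by norm_num)
    have e : r.xw + (r.xv - r.xw) / 3 ^ i = r.xw + (r.xv - r.xw) * (1 / 3 ^ i) := by ring
    refine ⟨j, hj, ⟨h3, h4⟩, ?_, ?_⟩
    · simp only [e]
      generalize (1 : ℝ) / 3 ^ i = t at *
      constructor <;> nlinarith
    · simp only [e, hcol]
      have := mul_pos h5 h6
      linarith

end FoldPath

/-! ### The order of the vertical segments -/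

open Relation

theorem pow_third_le {i i' : ℕ} (h : i < i') : ((1 : ℝ) / 3) ^ i' ≤ (1 / 3) ^ i / 3 := by
  have h1 : ((1 : ℝ) / 3) ^ i' ≤ (1 / 3) ^ (i + 1) :=
    pow_le_pow_of_le_one (by norm_num) (by norm_num) h
  rw [pow_succ] at h1
  linarith

theorem Nat.cast_add_one_le_or {j j' : ℕ} (h : j ≠ j') : (j : ℝ) + 1 ≤ j' ∨ (j' : ℝ) + 1 ≤ j := by
  rcases lt_or_gt_of_ne h with h | h
  · left; exact_mod_cast h
  · right; exact_mod_cast h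

/-- `x` gives the positions of the vertical segments in the region folded along `p`. -/
structure FoldLayout {N : ℕ} (Ξ : FullPassport N) (G : RibbonGraph N) {a b : Fin N}
    (p : G.graph.Walk a b) (x : Fin N → ℝ) : Prop extends FoldPath Ξ G p where
  drawn : ∀ v w r, G.Drawn p v w r → r.xw = x w

namespace FoldLayout

variable {N : ℕ} {Ξ : FullPassport N} {G : RibbonGraph N} {a b : Fin N} {p : G.graph.Walk a b}
  {x : Fin N → ℝ} (F : FoldLayout Ξ G p x)

include F

theorem drawn_left {v w : Fin N} {r : FoldRect} (h : G.Drawn p v w r) : r.xv = x v := by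
  obtain ⟨v', r', h', he⟩ := FoldPath.exists_drawn_swap h
  rw [← he, F.drawn _ _ _ h']

theorem x_getVert {i : ℕ} (hi : i ≤ p.length) : x (p.getVert i) = i := by
  have : ∃ v r, G.Drawn p v (p.getVert i) r := by
    rcases Nat.lt_or_ge i p.length with h | h
    · exact ⟨_, _, .path_symm i h⟩
    · obtain ⟨k, rfl⟩ : ∃ k, i = k + 1 := ⟨i - 1, by have := F.length_pos; omega⟩
      exact ⟨_, _, .path k (by omega)⟩
  obtain ⟨v, r, h⟩ := this
  rw [← F.drawn _ _ _ h, F.drawn_mem_support hi h]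

/-- The lengths in a stack are divided by three from each rectangle to the next. -/
theorem x_turn_pow {w v : Fin N} {i : ℕ} (h : Stop p w v) (hf : Free p w v i) :
    x ((G.turn w ^ i) v) = x w + (x v - x w) * (1 / 3) ^ i := by
  rcases Nat.eq_zero_or_pos i with rfl | hi
  · simp
  · obtain ⟨r, hr⟩ := F.exists_drawn h
    have := F.drawn _ _ _ (.attach v w r hr i hi ((F.free_iff h i).1 hf))
    simp only at this
    rw [← this, F.drawn_left hr, F.drawn _ _ _ hr, one_div, inv_pow, div_eq_mul_inv]

/-- An edge lies over the unit interval of one edge of the path, and its left end has the color of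
the left end of this edge. -/
theorem side {u v : Fin N} (h : G.graph.Adj u v) : ∃ j < p.length,
    ((j : ℝ) ≤ x u ∧ x u ≤ j + 1) ∧ ((j : ℝ) ≤ x v ∧ x v ≤ j + 1) ∧
    0 < (x v - x u) * (G.colorSign u * G.colorSign (p.getVert j)) := by
  have key : ∀ {u v : Fin N}, Stop p v u → ∃ j < p.length,
      ((j : ℝ) ≤ x u ∧ x u ≤ j + 1) ∧ ((j : ℝ) ≤ x v ∧ x v ≤ j + 1) ∧
      0 < (x v - x u) * (G.colorSign u * G.colorSign (p.getVert j)) := by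
    intro u v hs
    obtain ⟨r, hr⟩ := F.exists_drawn hs
    have := F.drawn_side hr
    rwa [F.drawn_left hr, F.drawn _ _ _ hr] at this
  rcases F.stop_or_child h with hs | hs
  · obtain ⟨j, h1, h2, h3, h4⟩ := key hs
    refine ⟨j, h1, h3, h2, ?_⟩
    rw [F.tree.colorSign_of_adj h] at h4
    linarith
  · exact key (Or.inr hs)

theorem x_ne {u v : Fin N} (h : G.graph.Adj u v) : x u ≠ x v := by
  obtain ⟨j, -, -, -, h4⟩ := F.side h
  intro he
  rw [he, sub_self, zero_mul] at h4
  exact lt_irrefl _ h4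

/-- Two different stops at a vertex lie on opposite sides at distance one. -/
theorem stop_opposite {w v v' : Fin N} (h : Stop p w v) (h' : Stop p w v') (hne : v ≠ v') :
    x v' - x w = -(x v - x w) := by
  by_cases hw : w ∈ p.support
  · have key : ∀ {t}, Stop p w t → ∃ i j : ℕ, i ≤ p.length ∧ j ≤ p.length ∧ w = p.getVert i ∧
        t = p.getVert j ∧ (j = i + 1 ∨ i = j + 1) := by
      rintro t (ht | ht)
      · obtain ⟨i, hi, ⟨h1, h2⟩ | ⟨h1, h2⟩⟩ := FoldPath.mem_edges ht
        · exact ⟨i, i + 1, hi.le, hi, h1, h2, Or.inl rfl⟩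
        · exact ⟨i + 1, i, hi, hi.le, h1, h2, Or.inr rfl⟩
      · exact absurd hw (F.not_mem_support_of_child ht)
    obtain ⟨i, j, hi, hj, rfl, rfl, hij⟩ := key h
    obtain ⟨i', j', hi', hj', he, rfl, hij'⟩ := key h'
    obtain rfl := F.getVert_inj hi hi' he
    rw [F.x_getVert hi, F.x_getVert hj, F.x_getVert hj']
    rcases hij with rfl | rfl <;> rcases hij' with h1 | h1
    · exact absurd (by rw [h1]) hne
    · subst h1; push_cast; ring
    · subst h1; push_cast; ring
    · exact absurd (by rw [show j = j' by omega]) hne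
  · exact absurd (F.stop_eq_of_notMem hw h h') hne

/-- The branch of `u` lies between `u` and a third of the way to its parent `w`. -/
theorem branch {w u z : Fin N} (h : Child p w u) (hz : ReflTransGen (Child p) u z) :
    ∃ t : ℝ, 0 ≤ t ∧ t ≤ 1 / 3 ∧ x z = x u + t * (x w - x u) := by
  induction hz using ReflTransGen.head_induction_on generalizing w with
  | refl => exact ⟨0, le_rfl, by norm_num, by ring⟩
  | head hut htz ih =>
    rename_i u t
    obtain ⟨θ, h0, h1, h2⟩ := ih hut
    obtain ⟨v, i, hi, hs, hf, rfl⟩ := F.exists_index_of_child hut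
    obtain rfl := F.stop_eq_of_notMem (F.not_mem_support_of_child h) hs (Or.inr h)
    rw [F.x_turn_pow hs hf] at h2
    have h3 := pow_third_le hi
    have h4 : (0 : ℝ) < (1 / 3) ^ i := by positivity
    -- The branch of `t` lies between `1 - 1 / 3` and `1` times `3⁻ⁱ` of the way from `u` to `w`.
    refine ⟨(1 / 3) ^ i * (1 - θ), mul_nonneg h4.le (by linarith), ?_, by rw [h2]; ring⟩
    simp only [pow_zero] at h3
    nlinarith

/-- `z` lies in the branch that starts with the `i`-th edge of the stack of `v` at `w`; its distance
from `w` is between `2 / 3` and `1` times the length of the rectangle of this edge. -/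
theorem exists_ratio {w v z : Fin N} {i : ℕ} (hi : 1 ≤ i) (hs : Stop p w v) (hf : Free p w v i)
    (hz : ReflTransGen (Child p) ((G.turn w ^ i) v) z) :
    ∃ t : ℝ, 2 / 3 * (1 / 3) ^ i ≤ t ∧ t ≤ (1 / 3) ^ i ∧ x z = x w + (x v - x w) * t := by
  obtain ⟨θ, h0, h1, h2⟩ := F.branch (F.child_turn_pow hs hf hi) hz
  rw [F.x_turn_pow hs hf] at h2
  have h4 : (0 : ℝ) < (1 / 3) ^ i := by positivity
  refine ⟨(1 / 3) ^ i * (1 - θ), by nlinarith, by nlinarith, by rw [h2]; ring⟩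

theorem exists_root (z : Fin N) :
    ∃ j ≤ p.length, ReflTransGen (Child p) (p.getVert j) z := by
  induction hn : G.graph.dist a z using Nat.strong_induction_on generalizing z with
  | _ n ih =>
    by_cases hz : z ∈ p.support
    · obtain ⟨i, rfl, hi⟩ := SimpleGraph.Walk.mem_support_iff_exists_getVert.1 hz
      exact ⟨i, hi, .refl⟩
    · obtain ⟨w, hw⟩ := F.exists_child hz
      obtain ⟨j, hj, h⟩ := ih _ (by have := hw.2.2; omega) w rfl
      exact ⟨j, hj, h.tail hw⟩

theorem x_stop_root {j : ℕ} (hj : j ≤ p.length) {v : Fin N} (hs : Stop p (p.getVert j) v) :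
    x v - j = 1 ∨ x v - j = -1 := by
  rcases hs with h | h
  · obtain ⟨i, hi, ⟨h1, rfl⟩ | ⟨h1, rfl⟩⟩ := FoldPath.mem_edges h
    · obtain rfl := F.getVert_inj hj hi.le h1
      left
      rw [F.x_getVert hi]
      push_cast
      ring
    · obtain rfl := F.getVert_inj hj hi h1
      right
      rw [F.x_getVert hi.le]
      push_cast
      ring
  · exact absurd (p.getVert_mem_support j) (F.not_mem_support_of_child h)

/-- A tree of the forest stays within `1 / 3` of its root on the path. -/
theorem abs_root_le {j : ℕ} (hj : j ≤ p.length) {z : Fin N}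
    (hz : ReflTransGen (Child p) (p.getVert j) z) : (j : ℝ) - 1 / 3 ≤ x z ∧ x z ≤ j + 1 / 3 := by
  rcases hz.cases_head with rfl | ⟨t, ht, htz⟩
  · rw [F.x_getVert hj]
    constructor <;> linarith
  · obtain ⟨v, i, hi, hs, hf, rfl⟩ := F.exists_index_of_child ht
    obtain ⟨θ, h1, h2, h3⟩ := F.exists_ratio hi hs hf htz
    have h4 : (0 : ℝ) < (1 / 3) ^ i := by positivity
    have h5 := pow_third_le hi
    simp only [pow_zero] at h5
    rw [F.x_getVert hj] at h3
    rcases F.x_stop_root hj hs with e | e <;> rw [e] at h3 <;> constructor <;> linarith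

/-- The relative position of two vertices in the forest. -/
theorem pair_cases (z z' : Fin N) : ReflTransGen (Child p) z z' ∨ ReflTransGen (Child p) z' z ∨
    (∃ w u u', u ≠ u' ∧ Child p w u ∧ Child p w u' ∧ ReflTransGen (Child p) u z ∧
      ReflTransGen (Child p) u' z') ∨
    ∃ j j', j ≤ p.length ∧ j' ≤ p.length ∧ j ≠ j' ∧ ReflTransGen (Child p) (p.getVert j) z ∧
      ReflTransGen (Child p) (p.getVert j') z' := by
  obtain ⟨j, hj, hz⟩ := F.exists_root z
  obtain ⟨j', hj', hz'⟩ := F.exists_root z'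
  induction hz with
  | refl =>
    by_cases hjj : j = j'
    · exact Or.inl (hjj ▸ hz')
    · exact Or.inr (Or.inr (Or.inr ⟨j, j', hj, hj', hjj, .refl, hz'⟩))
  | @tail y z hy hyz ih =>
    rcases ih with h | h | ⟨w, u, u', h1, h2, h3, h4, h5⟩ | ⟨i, i', h1, h2, h3, h4, h5⟩
    · rcases h.cases_head with rfl | ⟨u', hu, huz⟩
      · exact Or.inr (Or.inl (.single hyz))
      · by_cases he : z = u'
        · exact Or.inl (he ▸ huz)
        · exact Or.inr (Or.inr (Or.inl ⟨y, z, u', he, hyz, hu, .refl, huz⟩))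
    · exact Or.inr (Or.inl (h.tail hyz))
    · exact Or.inr (Or.inr (Or.inl ⟨w, u, u', h1, h2, h3, h4.tail hyz, h5⟩))
    · exact Or.inr (Or.inr (Or.inr ⟨i, i', h1, h2, h3, h4.tail hyz, h5⟩))

theorem x_ne_of_descendant {z z' : Fin N} (hne : z ≠ z') (h : ReflTransGen (Child p) z z') :
    x z ≠ x z' := by
  rcases h.cases_head with rfl | ⟨t, ht, htz⟩
  · exact absurd rfl hne
  · obtain ⟨v, i, hi, hs, hf, rfl⟩ := F.exists_index_of_child ht
    obtain ⟨θ, h1, h2, h3⟩ := F.exists_ratio hi hs hf htz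
    have h4 : (0 : ℝ) < (1 / 3) ^ i := by positivity
    have h5 := F.x_ne (FoldPath.stop_adj hs)
    intro he
    rw [← he, left_eq_add, mul_eq_zero] at h3
    rcases h3 with h3 | h3
    · exact h5 (by linarith)
    · linarith

/-- Different vertices have different vertical segments, since disjoint branches fill disjoint
intervals. -/
theorem x_injective : Function.Injective x := by
  intro z z' he
  by_contra hne
  rcases F.pair_cases z z' with h | h | ⟨w, u, u', h1, h2, h3, h4, h5⟩ | ⟨i, i', h1, h2, h3, h4, h5⟩
  · exact F.x_ne_of_descendant hne h he
  · exact F.x_ne_of_descendant (Ne.symm hne) h he.symm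
  · obtain ⟨v, i, hi, hs, hf, rfl⟩ := F.exists_index_of_child h2
    obtain ⟨v', i', hi', hs', hf', rfl⟩ := F.exists_index_of_child h3
    obtain ⟨θ, a1, a2, a3⟩ := F.exists_ratio hi hs hf h4
    obtain ⟨θ', b1, b2, b3⟩ := F.exists_ratio hi' hs' hf' h5
    have p1 : (0 : ℝ) < (1 / 3) ^ i := by positivity
    have p2 : (0 : ℝ) < (1 / 3) ^ i' := by positivity
    have hD : x v - x w ≠ 0 := sub_ne_zero.2 (F.x_ne (FoldPath.stop_adj hs)).symm
    by_cases hv : v = v'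
    · subst hv
      have : θ = θ' := mul_left_cancel₀ hD (by linarith)
      have hii : i ≠ i' := fun h => h1 (by rw [h])
      rcases lt_or_gt_of_ne hii with h | h
      · have := pow_third_le h
        linarith
      · have := pow_third_le h
        linarith
    · rw [F.stop_opposite hs hs' hv] at b3
      have : (x v - x w) * (θ + θ') = 0 := by linarith
      rcases mul_eq_zero.1 this with h | h
      · exact hD h
      · linarith
  · have a1 := F.abs_root_le h1 h4
    have a2 := F.abs_root_le h2 h5
    rcases Nat.cast_add_one_le_or h3 with h | h <;> linarith

/-! ### No vertical segment separates a rectangle from its stack -/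

/-- The neighbors of a vertex in the branch of `t` are in this branch, apart from the parent
of `t`. -/
theorem adj_branch {w t z y : Fin N} (ht : Child p w t) (hz : ReflTransGen (Child p) t z)
    (h : G.graph.Adj z y) : y = w ∨ ReflTransGen (Child p) t y := by
  have hzs : z ∉ p.support := by
    rcases hz.cases_tail with rfl | ⟨y', -, h'⟩
    · exact F.not_mem_support_of_child ht
    · exact F.not_mem_support_of_child h'
  rcases F.adj_cases h with h | h | h
  · exact absurd (p.fst_mem_support_of_mem_edges h) hzs
  · exact Or.inr (hz.tail h)
  · rcases hz.cases_tail with rfl | ⟨y', hy, h'⟩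
    · exact Or.inl (F.child_unique h ht)
    · exact Or.inr (F.child_unique h h' ▸ hy)

/-- A vertex strictly between the two ends of the rectangle of `{w, u}` hangs from `w`, in the stack
on this rectangle or in the branch of `u`. -/
theorem between_child {w u z : Fin N} (hu : Child p w u) (hz : 0 < (x z - x w) * (x u - x z)) :
    ∃ t, Child p w t ∧ ReflTransGen (Child p) t z ∧
      ∀ y, ReflTransGen (Child p) t y → 0 ≤ (x y - x w) * (x u - x y) := by
  -- In the last three cases, `w` and `u` are in one branch or in one tree of the forest, and `z` is
  -- outside of the interval that it fills.
  rcases F.pair_cases w z with h | h | ⟨y, t, t', h1, h2, h3, h4, h5⟩ | ⟨j, j', h1, h2, h3, h4, h5⟩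
  · rcases h.cases_head with rfl | ⟨t, ht, htz⟩
    · simp at hz
    refine ⟨t, ht, htz, fun y hy => ?_⟩
    obtain ⟨v, i, hi, hs, hf, rfl⟩ := F.exists_index_of_child hu
    obtain ⟨v', i', hi', hs', hf', rfl⟩ := F.exists_index_of_child ht
    obtain ⟨θ, b1, b2, b3⟩ := F.exists_ratio hi' hs' hf' htz
    obtain ⟨θ', c1, c2, c3⟩ := F.exists_ratio hi' hs' hf' hy
    have a1 := F.x_turn_pow hs hf
    have p1 : (0 : ℝ) < (1 / 3) ^ i := by positivity
    have p2 : (0 : ℝ) < (1 / 3) ^ i' := by positivity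
    by_cases hv : v = v'
    · subst hv
      rw [a1, b3] at hz
      rw [a1, c3]
      have e1 : (x v - x w) ^ 2 * (θ * ((1 / 3) ^ i - θ)) > 0 := by
        calc _ < _ := hz
          _ = _ := by ring
      have e2 : θ < (1 / 3) ^ i := by
        by_contra hc
        have : θ * ((1 / 3) ^ i - θ) ≤ 0 :=
          mul_nonpos_of_nonneg_of_nonpos (by linarith) (by linarith)
        have := mul_nonpos_of_nonneg_of_nonpos (sq_nonneg (x v - x w)) this
        linarith
      have e3 : i ≤ i' := by
        by_contra hc
        have := pow_third_le (not_le.1 hc)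
        linarith
      have e4 : ((1 : ℝ) / 3) ^ i' ≤ (1 / 3) ^ i :=
        pow_le_pow_of_le_one (by norm_num) (by norm_num) e3
      have e5 : 0 ≤ θ' * ((1 / 3) ^ i - θ') := mul_nonneg (by linarith) (by linarith)
      calc 0 ≤ (x v - x w) ^ 2 * (θ' * ((1 / 3) ^ i - θ')) := mul_nonneg (sq_nonneg _) e5
        _ = _ := by ring
    · rw [F.stop_opposite hs hs' hv] at b3
      rw [a1, b3] at hz
      have e1 : 0 ≤ (x v - x w) ^ 2 * (θ * ((1 / 3) ^ i + θ)) :=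
        mul_nonneg (sq_nonneg _) (mul_nonneg (by linarith) (by linarith))
      have e2 : (x v - x w) ^ 2 * (θ * ((1 / 3) ^ i + θ)) < 0 := by linarith
      linarith
  · exfalso
    rcases h.cases_head with rfl | ⟨t, ht, htw⟩
    · simp at hz
    obtain ⟨v, i, hi, hs, hf, rfl⟩ := F.exists_index_of_child ht
    obtain ⟨θ, b1, b2, b3⟩ := F.exists_ratio hi hs hf htw
    obtain ⟨θ', c1, c2, c3⟩ := F.exists_ratio hi hs hf (htw.tail hu)
    have p1 : (0 : ℝ) < (1 / 3) ^ i := by positivity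
    rw [b3, c3] at hz
    have e1 : 0 ≤ (x v - x z) ^ 2 * (θ * θ') :=
      mul_nonneg (sq_nonneg _) (mul_nonneg (by linarith) (by linarith))
    have e2 : (x v - x z) ^ 2 * (θ * θ') < 0 := by linarith
    linarith
  · exfalso
    obtain ⟨v, i, hi, hs, hf, rfl⟩ := F.exists_index_of_child h2
    obtain ⟨v', i', hi', hs', hf', rfl⟩ := F.exists_index_of_child h3
    obtain ⟨θ, a1, a2, a3⟩ := F.exists_ratio hi hs hf h4
    obtain ⟨θ', b1, b2, b3⟩ := F.exists_ratio hi hs hf (h4.tail hu)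
    obtain ⟨η, c1, c2, c3⟩ := F.exists_ratio hi' hs' hf' h5
    have p1 : (0 : ℝ) < (1 / 3) ^ i := by positivity
    have p2 : (0 : ℝ) < (1 / 3) ^ i' := by positivity
    by_cases hv : v = v'
    · subst hv
      have hii : i ≠ i' := fun h => h1 (by rw [h])
      have e1 : 0 ≤ (η - θ) * (η - θ') := by
        rcases lt_or_gt_of_ne hii with h | h
        · have := pow_third_le h
          exact mul_nonneg_of_nonpos_of_nonpos (by linarith) (by linarith)
        · have := pow_third_le h
          exact mul_nonneg (by linarith) (by linarith)
      rw [a3, b3, c3] at hz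
      have e2 := mul_nonneg (sq_nonneg (x v - x y)) e1
      have e3 : (x v - x y) ^ 2 * ((η - θ) * (η - θ')) < 0 := by linarith
      linarith
    · rw [F.stop_opposite hs hs' hv] at c3
      rw [a3, b3, c3] at hz
      have e2 : 0 ≤ (x v - x y) ^ 2 * ((η + θ) * (η + θ')) :=
        mul_nonneg (sq_nonneg _) (mul_nonneg (by linarith) (by linarith))
      have e3 : (x v - x y) ^ 2 * ((η + θ) * (η + θ')) < 0 := by linarith
      linarith
  · exfalso
    have a1 := F.abs_root_le h1 h4
    have a2 := F.abs_root_le h1 (h4.tail hu)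
    have a3 := F.abs_root_le h2 h5
    rcases Nat.cast_add_one_le_or h3 with h | h
    · exact hz.not_ge (mul_nonpos_of_nonneg_of_nonpos (by linarith) (by linarith))
    · exact hz.not_ge (mul_nonpos_of_nonpos_of_nonneg (by linarith) (by linarith))

/-- A vertex strictly between the ends of an edge of the path hangs from one of the two, in a branch
that stays between them. -/
theorem between_path {j : ℕ} (hj : j < p.length) {z : Fin N} (h1 : j < x z) (h2 : x z < j + 1) :
    ∃ w t, (w = p.getVert j ∨ w = p.getVert (j + 1)) ∧ Child p w t ∧
      ReflTransGen (Child p) t z ∧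
      ∀ y, ReflTransGen (Child p) t y → j ≤ x y ∧ x y ≤ j + 1 := by
  obtain ⟨i, hi, hr⟩ := F.exists_root z
  have hb := F.abs_root_le hi hr
  have hij : i = j ∨ i = j + 1 := by
    have e1 : (i : ℝ) < (j : ℝ) + 2 := by linarith
    have e2 : (j : ℝ) < (i : ℝ) + 1 := by linarith
    have e1' : i < j + 2 := by exact_mod_cast e1
    have e2' : j < i + 1 := by exact_mod_cast e2
    omega
  rcases hr.cases_head with rfl | ⟨t, ht, htz⟩
  · rw [F.x_getVert hi] at h1 h2
    rcases hij with rfl | rfl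
    · exact absurd h1 (lt_irrefl _)
    · push_cast at h2
      exact absurd h2 (lt_irrefl _)
  refine ⟨p.getVert i, t, by rcases hij with rfl | rfl <;> simp, ht, htz, fun y hy => ?_⟩
  obtain ⟨v, n, hn, hs, hf, rfl⟩ := F.exists_index_of_child ht
  obtain ⟨θ, b1, b2, b3⟩ := F.exists_ratio hn hs hf htz
  obtain ⟨θ', c1, c2, c3⟩ := F.exists_ratio hn hs hf hy
  have p1 : (0 : ℝ) < (1 / 3) ^ n := by positivity
  have p2 := pow_third_le hn
  simp only [pow_zero] at p2
  rw [F.x_getVert hi] at b3 c3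
  rcases F.x_stop_root hi hs with e | e <;> rw [e] at b3 c3 <;> rcases hij with rfl | rfl <;>
    push_cast at b3 c3 ⊢ <;> constructor <;> linarith

/-- A vertex strictly between the ends of an edge has all its neighbors weakly between them. -/
theorem nest {w u z y : Fin N} (hwu : G.graph.Adj w u) (hz : 0 < (x z - x w) * (x u - x z))
    (hzy : G.graph.Adj z y) : 0 ≤ (x y - x w) * (x u - x y) := by
  have key : ∀ {w u : Fin N}, Child p w u → 0 < (x z - x w) * (x u - x z) →
      0 ≤ (x y - x w) * (x u - x y) := by
    intro w u h hz
    obtain ⟨t, h1, h2, h3⟩ := F.between_child h hz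
    rcases F.adj_branch h1 h2 hzy with rfl | h4
    · simp
    · exact h3 y h4
  have keyp : ∀ j < p.length, 0 < (x z - j) * ((j + 1 : ℕ) - x z) →
      0 ≤ (x y - j) * ((j + 1 : ℕ) - x y) := by
    intro j hj hz
    push_cast at hz ⊢
    have hlt : (j : ℝ) < x z ∧ x z < j + 1 := by
      rcases pos_and_pos_or_neg_and_neg_of_mul_pos hz with h | h
      · constructor <;> linarith
      · linarith
    obtain ⟨w', t, hw, h1, h2, h3⟩ := F.between_path hj hlt.1 hlt.2
    rcases F.adj_branch h1 h2 hzy with rfl | h4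
    · rcases hw with rfl | rfl
      · rw [F.x_getVert hj.le]; simp
      · rw [F.x_getVert hj]; simp
    · have := h3 y h4
      exact mul_nonneg (by linarith) (by linarith)
  rcases F.adj_cases hwu with h | h | h
  · obtain ⟨j, hj, ⟨rfl, rfl⟩ | ⟨rfl, rfl⟩⟩ := FoldPath.mem_edges h
    · rw [F.x_getVert hj, F.x_getVert hj.le] at hz ⊢
      exact keyp j hj hz
    · rw [F.x_getVert hj, F.x_getVert hj.le] at hz ⊢
      have := keyp j hj (by linarith)
      linarith
  · exact key h hz
  · have := key h (by linarith)
    linarith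

theorem noncrossing {P : Equiv.Perm (Fin N)} (hP : StrictMono (x ∘ P)) : G.Noncrossing P where
  nest k l i j hkl hki hil hij := by
    have h1 := hP hki
    have h2 := hP hil
    simp only [Function.comp_apply] at h1 h2
    have h3 := F.nest hkl (mul_pos (sub_pos.2 h1) (sub_pos.2 h2)) hij
    rcases nonneg_and_nonneg_or_nonpos_and_nonpos_of_mul_nonneg h3 with h | h
    · exact ⟨hP.le_iff_le.1 (sub_nonneg.1 h.1), hP.le_iff_le.1 (sub_nonneg.1 h.2)⟩
    · have := h1.trans h2
      linarith
  side k l k' l' h h' hkl hkl' h1 h2 := by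
    have a1 := hP hkl
    have a2 := hP hkl'
    have a3 := hP h1
    have a4 := hP h2
    simp only [Function.comp_apply] at a1 a2 a3 a4
    obtain ⟨j, -, ⟨b1, b2⟩, ⟨b3, b4⟩, b5⟩ := F.side h
    obtain ⟨j', -, ⟨c1, c2⟩, ⟨c3, c4⟩, c5⟩ := F.side h'
    have hjj : j = j' := by
      have e1 : (j : ℝ) < j' + 1 := by linarith
      have e2 : (j' : ℝ) < j + 1 := by linarith
      have e1' : j < j' + 1 := by exact_mod_cast e1
      have e2' : j' < j + 1 := by exact_mod_cast e2
      omega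
    subst hjj
    have d1 := pos_of_mul_pos_right b5 (by linarith)
    have d2 := pos_of_mul_pos_right c5 (by linarith)
    rcases G.colorSign_eq (P k) with h | h <;> rcases G.colorSign_eq (P k') with h' | h' <;>
      rw [h] at d1 ⊢ <;> rw [h'] at d2 ⊢ <;> linarith

/-! ### Combing the folded tree -/

theorem isTreePermutation {P : Equiv.Perm (Fin N)} (hP : StrictMono (x ∘ P)) :
    Ξ.IsTreePermutation P :=
  F.tree.isTreePermutation (F.noncrossing hP)

theorem hasRect_iff {P : Equiv.Perm (Fin N)} (hP : StrictMono (x ∘ P)) {k l : Fin N} :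
    Ξ.HasRect P k l ↔ k < l ∧ G.graph.Adj (P k) (P l) := by
  rw [← F.tree.graph_combGraph (F.noncrossing hP), FullPassport.combGraph_adj]
  exact ⟨fun h => ⟨h.lt, Or.inl h⟩, fun h => h.2.resolve_right fun h' => lt_asymm h.1 h'.lt⟩

/-- Between consecutive edges of a stack there are no further edges. -/
theorem no_between {w v t : Fin N} {i : ℕ} (hs : Stop p w v) (hf : Free p w v (i + 1))
    (ht : G.graph.Adj w t) (h : 0 < (x t - x ((G.turn w ^ (i + 1)) v)) *
      (x ((G.turn w ^ i) v) - x t)) : False := by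
  obtain ⟨v', i', hs', hf', rfl⟩ := F.exists_index ht
  have hf0 : Free p w v i := fun j h1 h2 => hf j h1 (by omega)
  rw [F.x_turn_pow hs hf, F.x_turn_pow hs hf0, F.x_turn_pow hs' hf'] at h
  have p1 : (0 : ℝ) < (1 / 3) ^ i := by positivity
  have p2 : (0 : ℝ) < (1 / 3) ^ i' := by positivity
  have p3 : ((1 : ℝ) / 3) ^ (i + 1) = (1 / 3) ^ i / 3 := by rw [pow_succ]; ring
  rw [p3] at h
  by_cases hv : v = v'
  · subst hv
    have e1 : ((1 / 3) ^ i' - (1 / 3 : ℝ) ^ i / 3) * ((1 / 3) ^ i - (1 / 3) ^ i') ≤ 0 := by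
      rcases Nat.lt_or_ge i i' with h1 | h1
      · have := pow_third_le h1
        exact mul_nonpos_of_nonpos_of_nonneg (by linarith) (by linarith)
      · have : ((1 : ℝ) / 3) ^ i ≤ (1 / 3) ^ i' :=
          pow_le_pow_of_le_one (by norm_num) (by norm_num) h1
        exact mul_nonpos_of_nonneg_of_nonpos (by linarith) (by linarith)
    have e2 := mul_nonpos_of_nonneg_of_nonpos (sq_nonneg (x v - x w)) e1
    linarith
  · rw [F.stop_opposite hs hs' hv] at h
    have e2 : 0 ≤ (x v - x w) ^ 2 * (((1 / 3) ^ i' + (1 / 3 : ℝ) ^ i / 3) *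
        ((1 / 3) ^ i + (1 / 3) ^ i')) := by positivity
    linarith

/-- Outside the stops, the next edge around a vertex is the next nearer one, in the tree as well as in
the combed graph. -/
theorem turn_eq {P : Equiv.Perm (Fin N)} (hP : StrictMono (x ∘ P)) {w u : Fin N}
    (hu : G.graph.Adj w u) (hs : ¬ Stop p w (G.turn w u)) :
    G.turn w u = (Ξ.combGraph P).turn w u := by
  obtain ⟨v, i, h1, h2, rfl⟩ := F.exists_index hu
  rw [← Equiv.Perm.mul_apply, ← pow_succ'] at hs ⊢
  have hf : Free p w v (i + 1) := fun j hj1 hj2 => by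
    rcases Nat.lt_or_ge i j with h | h
    · have : j = i + 1 := by omega
      rwa [this]
    · exact h2 j hj1 h
  have hx1 := F.x_turn_pow h1 h2
  have hx2 := F.x_turn_pow h1 hf
  have hu' := F.adj_turn_pow (FoldPath.stop_adj h1) (i + 1)
  have hno := fun t ht => F.no_between (t := t) h1 hf ht
  have p1 : (0 : ℝ) < (1 / 3) ^ i := by positivity
  have p3 : ((1 : ℝ) / 3) ^ (i + 1) = (1 / 3) ^ i / 3 := by rw [pow_succ]; ring
  generalize (G.turn w ^ i) v = u at *
  generalize (G.turn w ^ (i + 1)) v = u' at *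
  obtain ⟨k, rfl⟩ := P.surjective w
  obtain ⟨l, rfl⟩ := P.surjective u
  obtain ⟨m, rfl⟩ := P.surjective u'
  rw [p3] at hx2
  have hlt : ∀ {i j}, x (P i) < x (P j) → i < j := fun {i j} h => hP.lt_iff_lt.1 h
  have hgt : ∀ {i j}, i < j → x (P i) < x (P j) := fun {i j} h => hP h
  rcases lt_or_gt_of_ne (F.x_ne (FoldPath.stop_adj h1)) with h | h
  · have hD := mul_pos (sub_pos.2 h) p1
    have hkm : k < m := hlt (by linarith)
    have hml : m < l := hlt (by linarith)
    refine (FullPassport.turn_comb_right ((F.hasRect_iff hP).2 ⟨hkm.trans hml, hu⟩)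
      ((F.hasRect_iff hP).2 ⟨hkm, hu'⟩) hml fun z hz hzl hmz => ?_).symm
    refine hno (P z) ((F.hasRect_iff hP).1 hz).2 (mul_pos ?_ ?_)
    · exact sub_pos.2 (hgt hmz)
    · exact sub_pos.2 (hgt hzl)
  · have hD := mul_pos (sub_pos.2 h) p1
    have hmk : m < k := hlt (by linarith)
    have hlm : l < m := hlt (by linarith)
    refine (FullPassport.turn_comb_left ((F.hasRect_iff hP).2 ⟨hlm.trans hmk, hu.symm⟩)
      ((F.hasRect_iff hP).2 ⟨hmk, hu'.symm⟩) hlm fun z hz hzl hmz => ?_).symm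
    refine hno (P z) ((F.hasRect_iff hP).1 hz).2.symm (mul_pos_of_neg_of_neg ?_ ?_)
    · exact sub_neg.2 (hgt hmz)
    · exact sub_neg.2 (hgt hzl)

theorem black_combGraph (P : Equiv.Perm (Fin N)) : (Ξ.combGraph P).black = G.black :=
  F.tree.black_eq.symm

theorem combGraph_eq {P : Equiv.Perm (Fin N)} (hP : StrictMono (x ∘ P)) : Ξ.combGraph P = G := by
  have hc := F.noncrossing hP
  have hg := F.tree.graph_combGraph hc
  have hT := FullPassport.combGraph_isTree (F.isTreePermutation hP)
  have hturn : ∀ w, G.turn w = (Ξ.combGraph P).turn w := by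
    intro w
    obtain ⟨v, v', h1, h2, h3⟩ := F.stop_cases w
    have hcyc : ((Ξ.combGraph P).turn w).IsCycleOn (G.graph.neighborSet w) := by
      rw [← hg, RibbonGraph.turn]
      split_ifs
      · exact hT.rot_isCycleOn w
      · exact (hT.rot_isCycleOn w).inv
    have hself : ∀ y ∉ G.graph.neighborSet w, (Ξ.combGraph P).turn w y = y := by
      intro y hy
      rw [← hg] at hy
      have h1 := hT.rot_eq_self w y hy
      rw [RibbonGraph.turn]
      split_ifs
      · exact h1
      · rw [Equiv.Perm.inv_eq_iff_eq, h1]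
    -- Only the values at the at most two stops are left, and cyclicity determines them.
    refine (F.turn_isCycleOn w).eq_of_agree hcyc (fun y hy => F.turn_eq_self hy) hself
      (FoldPath.stop_adj h1) (FoldPath.stop_adj h2) fun y hy hv hv' => ?_
    exact F.turn_eq hP hy fun hs => (h3 _ hs).elim hv hv'
  ext1
  · exact hg
  · exact F.black_combGraph P
  · exact F.tree.weight_combGraph hc
  · ext1 w
    have := hturn w
    rw [RibbonGraph.turn, RibbonGraph.turn, F.black_combGraph P] at this
    split_ifs at this
    · exact this.symm
    · exact (inv_injective this).symm

end FoldLayout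

/-! ### Folding a combed permutation -/

theorem Fin.strictMono_of_steps {N : ℕ} {f : Fin N → ℝ}
    (h : ∀ j (hj : j < N), 0 < j → f ⟨j - 1, by omega⟩ < f ⟨j, hj⟩) : StrictMono f := by
  cases N with
  | zero => exact fun i => i.elim0
  | succ n => exact Fin.strictMono_iff_lt_succ.2 fun i => h (i + 1) (by omega) (by omega)

/-- An arc whose rectangle lies on the axis, from above. -/
def UpperAxisArc (h : ℕ → ℝ) (k l : ℕ) : Prop :=
  UpperArc h k l ∧ h k ≤ 0 ∧ h (l + 1) ≤ 0

/-- An arc whose rectangle lies on the axis. -/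
def AxisArc (h : ℕ → ℝ) (k l : ℕ) : Prop :=
  UpperAxisArc h k l ∨ UpperAxisArc (-h) k l

theorem AxisArc.arc {h : ℕ → ℝ} {k l : ℕ} (a : AxisArc h k l) : Arc h k l :=
  a.imp And.left And.left

theorem UpperAxisArc.right_unique {h : ℕ → ℝ} {k l l' : ℕ} (a : UpperAxisArc h k l)
    (b : UpperAxisArc h k l') : l = l' := by
  rcases lt_trichotomy l l' with hlt | he | hlt
  · have := (b.1.2 (l + 1) (by have := a.1.1; omega) hlt).1
    have := a.2.2
    linarith
  · exact he
  · have := (a.1.2 (l' + 1) (by have := b.1.1; omega) hlt).1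
    have := b.2.2
    linarith

theorem UpperAxisArc.left_unique {h : ℕ → ℝ} {k k' l : ℕ} (a : UpperAxisArc h k l)
    (b : UpperAxisArc h k' l) : k = k' := by
  rcases lt_trichotomy k k' with hlt | he | hlt
  · have := (a.1.2 k' hlt b.1.1.le).1
    have := b.2.1
    linarith
  · exact he
  · have := (b.1.2 k hlt a.1.1.le).1
    have := a.2.1
    linarith

theorem TreeSeq.exists_upperAxisArc {N : ℕ} {h : ℕ → ℝ} (H : TreeSeq N h) {k : ℕ} (hk : k + 1 < N)
    (h0 : h k ≤ 0) (h1 : 0 < h (k + 1)) :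
    ∃ l, k < l ∧ l < N ∧ UpperAxisArc h k l ∧ h l * h (l + 1) ≤ 0 := by
  classical
  have hex : ∃ q, k + 1 < q ∧ h q ≤ 0 := ⟨N, hk, H.last.le⟩
  obtain ⟨hq1, hq2⟩ := Nat.find_spec hex
  have hqN : Nat.find hex ≤ N := Nat.find_min' hex ⟨hk, H.last.le⟩
  have hqmin : ∀ j, k < j → j < Nat.find hex → 0 < h j := fun j h2 h3 => by
    rcases Nat.lt_or_ge (k + 1) j with h4 | h4
    · have := Nat.find_min hex h3
      push Not at this
      exact this h4
    · have : j = k + 1 := by omega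
      rwa [this]
  generalize Nat.find hex = q at *
  have e : q - 1 + 1 = q := by omega
  refine ⟨q - 1, by omega, by omega, ⟨⟨by omega, fun j h2 h3 => ?_⟩, h0, by rwa [e]⟩, ?_⟩
  · have := hqmin j h2 (by omega)
    rw [e]
    exact ⟨this, by linarith, by linarith⟩
  · rw [e]
    exact mul_nonpos_of_nonneg_of_nonpos (hqmin _ (by omega) (by omega)).le hq2

/-- From every crossing of the axis but the last, an arc on the axis leads to the next one. -/
theorem TreeSeq.exists_axisArc {N : ℕ} {h : ℕ → ℝ} (H : TreeSeq N h) {k : ℕ} (hk : k + 1 < N)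
    (hc : h k * h (k + 1) ≤ 0) : ∃ l, k < l ∧ l < N ∧ AxisArc h k l ∧ h l * h (l + 1) ≤ 0 := by
  rcases lt_or_gt_of_ne (H.ne_zero (k + 1) (by omega) hk) with h1 | h1
  · have h2 : 0 ≤ h k := by
      by_contra hn
      have := mul_pos_of_neg_of_neg (not_le.1 hn) h1
      linarith
    obtain ⟨l, a1, a2, a3, a4⟩ := H.negate.exists_upperAxisArc hk (by simpa using h2)
      (by simpa using h1)
    exact ⟨l, a1, a2, Or.inr a3, by simpa using a4⟩
  · have h2 : h k ≤ 0 := by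
      by_contra hn
      have := mul_pos (not_le.1 hn) h1
      linarith
    obtain ⟨l, a1, a2, a3, a4⟩ := H.exists_upperAxisArc hk h2 h1
    exact ⟨l, a1, a2, Or.inl a3, a4⟩

namespace FoldLayout

/-- Each turn within a stack divides the distance by three. -/
theorem x_turn {N : ℕ} {Ξ : FullPassport N} {G : RibbonGraph N} {a b : Fin N}
    {p : G.graph.Walk a b} {x : Fin N → ℝ} (F : FoldLayout Ξ G p x) {w u : Fin N}
    (h : G.graph.Adj w u) (hs : ¬ Stop p w (G.turn w u)) :
    x (G.turn w u) = x w + (x u - x w) / 3 := by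
  obtain ⟨v, i, h1, h2, rfl⟩ := F.exists_index h
  rw [← Equiv.Perm.mul_apply, ← pow_succ'] at hs ⊢
  have hf : Free p w v (i + 1) := fun j hj1 hj2 => by
    rcases Nat.lt_or_ge i j with h | h
    · have : j = i + 1 := by omega
      rwa [this]
    · exact h2 j hj1 h
  rw [F.x_turn_pow h1 hf, F.x_turn_pow h1 h2, pow_succ]
  ring

end FoldLayout

namespace FullPassport

variable {N : ℕ} {Ξ : FullPassport N} {P : Equiv.Perm (Fin N)}

/-- All arcs that start at the same position lie on the same side of the axis. -/
theorem upperArc_same_left {h : ℕ → ℝ} (hh : h = Ξ.cumSum P ∨ h = -Ξ.cumSum P) {k l z : Fin N}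
    (a : UpperArc h k l) (b : Ξ.HasRect P k z) : UpperArc h k z := by
  rcases hh with rfl | rfl
  · exact upperArc_of_left b (wt_pos_of_upperArc_left a)
  · exact lowerArc_of_left b (wt_neg_of_lowerArc_left a)

theorem upperArc_same_right {h : ℕ → ℝ} (hh : h = Ξ.cumSum P ∨ h = -Ξ.cumSum P) {k l z : Fin N}
    (a : UpperArc h k l) (b : Ξ.HasRect P z l) : UpperArc h z l := by
  rcases hh with rfl | rfl
  · exact upperArc_of_right b (wt_neg_of_upperArc_right a)
  · exact lowerArc_of_right b (wt_pos_of_lowerArc_right a)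

theorem hasRect_of_upperArc {h : ℕ → ℝ} (hh : h = Ξ.cumSum P ∨ h = -Ξ.cumSum P) {k l : Fin N}
    (a : UpperArc h k l) : Ξ.HasRect P k l := by
  rw [hasRect_iff]
  rcases hh with rfl | rfl
  · exact Or.inl a
  · exact Or.inr a

theorem axisArc_right_unique {k l l' : Fin N} (a : AxisArc (Ξ.cumSum P) k l)
    (b : AxisArc (Ξ.cumSum P) k l') : l = l' := by
  rcases a with a | a <;> rcases b with b | b
  · exact Fin.ext (a.right_unique b)
  · exact absurd (wt_pos_of_upperArc_left a.1) (wt_neg_of_lowerArc_left b.1).not_gt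
  · exact absurd (wt_pos_of_upperArc_left b.1) (wt_neg_of_lowerArc_left a.1).not_gt
  · exact Fin.ext (a.right_unique b)

theorem axisArc_left_unique {k k' l : Fin N} (a : AxisArc (Ξ.cumSum P) k l)
    (b : AxisArc (Ξ.cumSum P) k' l) : k = k' := by
  rcases a with a | a <;> rcases b with b | b
  · exact Fin.ext (a.left_unique b)
  · exact absurd (wt_neg_of_upperArc_right a.1) (wt_pos_of_lowerArc_right b.1).not_gt
  · exact absurd (wt_neg_of_upperArc_right b.1) (wt_pos_of_lowerArc_right a.1).not_gt
  · exact Fin.ext (a.left_unique b)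

/-- At the left end of an arc, the turn leads to the arc that rests on it left of its bottom. -/
theorem turn_left_child {h : ℕ → ℝ} (hh : h = Ξ.cumSum P ∨ h = -Ξ.cumSum P) {k l m : Fin N}
    (a : UpperArc h k l) (hm : IsBottom h k l (m + 1)) (hkm : k < m) :
    (Ξ.combGraph P).turn (P k) (P l) = P m := by
  have hml : m < l := hm.2.1
  refine turn_comb_right (hasRect_of_upperArc hh a) (hasRect_of_upperArc hh ?_) hml
    fun z hz hzl hmz => ?_
  · simpa using a.left_child hm (by omega)
  · have := UpperArc.le_of_left hm (upperArc_same_left hh a hz) hzl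
    omega

/-- At the right end of an arc, the turn leads to the arc that rests on it right of its bottom. -/
theorem turn_right_child {h : ℕ → ℝ} (hh : h = Ξ.cumSum P ∨ h = -Ξ.cumSum P) {k l m : Fin N}
    (a : UpperArc h k l) (hm : IsBottom h k l m) (hml : m < l) :
    (Ξ.combGraph P).turn (P l) (P k) = P m := by
  refine turn_comb_left (hasRect_of_upperArc hh a)
    (hasRect_of_upperArc hh (a.right_child hm hml)) hm.1 fun z hz hkz hzm => ?_
  have := UpperArc.le_of_right hm (upperArc_same_right hh a hz) hkz
  omega

section

variable {a b : Fin N} {p : (Ξ.combGraph P).graph.Walk a b} {x : Fin N → ℝ}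

/-- No stack of rectangles at `P k` or `P l` starts between the positions `k` and `l`. -/
def Clear (p : (Ξ.combGraph P).graph.Walk a b) (k l : Fin N) : Prop :=
  (∀ z, k < z → Stop p (P k) (P z) → l ≤ z) ∧ ∀ z, z < l → Stop p (P l) (P z) → z ≤ k

/-- The vertical segments of the vertices between the ends of an arc are in the order of the
positions: a rectangle splits the interval below it at its lowest step, and the two rectangles
stacked on it have a third of its length. -/
theorem step_lt (F : FoldLayout Ξ (Ξ.combGraph P) p x) {h : ℕ → ℝ}
    (hh : h = Ξ.cumSum P ∨ h = -Ξ.cumSum P) (H : TreeSeq N h) (n : ℕ) :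
    ∀ k l : Fin N, l.val - k.val ≤ n → UpperArc h k l → Clear p k l → x (P k) < x (P l) →
      ∀ j (hj : j < N), (k : ℕ) < j → j ≤ l → x (P ⟨j - 1, by omega⟩) < x (P ⟨j, hj⟩) := by
  induction n with
  | zero => intro k l hn a; have := a.1; omega
  | succ n ih =>
    intro k l hn a hcl hx
    obtain ⟨m', hm⟩ := H.exists_bottom l.2 a
    obtain ⟨m, rfl⟩ : ∃ m, m' = m + 1 := ⟨m' - 1, by have := hm.1; omega⟩
    have hm1 := hm.1
    have hm2 := hm.2.1
    have hadj := combGraph_adj.2 (Or.inl (hasRect_of_upperArc hh a))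
    -- The bottom `m + 1` is the step from position `s` to position `t`; the arcs from `k` to `s` and from
    -- `t` to `l` rest on this one, unless they are degenerate.
    set s : Fin N := ⟨m, by omega⟩ with hs
    set t : Fin N := ⟨m + 1, by omega⟩ with ht
    have hleft : k < s → x (P s) = x (P k) + (x (P l) - x (P k)) / 3 ∧ Clear p k s := by
      intro hks
      have e := turn_left_child (m := s) hh a hm hks
      have hst : ¬ Stop p (P k) (P s) := fun hst => by
        have := hcl.1 s hks hst
        have : s < l := hm2
        omega
      have hx := F.x_turn hadj (by rwa [e])
      rw [e] at hx
      have hadj' := combGraph_adj.2 (Or.inl (hasRect_of_upperArc hh (k := k) (l := s)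
        (by simpa using a.left_child hm (Nat.succ_lt_succ hks))))
      have hch := (F.stop_or_child hadj').resolve_left hst
      refine ⟨hx, fun z hz hsz => ?_, fun z hz hsz => ?_⟩
      · have := hcl.1 z hz hsz
        have : s < l := hm2
        omega
      · exact (P.injective (F.stop_eq_of_notMem (F.not_mem_support_of_child hch) hsz
          (Or.inr hch))).le
    have hright : t < l → x (P t) = x (P l) + (x (P k) - x (P l)) / 3 ∧ Clear p t l := by
      intro htl
      have e := turn_right_child (m := t) hh a hm htl
      have hst : ¬ Stop p (P l) (P t) := fun hst => by
        have := hcl.2 t htl hst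
        have : k < t := hm1
        omega
      have hx := F.x_turn hadj.symm (by rwa [e])
      rw [e] at hx
      have hadj' := combGraph_adj.2 (Or.inr (hasRect_of_upperArc hh (k := t) (l := l)
        (a.right_child hm htl)))
      have hch := (F.stop_or_child hadj').resolve_left hst
      refine ⟨hx, fun z hz hsz => ?_, fun z hz hsz => ?_⟩
      · exact (P.injective (F.stop_eq_of_notMem (F.not_mem_support_of_child hch) hsz
          (Or.inr hch))).ge
      · have := hcl.2 z hz hsz
        have : k < t := hm1
        omega
    have hs3 : x (P s) ≤ x (P k) + (x (P l) - x (P k)) / 3 := by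
      rcases (show k ≤ s by rw [Fin.le_def]; simp only [hs]; omega).eq_or_lt with he | hks
      · rw [← he]; linarith
      · exact (hleft hks).1.le
    have ht3 : x (P l) + (x (P k) - x (P l)) / 3 ≤ x (P t) := by
      rcases (show t ≤ l by rw [Fin.le_def]; simp only [ht]; omega).eq_or_lt with he | htl
      · rw [he]; linarith
      · exact (hright htl).1.ge
    intro j hj h1 h2
    rcases lt_trichotomy j (m + 1) with h3 | rfl | h3
    · have hks : k < s := by rw [Fin.lt_def]; simp only [hs]; omega
      obtain ⟨g1, g2⟩ := hleft hks
      refine ih k s (by simp only [hs]; omega) ?_ g2 (by linarith) j hj h1 (by simp only [hs]; omega)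
      simpa using a.left_child hm (Nat.succ_lt_succ hks)
    · exact lt_of_le_of_lt hs3 (lt_of_lt_of_le (by linarith) ht3)
    · have htl : t < l := by rw [Fin.lt_def]; simp only [ht]; omega
      obtain ⟨g1, g2⟩ := hright htl
      exact ih t l (by simp only [ht]; omega) (a.right_child hm htl) g2 (by linarith) j hj h3 h2

end

/-- The arcs on the axis form a path in the combed graph, from every crossing `k` of the axis to the
last position; they cover all steps after `k`. The product of the heights before and after `k` is
not positive exactly at the crossings. -/
theorem exists_axis_walk (hP : Ξ.IsTreePermutation P) (n : ℕ) : ∀ k e : Fin N, (e : ℕ) = N - 1 →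
    N - 1 - k.val ≤ n → Ξ.cumSum P k * Ξ.cumSum P (k + 1) ≤ 0 →
    ∃ q : (Ξ.combGraph P).graph.Walk (P k) (P e), q.IsPath ∧
      (∀ z, P z ∈ q.support → k ≤ z) ∧
      (∀ i < q.length, ∃ k' l' : Fin N, q.getVert i = P k' ∧ q.getVert (i + 1) = P l' ∧
        AxisArc (Ξ.cumSum P) k' l') ∧
      ∀ m, k.val < m → m < N → ∃ i < q.length, ∃ k' l' : Fin N, q.getVert i = P k' ∧
        q.getVert (i + 1) = P l' ∧ AxisArc (Ξ.cumSum P) k' l' ∧ k'.val < m ∧ m ≤ l'.val := by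
  induction n with
  | zero =>
    intro k e he hn _
    obtain rfl : k = e := Fin.ext (by omega)
    exact ⟨.nil, .nil, fun z hz => (show k = z by simpa [eq_comm] using hz).le, by simp, by omega⟩
  | succ n ih =>
    intro k e he hn hc
    rcases Nat.lt_or_ge (k + 1) N with hk | hk
    · obtain ⟨l, hkl, hl, hax, hcl⟩ := hP.treeSeq.exists_axisArc hk hc
      obtain ⟨q, h1, h2, h3, h4⟩ := ih ⟨l, hl⟩ e he (by simp only; omega) hcl
      have hadj : (Ξ.combGraph P).graph.Adj (P k) (P ⟨l, hl⟩) :=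
        combGraph_adj.2 (Or.inl (hasRect_iff.2 hax.arc))
      refine ⟨.cons hadj q, ?_, ?_, ?_, ?_⟩
      · rw [SimpleGraph.Walk.cons_isPath_iff]
        refine ⟨h1, fun hm => ?_⟩
        have := h2 k hm
        rw [Fin.le_def] at this
        simp only at this
        omega
      · intro z hz
        rw [SimpleGraph.Walk.support_cons, List.mem_cons] at hz
        rcases hz with hz | hz
        · exact (P.injective hz).ge
        · have := h2 z hz
          rw [Fin.le_def] at this ⊢
          simp only at this
          omega
      · intro i hi
        cases i with
        | zero => exact ⟨k, ⟨l, hl⟩, by simp, by simp, hax⟩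
        | succ i =>
          rw [SimpleGraph.Walk.length_cons] at hi
          simpa using h3 i (by omega)
      · intro m hm1 hm2
        rcases Nat.lt_or_ge l m with hm | hm
        · obtain ⟨i, hi, h⟩ := h4 m hm hm2
          exact ⟨i + 1, by simpa using hi, by simpa using h⟩
        · exact ⟨0, by simp, k, ⟨l, hl⟩, by simp, by simp, hax, hm1, hm⟩
    · obtain rfl : k = e := Fin.ext (by omega)
      exact ⟨.nil, .nil, fun z hz => (show k = z by simpa [eq_comm] using hz).le, by simp, by omega⟩

end FullPassport

/-! ### Comb and fold are inverse to each other -/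

/-- The path is unique, so that `vertexX` agrees with every rectangle drawn along it. -/
theorem MarkedRibbonGraph.foldLayout {N : ℕ} {Ξ : FullPassport N} {M : MarkedRibbonGraph N}
    (hM : M ∈ Ξ.twiceMarkedTrees) {p : M.G.graph.Walk M.a M.b} (hp : p.IsPath) :
    FoldLayout Ξ M.G p M.vertexX := by
  have F : FoldPath Ξ M.G p := ⟨hM.1, hp, Nat.pos_of_ne_zero fun h =>
    hM.2 (SimpleGraph.Walk.eq_of_length_eq_zero h)⟩
  refine ⟨F, fun v w r h => ?_⟩
  have hex : ∃ y, M.HasVertexAt w y := ⟨r.xw, p, hp, v, r, h, rfl⟩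
  rw [MarkedRibbonGraph.vertexX, dif_pos hex]
  obtain ⟨p', hp', u, r', h', he⟩ := hex.choose_spec
  obtain rfl := (F.isTree.existsUnique_path M.a M.b).unique hp' hp
  rw [← he]
  exact F.drawn_unique h h'

namespace FullPassport

variable {N : ℕ} {Ξ : FullPassport N}

/-- The vertical segments of the tree of a tree permutation are in the order of the permutation. -/
theorem strictMono_vertexX {P : Equiv.Perm (Fin N)} (hP : Ξ.IsTreePermutation P) :
    StrictMono ((Ξ.comb P).vertexX ∘ P) := by
  have hN := Ξ.one_lt
  obtain ⟨p, hp, -, hax, hcov⟩ := exists_axis_walk hP N ⟨0, Ξ.nonempty⟩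
    ⟨N - 1, Nat.sub_one_lt_of_lt Ξ.nonempty⟩ rfl (by omega) (by simp [cumSum_zero])
  have F := MarkedRibbonGraph.foldLayout (comb_mem hP) (p := p) hp
  have F' : FoldLayout Ξ (Ξ.combGraph P) p (Ξ.comb P).vertexX := F
  have hnext : ∀ k z : Fin N, P k ∈ p.support → Stop p (P k) (P z) →
      (k < z ∧ AxisArc (Ξ.cumSum P) k z) ∨ (z < k ∧ AxisArc (Ξ.cumSum P) z k) := by
    rintro k z hk (hs | hs)
    · obtain ⟨i, hi, h⟩ := FoldPath.mem_edges hs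
      obtain ⟨k', l', h1, h2, h3⟩ := hax i hi
      have hlt := h3.arc.lt
      rw [h1, h2] at h
      rcases h with ⟨e1, e2⟩ | ⟨e1, e2⟩
      · obtain rfl := P.injective e1
        obtain rfl := P.injective e2
        exact Or.inl ⟨hlt, h3⟩
      · obtain rfl := P.injective e1
        obtain rfl := P.injective e2
        exact Or.inr ⟨hlt, h3⟩
    · exact absurd hk (F'.not_mem_support_of_child hs)
  refine Fin.strictMono_of_steps fun j hj hj0 => ?_
  obtain ⟨i, hi, k, l, h1, h2, h3, h4, h5⟩ := hcov j hj0 hj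
  have hk : P k ∈ p.support := h1 ▸ p.getVert_mem_support i
  have hl : P l ∈ p.support := h2 ▸ p.getVert_mem_support (i + 1)
  have hcl : Clear p k l := by
    refine ⟨fun z hz hs => ?_, fun z hz hs => ?_⟩
    · rcases hnext k z hk hs with h | h
      · exact (axisArc_right_unique h3 h.2).le
      · exact absurd hz h.1.not_gt
    · rcases hnext l z hl hs with h | h
      · exact absurd hz h.1.not_gt
      · exact (axisArc_left_unique h3 h.2).ge
  have hx : (Ξ.comb P).vertexX (P k) < (Ξ.comb P).vertexX (P l) := by
    rw [← h1, ← h2, F'.x_getVert hi.le, F'.x_getVert hi]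
    exact_mod_cast Nat.lt_succ_self i
  rcases h3 with a | a
  · exact step_lt F' (Or.inl rfl) hP.treeSeq _ k l le_rfl a.1 hcl hx j hj h4 h5
  · exact step_lt F' (Or.inr rfl) hP.treeSeq.negate _ k l le_rfl a.1 hcl hx j hj h4 h5

/-- Folding is a left inverse of combing on tree permutations. -/
theorem fold_comb {P : Equiv.Perm (Fin N)} (hP : Ξ.IsTreePermutation P) :
    (Ξ.comb P).fold = P := by
  have h := strictMono_vertexX hP
  exact (Tuple.eq_sort_iff.2 ⟨h.monotone, fun i j hij he => absurd he (h hij).ne⟩).symm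

theorem exists_foldLayout {M : MarkedRibbonGraph N} (hM : M ∈ Ξ.twiceMarkedTrees) :
    ∃ p, FoldLayout Ξ M.G (a := M.a) (b := M.b) p M.vertexX ∧
      StrictMono (M.vertexX ∘ M.fold) := by
  obtain ⟨p, hp, -⟩ := (hM.1.connected M.a M.b).exists_path_of_dist
  have F := MarkedRibbonGraph.foldLayout hM hp
  exact ⟨p, F, (Tuple.monotone_sort _).strictMono_of_injective
    (F.x_injective.comp M.fold.injective)⟩

theorem fold_mem {M : MarkedRibbonGraph N} (hM : M ∈ Ξ.twiceMarkedTrees) :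
    Ξ.IsTreePermutation M.fold := by
  obtain ⟨p, F, hmono⟩ := exists_foldLayout hM
  exact F.isTreePermutation hmono

/-- Folding is a right inverse of combing on twice-marked trees. The marked vertices have the
extreme positions `0` and `p.length`. -/
theorem comb_fold {M : MarkedRibbonGraph N} (hM : M ∈ Ξ.twiceMarkedTrees) :
    Ξ.comb M.fold = M := by
  obtain ⟨p, F, hmono⟩ := exists_foldLayout hM
  have hrange : ∀ v, 0 ≤ M.vertexX v ∧ M.vertexX v ≤ p.length := by
    intro v
    obtain ⟨u, -, hs, -⟩ := F.stop_cases v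
    obtain ⟨j, hj, ⟨h1, h2⟩, -⟩ := F.side (FoldPath.stop_adj hs)
    have h3 : (0 : ℝ) ≤ j := Nat.cast_nonneg j
    have h4 : (j : ℝ) + 1 ≤ p.length := by exact_mod_cast hj
    constructor <;> linarith
  have ha : M.vertexX M.a = 0 := by simpa using F.x_getVert (Nat.zero_le _)
  have hb : M.vertexX M.b = p.length := by simpa using F.x_getVert le_rfl
  ext1
  · exact F.combGraph_eq hmono
  · obtain ⟨i, hi⟩ := M.fold.surjective M.a
    have h1 := hmono.monotone (show (⟨0, Ξ.nonempty⟩ : Fin N) ≤ i from Nat.zero_le _)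
    simp only [Function.comp_apply, hi, ha] at h1
    exact F.x_injective ((le_antisymm h1 (hrange _).1).trans ha.symm)
  · obtain ⟨i, hi⟩ := M.fold.surjective M.b
    have h1 := hmono.monotone (show i ≤ (⟨N - 1, Nat.sub_one_lt_of_lt Ξ.nonempty⟩ : Fin N) from
      Nat.le_sub_one_of_lt i.2)
    simp only [Function.comp_apply, hi, hb] at h1
    exact F.x_injective ((le_antisymm (hrange _).2 h1).trans hb.symm)

end FullPassport

theorem theorem2p9 {N : ℕ} (Ξ : FullPassport N) :
    Set.BijOn Ξ.comb Ξ.treePermutations Ξ.twiceMarkedTrees ∧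
    Set.MapsTo MarkedRibbonGraph.fold Ξ.twiceMarkedTrees Ξ.treePermutations ∧
    Set.InvOn MarkedRibbonGraph.fold Ξ.comb Ξ.treePermutations Ξ.twiceMarkedTrees := by
  have hinv : Set.InvOn MarkedRibbonGraph.fold Ξ.comb Ξ.treePermutations Ξ.twiceMarkedTrees :=
    ⟨fun _ hP => FullPassport.fold_comb hP, fun _ hM => FullPassport.comb_fold hM⟩
  have hcomb : Set.MapsTo Ξ.comb Ξ.treePermutations Ξ.twiceMarkedTrees :=
    fun _ hP => FullPassport.comb_mem hP
  have hfold : Set.MapsTo MarkedRibbonGraph.fold Ξ.twiceMarkedTrees Ξ.treePermutations :=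
    fun _ hM => FullPassport.fold_mem hM
  exact ⟨hinv.bijOn hcomb hfold, hfold, hinv⟩
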